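/- Let $\epsilon\neq 0$, $\delta>0$ and $R\in(0,\infty)\setminus\{1\}$ be fixed (in the Merton problem with proportional transaction costs, $\epsilon=\mu/\beta$ and $\delta^2=\sigma^2/\beta$, where $\mu,\sigma$ are the drift and volatility of the risky asset, $\beta$ is the discount rate and $R$ the relative risk aversion). Put $q_M=\epsilon/(\delta^2R)$ (the Merton proportion) and $$m(q)=1-\epsilon(1-R)q+\tfrac{\delta^2}{2}R(1-R)q^2,\quad \ell(q)=m(q)+\tfrac{\delta^2}{2}(1-R)q(1-q),\quad O(q,n)=\frac{1-R}{R}\,\frac{n}{1-q}\,\frac{m(q)-n}{\ell(q)-n}.$$ *Free boundaries.* For $\xi>0$ we say that $q_*<q^*$ are the free boundaries for the round-trip transaction cost $\xi$ if there is a positive $n\in C^1([q_*,q^*])$ such that $n\ne\ell$ and $n'=O(q,n)$ on $(q_*,q^*)\setminus\{0,1\}$; $n(q_*)=m(q_*)$ and $n(q^*)=m(q^*)$; $(1-R)n\ge(1-R)m$ on $[q_*,q^*]$; $n'(q^*)=0$, and $n'(q_*)=0$ unless $q_*=1$ (one-sided derivatives); and $$\int_{q_*}^{q^*}\frac{1}{q(1-q)}\,\frac{n(q)-m(q)}{\ell(q)-n(q)}\,dq=\ln(1+\xi),$$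 the integral being convergent. *Well-posedness.* For $R<1$ and $|\epsilon|>\delta\sqrt{2R/(1-R)}$ let $q_-<q_+$ be the roots of $m$ and $\underline\xi=\exp\Big(\int_{q_-}^{q_+}\frac{1}{q(1-q)}\frac{|m(q)|}{\ell(q)}\,dq\Big)-1$. The problem is called well-posed for $\xi$ if $R>1$; or $R<1$, $|\epsilon|\le\delta\sqrt{2R/(1-R)}$ and $\epsilon<\frac1{1-R}+\frac{\delta^2R}2$; or $R<1$, $\delta\sqrt{2R/(1-R)}<\epsilon<\frac1{1-R}+\frac{\delta^2R}2$ and $\xi>\underline\xi$; or $R<1$, $\epsilon<-\delta\sqrt{2R/(1-R)}$ and $\xi>\underline\xi$. It is called well-posed for some (for all) costs if this holds for some (for all) $\xi>0$. *Wedge.* For transaction costs $\lambda\ge0$ on purchases and $\gamma\in[0,1)$ on sales with $\lambda+\gamma>0$ let $\xi=\frac{\lambda+\gamma}{1-\gamma}$; if $q_*,q^*$ are the free boundaries for $\xi$, the purchase and sale boundaries of the no-transaction wedge are $$p_*(\lambda,\gamma)=\frac{q_*}{1+\lambda-\lambda q_*},\qquad p^*(\lambda,\gamma)=\frac{q^*}{1-\gamma+\gamma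 q^*}.$$ **Theorem.** If the problem is well-posed for $\xi>0$, then the free boundaries $q_*(\xi),q^*(\xi)$ exist and are unique. Moreover, wherever the free boundaries exist, the following hold. (a) (i) $q^*$ is non-decreasing in $\xi$ and $q_*$ is strictly decreasing in $\xi$. (ii) If $\epsilon>\delta^2R$ and the problem is well-posed for some cost, then there are a unique $\overline\xi>0$ for which $q_*=1$, and a number $\overline q$, such that for every $\xi\ge\overline\xi$ the free boundaries exist and satisfy $q_*\le1$ and $q^*=\overline q$; so $q^*$ does not depend on $\xi\ge\overline\xi$. (b) (i) If $0<\epsilon<\delta^2R$, then $p_*$ is strictly decreasing in $\lambda$ and in $\gamma$, $p^*$ is strictly increasing in $\lambda$ and in $\gamma$, and $0<p_*<q_M<p^*<1$; in particular the Merton line lies in the wedge. (ii) If $\epsilon>\delta^2R$, then $p^*>1$; if moreover the problem is well-posed for some cost, there are $\lambda,\gamma$ with $p^*(\lambda,\gamma)<q_M$, so that the Merton line lies outside the wedge; and if it is well-posed for all costs, there is $\lambda$ such that $\gamma\mapsto p^*(\lambda,\gamma)$ is not monotone: there are $\gamma_1<\gamma_2<\gamma_3$ with $p^*(\lambda,\gamma_2)>\max\{p^*(\lambda,\gamma_1),p^*(\lambda,\gamma_3)\}$.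 If $\epsilon<0$, then $p_*<p^*<0$; there are $\lambda,\gamma$ with $q_M<p_*(\lambda,\gamma)$, so that the Merton line lies outside the wedge; and if the problem is well-posed for all costs, there is $\gamma$ such that $\lambda\mapsto p_*(\lambda,\gamma)$ is not monotone: there are $\lambda_1<\lambda_2<\lambda_3$ with $p_*(\lambda_2,\gamma)<\min\{p_*(\lambda_1,\gamma),p_*(\lambda_3,\gamma)\}$. -/

import Mathlib

open Set

namespace MertonTC

noncomputable section

/-- The quadratic `m(q) = 1 - ε(1-R)q + (δ²/2)R(1-R)q²`, with `ε = μ/β` and `δ² = σ²/β`. -/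
def m (ε δ R q : ℝ) : ℝ :=
  1 - ε * (1 - R) * q + δ ^ 2 / 2 * R * (1 - R) * q ^ 2

/-- The quadratic `ℓ(q) = m(q) + (δ²/2)(1-R)q(1-q)`. -/
def ell (ε δ R q : ℝ) : ℝ :=
  m ε δ R q + q * (1 - q) * (δ ^ 2 / 2) * (1 - R)

/-- The slope field `O(q, n)` of the first-order equation `n' = O(q, n)`. It is used only at points
with `q ≠ 1` and `n ≠ ℓ(q)`. -/
def slope (ε δ R q n : ℝ) : ℝ :=
  (1 - R) / R * (n / (1 - q)) * ((m ε δ R q - n) / (ell ε δ R q - n))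

/-- The Merton proportion, which is the turning point of `m`. -/
def qM (ε δ R : ℝ) : ℝ := ε / (δ ^ 2 * R)

/-- `n` is a positive `C¹` solution of the free-boundary problem on `[a, b]`: it solves
`n' = O(q, n)` on the open interval away from the singular points `0` and `1`, it agrees with `m` at
both end points, and it does not cross `m` before `b`. Smooth fit (`n' = 0`) is
imposed at both end points, except that a lower end point sitting at the singular point `1` only
has to satisfy `n(1) = m(1)`. -/
structure SolvesFBP (ε δ R : ℝ) (n : ℝ → ℝ) (a b : ℝ) : Prop where
  lt : a < b
  contDiffOn : ContDiffOn ℝ 1 n (Icc a b)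
  pos : ∀ q ∈ Icc a b, 0 < n q
  ne_ell : ∀ q ∈ Ioo a b, q ≠ 0 → q ≠ 1 → n q ≠ ell ε δ R q
  ode : ∀ q ∈ Ioo a b, q ≠ 0 → q ≠ 1 → HasDerivAt n (slope ε δ R q (n q)) q
  left_eq : n a = m ε δ R a
  right_eq : n b = m ε δ R b
  no_crossing : ∀ q ∈ Icc a b, (1 - R) * m ε δ R q ≤ (1 - R) * n q
  left_smooth : a ≠ 1 → HasDerivWithinAt n 0 (Icc a b) a
  right_smooth : HasDerivWithinAt n 0 (Icc a b) b

/-- The integrand of the integral condition which selects the round-trip cost. -/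
def costIntegrand (ε δ R : ℝ) (n : ℝ → ℝ) (q : ℝ) : ℝ :=
  1 / (q * (1 - q)) * ((n q - m ε δ R q) / (ell ε δ R q - n q))

/-- `a = q_*(ξ)` and `b = q^*(ξ)` are the free boundaries for the round-trip transaction cost
`ξ > 0`: there is a solution of the free-boundary problem on `[a, b]` for which the integral of
`costIntegrand` converges and equals `log (1 + ξ)`. -/
def IsFreeBoundary (ε δ R ξ a b : ℝ) : Prop :=
  0 < ξ ∧ ∃ n : ℝ → ℝ, SolvesFBP ε δ R n a b ∧
    IntervalIntegrable (costIntegrand ε δ R n) MeasureTheory.volume a b ∧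
    ∫ q in a..b, costIntegrand ε δ R n q = Real.log (1 + ξ)

/-- The smaller root of `m`, when `m` has real roots and `R < 1`. -/
def rootMinus (ε δ R : ℝ) : ℝ :=
  (ε - Real.sqrt (ε ^ 2 - δ ^ 2 * (2 * R / (1 - R)))) / (δ ^ 2 * R)

/-- The larger root of `m`, when `m` has real roots and `R < 1`. -/
def rootPlus (ε δ R : ℝ) : ℝ :=
  (ε + Real.sqrt (ε ^ 2 - δ ^ 2 * (2 * R / (1 - R)))) / (δ ^ 2 * R)

/-- The threshold round-trip cost between ill-posedness and well-posedness, for `R < 1` and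
parameters for which `m` takes negative values. -/
def lowerCost (ε δ R : ℝ) : ℝ :=
  Real.exp (∫ q in (rootMinus ε δ R)..(rootPlus ε δ R),
    1 / (q * (1 - q)) * (|m ε δ R q| / ell ε δ R q)) - 1

/-- The parameter regimes in which the consumption/investment problem with round-trip transaction
cost `ξ` is well-posed. -/
def WellPosed (ε δ R ξ : ℝ) : Prop :=
  1 < R ∨
  (R < 1 ∧ |ε| ≤ δ * Real.sqrt (2 * R / (1 - R)) ∧ ε < 1 / (1 - R) + δ ^ 2 * R / 2) ∨
  (R < 1 ∧ δ * Real.sqrt (2 * R / (1 - R)) < ε ∧ ε < 1 / (1 - R) + δ ^ 2 * R / 2 ∧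
    lowerCost ε δ R < ξ) ∨
  (R < 1 ∧ ε < -(δ * Real.sqrt (2 * R / (1 - R))) ∧ lowerCost ε δ R < ξ)

/-- Admissible proportional costs: `lam` on purchases and `gam` on sales, not both zero. -/
def Costs (lam gam : ℝ) : Prop := 0 ≤ lam ∧ 0 ≤ gam ∧ gam < 1 ∧ 0 < lam + gam

/-- The round-trip transaction cost `ξ = (1 + λ)/(1 - γ) - 1 = (λ + γ)/(1 - γ)`. -/
def roundTrip (lam gam : ℝ) : ℝ := (lam + gam) / (1 - gam)

/-- `p = p_*(λ, γ)` is the purchase boundary and `P = p^*(λ, γ)` the sale boundary of the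
no-transaction wedge, in terms of the proportion of paper wealth held in the risky asset. -/
def IsWedge (ε δ R lam gam p P : ℝ) : Prop :=
  Costs lam gam ∧ ∃ a b : ℝ, IsFreeBoundary ε δ R (roundTrip lam gam) a b ∧
    p = a / (1 + lam - lam * a) ∧ P = b / (1 - gam + gam * b)

end

end MertonTC

/-!
Reflecting `p = σ q` with `σ = sign ε` and passing to `Z = log n / c`, `c = (1 - R) / R`, turns all
parameter regimes into one problem on `p > 0` (`Params`, `FB`). With `V = (n - m) / κ`,
`κ = (δ² / 2) (1 - R)` and `s = q (1 - q)`, the equation reads `Z' = -p G` with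
`G = V / (s (s - V))`, and `G` is exactly the integrand of the cost. Both `V` and `G` increase
with `Z` whatever the sign of `1 - R`, so everything rests on comparing solutions.

*Comparison.* A solution that starts further left on the graph of `m` stays above the others,
hence it ends later and has a larger cost (`FB.b_le_b`, `FB.integral_lt`, `FB.b_lt_b`). This gives
uniqueness and monotonicity. The one singular point is `p = 1` for `σ = 1`, where `m` and `ℓ` meet:
comparing `V` with multiples of `s ^ 2` forces `G → gOne` there (`tendsto_G_left`,
`tendsto_G_right`), and `V = 0` at that point. So for `Q > 1` all solutions starting below `1`
coincide after `1`, and the sale boundary saturates (`FB.restrict_one`, `Cost.b_eq_of_le_one`).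

*Existence.* For every start `a < Q` with `m(a) > 0`, and with `m(1) > 0` in case `σ = 1`, `R < 1`,
the equation with truncated `V` has a Lipschitz right-hand side; barriers show that the truncation is not active, and the solution
returns to `m` beyond `Q` (`exists_FB`). The cost is continuous in `a`, because the difference of
costs is controlled by the difference of the starting values (`FB.integral_sub_le`). It tends to
infinity as `a → 0` (`exists_large_cost`), and its lower limit is `0` if `m(Q) > 0`, or the integral
between the roots of `m` that defines the threshold cost (`eventually_cost_le`,
`eventually_cost_le_of_root`). The intermediate value theorem gives all the well-posed costs
(`exists_cost_of_le`).

*Smooth solutions.* A solution of the original problem cannot lie above `ℓ` on `(0, 1)`, since it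
would blow up at `1`, and smooth fit keeps `0` out of the interval; so it is a solution of the
reduced problem (`Smooth.toFB`, `Models.isFreeBoundary_iff`).

*Wedge.* For a Merton proportion in `(0, 1)` the shape of the wedge follows from the monotonicity
of the free boundaries. In the leveraged and short cases the cost is of lower order than the
distance of the far boundary from `Q` (`eventually_cost_lt_b_sub`), so the boundary of the wedge
first moves away from the Merton line, whereas for extreme costs on one side it tends to `1` or to
`0` and crosses that line.
-/
open Set Filter Topology MeasureTheory


namespace MertonTC

/-! ### Differential inequalities on an interval -/

theorem antitoneOn_Icc_of_hasDerivAt_nonpos {f f' : ℝ → ℝ} {a b : ℝ}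
    (hc : ContinuousOn f (Icc a b)) (hd : ∀ p ∈ Ioo a b, HasDerivAt f (f' p) p)
    (h0 : ∀ p ∈ Ioo a b, f' p ≤ 0) : AntitoneOn f (Icc a b) := by
  refine antitoneOn_of_deriv_nonpos (convex_Icc a b) hc ?_ ?_
  · rw [interior_Icc]
    exact fun p hp => (hd p hp).differentiableAt.differentiableWithinAt
  · rw [interior_Icc]
    exact fun p hp => by rw [(hd p hp).deriv]; exact h0 p hp

theorem monotoneOn_Icc_of_hasDerivAt_nonneg {f f' : ℝ → ℝ} {a b : ℝ}
    (hc : ContinuousOn f (Icc a b)) (hd : ∀ p ∈ Ioo a b, HasDerivAt f (f' p) p)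
    (h0 : ∀ p ∈ Ioo a b, 0 ≤ f' p) : MonotoneOn f (Icc a b) := by
  refine monotoneOn_of_deriv_nonneg (convex_Icc a b) hc ?_ ?_
  · rw [interior_Icc]
    exact fun p hp => (hd p hp).differentiableAt.differentiableWithinAt
  · rw [interior_Icc]
    exact fun p hp => by rw [(hd p hp).deriv]; exact h0 p hp

/-- One point where differentiability is not known does not spoil monotonicity. -/
theorem antitoneOn_Icc_of_hasDerivAt_nonpos_off {f f' : ℝ → ℝ} {a b : ℝ} (x : ℝ)
    (hc : ContinuousOn f (Icc a b)) (hd : ∀ p ∈ Ioo a b, p ≠ x → HasDerivAt f (f' p) p)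
    (h0 : ∀ p ∈ Ioo a b, p ≠ x → f' p ≤ 0) : AntitoneOn f (Icc a b) := by
  have key : ∀ u v, a ≤ u → v ≤ b → (v ≤ x ∨ x ≤ u) → AntitoneOn f (Icc u v) := by
    intro u v hu hv hx
    have hne : ∀ p ∈ Ioo u v, p ≠ x := by
      rintro p ⟨h1, h2⟩ rfl
      rcases hx with h | h <;> linarith
    have hsub : ∀ p ∈ Ioo u v, p ∈ Ioo a b := fun p hp =>
      ⟨lt_of_le_of_lt hu hp.1, lt_of_lt_of_le hp.2 hv⟩
    exact antitoneOn_Icc_of_hasDerivAt_nonpos (hc.mono (Icc_subset_Icc hu hv))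
      (fun p hp => hd p (hsub p hp) (hne p hp)) (fun p hp => h0 p (hsub p hp) (hne p hp))
  intro p hp r hr hpr
  rcases le_total r x with hrx | hrx
  · exact key p r hp.1 hr.2 (Or.inl hrx) ⟨le_rfl, hpr⟩ ⟨hpr, le_rfl⟩ hpr
  rcases le_total x p with hxp | hxp
  · exact key p r hp.1 hr.2 (Or.inr hxp) ⟨le_rfl, hpr⟩ ⟨hpr, le_rfl⟩ hpr
  · exact (key x r (hp.1.trans hxp) hr.2 (Or.inr le_rfl) ⟨le_rfl, hrx⟩ ⟨hrx, le_rfl⟩ hrx).trans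
      (key p x hp.1 (hrx.trans hr.2) (Or.inl le_rfl) ⟨le_rfl, hxp⟩ ⟨hxp, le_rfl⟩ hxp)

/-- A function which starts nonpositive and decreases wherever it is positive stays nonpositive.
Differentiability is needed only where the function is positive. -/
theorem nonpos_of_barrier {φ φ' : ℝ → ℝ} {x y : ℝ} (hc : ContinuousOn φ (Icc x y))
    (hx : φ x ≤ 0) (hd : ∀ p ∈ Ioo x y, 0 < φ p → HasDerivAt φ (φ' p) p)
    (h0 : ∀ p ∈ Ioo x y, 0 < φ p → φ' p ≤ 0) : ∀ p ∈ Icc x y, φ p ≤ 0 := by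
  intro p hp
  by_contra hpos
  push Not at hpos
  have hcp : ContinuousOn φ (Icc x p) := hc.mono (Icc_subset_Icc le_rfl hp.2)
  have hcl : IsCompact (Icc x p ∩ φ ⁻¹' Iic 0) :=
    isCompact_Icc.of_isClosed_subset (hcp.preimage_isClosed_of_isClosed isClosed_Icc isClosed_Iic)
      inter_subset_left
  obtain ⟨r, hr⟩ := hcl.exists_isGreatest ⟨x, ⟨le_rfl, hp.1⟩, hx⟩
  have hrφ : φ r ≤ 0 := hr.1.2
  have hrI : r ∈ Icc x p := hr.1.1
  have hlater : ∀ t ∈ Ioo r p, 0 < φ t := by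
    intro t ht
    by_contra hneg
    push Not at hneg
    exact absurd (hr.2 ⟨⟨hrI.1.trans ht.1.le, ht.2.le⟩, hneg⟩) (not_le.2 ht.1)
  have hsub : ∀ t ∈ Ioo r p, t ∈ Ioo x y := fun t ht =>
    ⟨lt_of_le_of_lt hrI.1 ht.1, lt_of_lt_of_le ht.2 hp.2⟩
  have := antitoneOn_Icc_of_hasDerivAt_nonpos (hcp.mono (Icc_subset_Icc hrI.1 le_rfl))
    (fun t ht => hd t (hsub t ht) (hlater t ht)) (fun t ht => h0 t (hsub t ht) (hlater t ht))
    ⟨le_rfl, hrI.2⟩ ⟨hrI.2, le_rfl⟩ hrI.2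
  linarith

/-- A function on `(x, 1)` with derivative at most `-c / (1 - p)` is unbounded below. -/
theorem not_bddBelow_of_deriv_le {f f' : ℝ → ℝ} {x c B : ℝ} (hx : x < 1) (hc : 0 < c)
    (hd : ∀ p ∈ Ioo x 1, HasDerivAt f (f' p) p)
    (h0 : ∀ p ∈ Ioo x 1, f' p ≤ -(c / (1 - p))) (hB : ∀ p ∈ Ioo x 1, B ≤ f p) : False := by
  obtain ⟨y, hxy, hy1⟩ := exists_between hx
  have hg : ∀ p ∈ Ioo x 1, HasDerivAt (fun p => f p - c * Real.log (1 - p))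
      (f' p + c / (1 - p)) p := by
    intro p hp
    have h1 : HasDerivAt (fun p : ℝ => 1 - p) (-1) p := by
      simpa using (hasDerivAt_id p).const_sub 1
    have h2 := ((h1.log (by have := hp.2; linarith)).const_mul c)
    exact ((hd p hp).sub h2).congr_deriv (by ring)
  have hle : ∀ p ∈ Ico y 1, f p - c * Real.log (1 - p) ≤ f y - c * Real.log (1 - y) := by
    intro p hp
    have hsub : ∀ t ∈ Icc y p, t ∈ Ioo x 1 := fun t ht => ⟨hxy.trans_le ht.1, ht.2.trans_lt hp.2⟩
    exact antitoneOn_Icc_of_hasDerivAt_nonpos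
      (fun t ht => (hg t (hsub t ht)).continuousAt.continuousWithinAt)
      (fun t ht => hg t (hsub t (Ioo_subset_Icc_self ht)))
      (fun t ht => by linarith [h0 t (hsub t (Ioo_subset_Icc_self ht))])
      ⟨le_rfl, hp.1⟩ ⟨hp.1, le_rfl⟩ hp.1
  set A := (f y - c * Real.log (1 - y) - B) / c with hA
  have hp : max y (1 - Real.exp (-(A + 1))) < 1 :=
    max_lt hy1 (by linarith [Real.exp_pos (-(A + 1))])
  have h1 := hle _ ⟨le_max_left _ _, hp⟩
  have h2 := hB _ ⟨hxy.trans_le (le_max_left _ _), hp⟩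
  have h3 : Real.log (1 - max y (1 - Real.exp (-(A + 1)))) ≤ -(A + 1) := by
    rw [Real.log_le_iff_le_exp (by linarith)]
    linarith [le_max_right y (1 - Real.exp (-(A + 1)))]
  have h4 : c * A = f y - c * Real.log (1 - y) - B := by rw [hA]; field_simp
  nlinarith [mul_le_mul_of_nonneg_left h3 hc.le]

/-- A continuous function whose derivative off one point is a continuous function `g` has the
derivative `g` everywhere, one-sided at the ends. -/
theorem hasDerivWithinAt_Icc_of_off {f g : ℝ → ℝ} {a b : ℝ} (x : ℝ)
    (hc : ContinuousOn f (Icc a b)) (hg : ContinuousOn g (Icc a b))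
    (hd : ∀ p ∈ Ioo a b, p ≠ x → HasDerivAt f (g p) p) :
    ∀ p ∈ Icc a b, HasDerivWithinAt f (g p) (Icc a b) p := by
  intro p hp
  have hab : a ≤ b := hp.1.trans hp.2
  have hint : ∀ r ∈ Icc a b, f r = f a + ∫ t in a..r, g t := by
    intro r hr
    have := MeasureTheory.integral_eq_of_hasDerivAt_off_countable f g (a := a) (b := r)
      (s := {x}) (countable_singleton x)
      (by rw [uIcc_of_le hr.1]; exact hc.mono (Icc_subset_Icc le_rfl hr.2))
      (by
        rw [min_eq_left hr.1, max_eq_right hr.1]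
        exact fun t ht => hd t ⟨ht.1.1, ht.1.2.trans_le hr.2⟩ ht.2)
      ((hg.mono (Icc_subset_Icc le_rfl hr.2)).intervalIntegrable_of_Icc hr.1)
    rw [this]; ring
  have : Fact (p ∈ Icc a b) := ⟨hp⟩
  have h1 : HasDerivWithinAt (fun r => ∫ t in a..r, g t) (g p) (Icc a b) p :=
    intervalIntegral.integral_hasDerivWithinAt_right
      ((hg.mono (Icc_subset_Icc le_rfl hp.2)).intervalIntegrable_of_Icc hp.1)
      (hg.stronglyMeasurableAtFilter_nhdsWithin measurableSet_Icc p) (hg p hp)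
  exact (h1.const_add (f a)).congr hint (hint p hp)

end MertonTC

namespace MertonTC

/-! ### The reduced problem -/

/-- The data of the free-boundary problem after the reflection `p = σ q`, `σ = sign ε`, which puts
everything on the half-line `p > 0`: `κ` stands for `(δ²/2)(1 - R)` and `Q` for `|ε| / (δ² R)`. -/
structure Params where
  R : ℝ
  κ : ℝ
  Q : ℝ
  σ : ℝ
  R_pos : 0 < R
  κ_mul_pos : 0 < κ * (1 - R)
  Q_pos : 0 < Q
  σ_eq : σ = 1 ∨ σ = -1

namespace Params

variable (P : Params)

/-- The exponent in `n = exp (c Z)`. -/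
noncomputable def c : ℝ := (1 - P.R) / P.R

/-- The positive ratio `c / κ`. -/
noncomputable def β : ℝ := P.c / P.κ

/-- The quadratic `m`, normalised by its turning point `Q`. -/
noncomputable def M (p : ℝ) : ℝ := 1 + P.κ * P.R * (p * (p - 2 * P.Q))

/-- The factor `q (1 - q)` in the reflected variable, so that `ℓ = m + κ s`. -/
noncomputable def s (p : ℝ) : ℝ := p * (P.σ - p)

/-- The scaled excess `(n - m) / κ` in terms of `Z`, where `n = exp (c Z)`. It is increasing in `Z`
whatever the sign of `1 - R`. -/
noncomputable def V (p Z : ℝ) : ℝ := (Real.exp (P.c * Z) - P.M p) / P.κ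

/-- The cost integrand in terms of `Z`. The first-order equation reads `Z' = -p G(p, Z)`. -/
noncomputable def G (p Z : ℝ) : ℝ := P.V p Z / (P.s p * (P.s p - P.V p Z))

variable {P}

theorem κ_ne : P.κ ≠ 0 := fun h => by have := P.κ_mul_pos; simp [h] at this

theorem c_ne : P.c ≠ 0 := by
  have h : 1 - P.R ≠ 0 := fun h => by have := P.κ_mul_pos; simp [h] at this
  exact div_ne_zero h P.R_pos.ne'

theorem κ_mul_c_pos : 0 < P.κ * P.c := by
  rw [c, ← mul_div_assoc]; exact div_pos P.κ_mul_pos P.R_pos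

theorem β_pos : 0 < P.β := by
  have h : P.β = P.κ * P.c / (P.κ * P.κ) := by
    rw [β, mul_div_mul_left _ _ κ_ne]
  rw [h]; exact div_pos κ_mul_c_pos (mul_self_pos.2 κ_ne)

/-- Both signs of `1 - R` occur. -/
theorem sign_cases (P : Params) : (0 < P.κ ∧ 0 < P.c) ∨ (P.κ < 0 ∧ P.c < 0) := by
  rcases pos_and_pos_or_neg_and_neg_of_mul_pos (κ_mul_c_pos (P := P)) with h | h
  · exact Or.inl h
  · exact Or.inr h

theorem exp_eq (p Z : ℝ) : Real.exp (P.c * Z) = P.M p + P.κ * P.V p Z := by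
  rw [V]; field_simp [κ_ne (P := P)]; ring

theorem V_le_V_iff {p Z W : ℝ} : P.V p Z ≤ P.V p W ↔ Z ≤ W := by
  rcases P.sign_cases with ⟨h1, h2⟩ | ⟨h1, h2⟩
  · rw [V, V, div_le_div_iff_of_pos_right h1, sub_le_sub_iff_right, Real.exp_le_exp,
      mul_le_mul_iff_right₀ h2]
  · rw [V, V, div_le_div_right_of_neg h1, sub_le_sub_iff_right, Real.exp_le_exp,
      mul_le_mul_left_of_neg h2]

theorem V_lt_V_iff {p Z W : ℝ} : P.V p Z < P.V p W ↔ Z < W := by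
  rw [← not_le, ← not_le, V_le_V_iff]

theorem V_eq_V_iff {p Z W : ℝ} : P.V p Z = P.V p W ↔ Z = W := by
  rw [le_antisymm_iff, le_antisymm_iff, V_le_V_iff, V_le_V_iff]

theorem M_sub_M (p r : ℝ) : P.M p - P.M r = P.κ * P.R * ((p - r) * (p + r - 2 * P.Q)) := by
  rw [M, M]; ring

theorem V_sub_V (p r Z : ℝ) :
    P.V p Z - P.V r Z = P.R * ((r - p) * (p + r - 2 * P.Q)) := by
  have h := M_sub_M (P := P) p r
  have e1 := exp_eq (P := P) p Z
  have e2 := exp_eq (P := P) r Z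
  apply mul_left_cancel₀ (κ_ne (P := P))
  linarith [h, e1, e2]

theorem s_pos_iff {p : ℝ} (hp : 0 < p) : 0 < P.s p ↔ P.σ = 1 ∧ p < 1 := by
  rw [s, mul_pos_iff_of_pos_left hp]
  rcases P.σ_eq with h | h <;> rw [h]
  · simp
  · constructor
    · intro h; linarith
    · rintro ⟨h, -⟩; norm_num at h

theorem s_ne {p : ℝ} (hp : 0 < p) (h : p ≠ P.σ) : P.s p ≠ 0 :=
  mul_ne_zero hp.ne' (sub_ne_zero.2 h.symm)

theorem s_neg {p : ℝ} (hp : P.σ < p) (h0 : 0 < p) : P.s p < 0 :=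
  mul_neg_of_pos_of_neg h0 (by linarith)

theorem continuous_M : Continuous P.M := by unfold M; fun_prop
theorem continuous_s : Continuous P.s := by unfold s; fun_prop
theorem hasDerivAt_s (p : ℝ) : HasDerivAt P.s (P.σ - 2 * p) p := by
  have := (hasDerivAt_id p).mul ((hasDerivAt_id p).const_sub P.σ)
  exact this.congr_deriv (by simp; ring)

theorem continuousOn_V {Z : ℝ → ℝ} {S : Set ℝ} (h : ContinuousOn Z S) :
    ContinuousOn (fun p => P.V p (Z p)) S := by
  unfold V
  exact ((Real.continuous_exp.comp_continuousOn (continuousOn_const.mul h)).sub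
    continuous_M.continuousOn).div_const _

theorem hasDerivAt_V {Z : ℝ → ℝ} {z p : ℝ} (h : HasDerivAt Z z p) :
    HasDerivAt (fun p => P.V p (Z p))
      (P.β * Real.exp (P.c * Z p) * z + 2 * P.R * (P.Q - p)) p := by
  have h1 := ((h.const_mul P.c).exp)
  have h2 : HasDerivAt P.M (P.κ * P.R * (2 * p - 2 * P.Q)) p := by
    have := ((((hasDerivAt_id p).mul ((hasDerivAt_id p).sub_const (2 * P.Q))).const_mul
      (P.κ * P.R)).const_add 1)
    exact this.congr_deriv (by simp only [id]; ring)
  refine ((h1.sub h2).div_const P.κ).congr_deriv ?_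
  rw [β]; field_simp [κ_ne (P := P)]; ring

/-- `Z` is the logarithm of an admissible solution on `[a, b]`: it solves the first-order equation
off the singular point and stays between the graphs of `m` and `ℓ`. Only values `p > 0` are
considered, and there `s` vanishes at `p = σ` only. -/
structure Orbit (P : Params) (Z : ℝ → ℝ) (a b : ℝ) : Prop where
  a_pos : 0 < a
  cont : ContinuousOn Z (Icc a b)
  ode : ∀ p ∈ Ioo a b, p ≠ P.σ → HasDerivAt Z (-(p * P.G p (Z p))) p
  nonneg : ∀ p ∈ Icc a b, 0 ≤ P.V p (Z p)
  below : ∀ p ∈ Ioo a b, 0 < P.s p → P.V p (Z p) < P.s p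

/-- The reduced free-boundary problem on `[a, b]`: an orbit which starts and ends on the graph of
`m`. Smooth fit at the upper end is encoded by `Q ≤ b`. -/
structure FB (P : Params) (Z : ℝ → ℝ) (a b : ℝ) : Prop extends Orbit P Z a b where
  lt : a < b
  left : P.V a (Z a) = 0
  right : P.V b (Z b) = 0
  le_b : P.Q ≤ b

theorem denom_pos {p Z : ℝ} (hs : P.s p ≠ 0) (h0 : 0 ≤ P.V p Z)
    (h1 : 0 < P.s p → P.V p Z < P.s p) : 0 < P.s p * (P.s p - P.V p Z) := by
  rcases lt_or_gt_of_ne hs with h | h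
  · exact mul_pos_of_neg_of_neg h (by linarith)
  · exact mul_pos h (by linarith [h1 h])

theorem G_sub_G {p Z W : ℝ} (hs : P.s p ≠ 0) (hZ : P.s p - P.V p Z ≠ 0)
    (hW : P.s p - P.V p W ≠ 0) :
    P.G p W - P.G p Z =
      (P.V p W - P.V p Z) / ((P.s p - P.V p Z) * (P.s p - P.V p W)) := by
  rw [G, G]; field_simp; ring

theorem G_nonneg {p Z : ℝ} (h0 : 0 ≤ P.V p Z)
    (h1 : 0 < P.s p → P.V p Z < P.s p) : 0 ≤ P.G p Z := by
  rcases eq_or_ne (P.s p) 0 with hs | hs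
  · simp [G, hs]
  · exact div_nonneg h0 (denom_pos hs h0 h1).le

/-- The cost integrand is increasing in `Z` on the admissible region. -/
theorem G_mono {p Z W : ℝ} (h0 : 0 ≤ P.V p Z) (h1 : 0 < P.s p → P.V p W < P.s p)
    (hZW : Z ≤ W) : P.G p Z ≤ P.G p W := by
  rcases eq_or_ne (P.s p) 0 with hs | hs
  · simp [G, hs]
  have hV : P.V p Z ≤ P.V p W := V_le_V_iff.2 hZW
  have hd : 0 < (P.s p - P.V p Z) * (P.s p - P.V p W) := by
    rcases lt_or_gt_of_ne hs with h | h
    · exact mul_pos_of_neg_of_neg (by linarith) (by linarith)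
    · have := h1 h
      exact mul_pos (by linarith) (by linarith)
  have := G_sub_G (P := P) hs (left_ne_zero_of_mul hd.ne') (right_ne_zero_of_mul hd.ne')
  have h3 : 0 ≤ P.G p W - P.G p Z := by
    rw [this]; exact div_nonneg (by linarith) hd.le
  linarith

namespace Orbit

variable {Z : ℝ → ℝ} {a b : ℝ}

theorem pos_of_mem (h : Orbit P Z a b) {p : ℝ} (hp : p ∈ Icc a b) : 0 < p :=
  h.a_pos.trans_le hp.1

theorem mono (h : Orbit P Z a b) {u v : ℝ} (hu : a ≤ u) (hv : v ≤ b) : Orbit P Z u v where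
  a_pos := h.a_pos.trans_le hu
  cont := h.cont.mono (Icc_subset_Icc hu hv)
  ode := fun p hp => h.ode p (Ioo_subset_Ioo hu hv hp)
  nonneg := fun p hp => h.nonneg p (Icc_subset_Icc hu hv hp)
  below := fun p hp => h.below p (Ioo_subset_Ioo hu hv hp)

theorem G_nonneg (h : Orbit P Z a b) {p : ℝ} (hp : p ∈ Ioo a b) : 0 ≤ P.G p (Z p) :=
  Params.G_nonneg (h.nonneg p (Ioo_subset_Icc_self hp)) (h.below p hp)

theorem hasDerivAt_V (h : Orbit P Z a b) {p : ℝ} (hp : p ∈ Ioo a b) (hσ : p ≠ P.σ) :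
    HasDerivAt (fun p => P.V p (Z p))
      (2 * P.R * (P.Q - p) - P.β * Real.exp (P.c * Z p) * (p * P.G p (Z p))) p :=
  (Params.hasDerivAt_V (h.ode p hp hσ)).congr_deriv (by ring)

theorem antitoneOn (h : Orbit P Z a b) : AntitoneOn Z (Icc a b) :=
  antitoneOn_Icc_of_hasDerivAt_nonpos_off P.σ h.cont h.ode fun _ hp _ =>
    neg_nonpos.2 (mul_nonneg (h.pos_of_mem (Ioo_subset_Icc_self hp)).le (h.G_nonneg hp))

/-- The upper bound `V ≤ s` closes the region at the singular point. -/
theorem V_one_eq_zero (h : Orbit P Z a 1) (hσ : P.σ = 1) (ha : a < 1) : P.V 1 (Z 1) = 0 := by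
  refine le_antisymm ?_ (h.nonneg 1 ⟨ha.le, le_rfl⟩)
  have hs : P.s 1 = 0 := by simp [s, hσ]
  have h1 : Tendsto (fun p => P.V p (Z p)) (𝓝[<] 1) (𝓝 (P.V 1 (Z 1))) :=
    ((continuousOn_V h.cont) 1 ⟨ha.le, le_rfl⟩).mono_left
      (nhdsWithin_le_of_mem (mem_of_superset (Ioo_mem_nhdsLT ha) Ioo_subset_Icc_self))
  have h2 : Tendsto P.s (𝓝[<] 1) (𝓝 0) := by
    rw [← hs]; exact continuous_s.continuousAt.mono_left nhdsWithin_le_nhds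
  refine le_of_tendsto_of_tendsto h1 h2 ?_
  filter_upwards [Ioo_mem_nhdsLT ha] with p hp
  exact (h.below p hp ((s_pos_iff (h.a_pos.trans hp.1)).2 ⟨hσ, hp.2⟩)).le

end Orbit

/-! ### Passing through the singular point

At `p = 1` the curves `m` and `ℓ` meet. Comparing `V` with `k s²` shows that the slope of an orbit
there is forced. -/

/-- The value of the cost integrand forced at the singular point. -/
noncomputable def gOne (P : Params) : ℝ := 2 * P.R * (P.Q - 1) / (P.β * P.M 1)

/-- The upper bound for the growth of `V - k s²` above zero. -/
noncomputable def barrier (P : Params) (Z : ℝ → ℝ) (k p : ℝ) : ℝ :=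
  2 * P.R * (P.Q - p) - P.β * Real.exp (P.c * Z p) * (p * (k / (1 - k * P.s p)))
    - 2 * k * P.s p * (P.σ - 2 * p)

theorem G_sub_barrier {p Z k : ℝ} (hs : P.s p ≠ 0) (hd : P.s p - P.V p Z ≠ 0)
    (hk : 1 - k * P.s p ≠ 0) : P.G p Z - k / (1 - k * P.s p) =
      (P.V p Z - k * P.s p ^ 2) / (P.s p * (P.s p - P.V p Z) * (1 - k * P.s p)) := by
  rw [G, div_sub_div _ _ (mul_ne_zero hs hd) hk]; congr 1; ring

theorem barrier_le_G_iff {p Z k : ℝ} (hs : P.s p ≠ 0) (h0 : 0 ≤ P.V p Z)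
    (h1 : 0 < P.s p → P.V p Z < P.s p) (hk : 0 < 1 - k * P.s p) :
    k / (1 - k * P.s p) ≤ P.G p Z ↔ 0 ≤ P.V p Z - k * P.s p ^ 2 := by
  have hd := denom_pos hs h0 h1
  rw [← sub_nonneg, G_sub_barrier hs (right_ne_zero_of_mul hd.ne') hk.ne',
    le_div_iff₀ (mul_pos hd hk), zero_mul]

theorem G_le_barrier_iff {p Z k : ℝ} (hs : P.s p ≠ 0) (h0 : 0 ≤ P.V p Z)
    (h1 : 0 < P.s p → P.V p Z < P.s p) (hk : 0 < 1 - k * P.s p) :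
    P.G p Z ≤ k / (1 - k * P.s p) ↔ P.V p Z - k * P.s p ^ 2 ≤ 0 := by
  have hd := denom_pos hs h0 h1
  rw [← sub_nonpos, G_sub_barrier hs (right_ne_zero_of_mul hd.ne') hk.ne',
    div_le_iff₀ (mul_pos hd hk), zero_mul]

namespace Orbit

variable {Z : ℝ → ℝ} {a b : ℝ}

theorem hasDerivAt_sub_sq (h : Orbit P Z a b) (k : ℝ) {p : ℝ} (hp : p ∈ Ioo a b)
    (hσ : p ≠ P.σ) : HasDerivAt (fun p => P.V p (Z p) - k * P.s p ^ 2)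
      (2 * P.R * (P.Q - p) - P.β * Real.exp (P.c * Z p) * (p * P.G p (Z p))
        - 2 * k * P.s p * (P.σ - 2 * p)) p := by
  refine ((h.hasDerivAt_V hp hσ).sub (((hasDerivAt_s p).pow 2).const_mul k)).congr_deriv ?_
  push_cast; ring

theorem deriv_le_barrier (h : Orbit P Z a b) {k p : ℝ} (hp : p ∈ Ioo a b)
    (hσ : p ≠ P.σ) (hk : 0 < 1 - k * P.s p) (hφ : 0 < P.V p (Z p) - k * P.s p ^ 2) :
    2 * P.R * (P.Q - p) - P.β * Real.exp (P.c * Z p) * (p * P.G p (Z p))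
        - 2 * k * P.s p * (P.σ - 2 * p) ≤ P.barrier Z k p := by
  have hp0 := h.a_pos.trans hp.1
  have := (barrier_le_G_iff (s_ne hp0 hσ) (h.nonneg p (Ioo_subset_Icc_self hp))
    (h.below p hp) hk).2 hφ.le
  have h1 := mul_le_mul_of_nonneg_left (mul_le_mul_of_nonneg_left this hp0.le)
    (mul_pos (β_pos (P := P)) (Real.exp_pos (P.c * Z p))).le
  rw [barrier]; linarith

theorem barrier_le_deriv (h : Orbit P Z a b) {k p : ℝ} (hp : p ∈ Ioo a b)
    (hσ : p ≠ P.σ) (hk : 0 < 1 - k * P.s p) (hφ : P.V p (Z p) - k * P.s p ^ 2 < 0) :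
    P.barrier Z k p ≤ 2 * P.R * (P.Q - p) - P.β * Real.exp (P.c * Z p) * (p * P.G p (Z p))
        - 2 * k * P.s p * (P.σ - 2 * p) := by
  have hp0 := h.a_pos.trans hp.1
  have := (G_le_barrier_iff (s_ne hp0 hσ) (h.nonneg p (Ioo_subset_Icc_self hp))
    (h.below p hp) hk).2 hφ.le
  have h1 := mul_le_mul_of_nonneg_left (mul_le_mul_of_nonneg_left this hp0.le)
    (mul_pos (β_pos (P := P)) (Real.exp_pos (P.c * Z p))).le
  rw [barrier]; linarith

end Orbit

theorem tendsto_barrier {Z : ℝ → ℝ} {S : Set ℝ} (hσ : P.σ = 1) (hZ : ContinuousWithinAt Z S 1)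
    (hV : P.V 1 (Z 1) = 0) (k : ℝ) :
    Tendsto (P.barrier Z k) (𝓝[S] 1) (𝓝 (2 * P.R * (P.Q - 1) - P.β * P.M 1 * k)) ∧
    Tendsto (fun p => k / (1 - k * P.s p)) (𝓝[S] 1) (𝓝 k) ∧
    ∀ᶠ p in 𝓝[S] 1, 0 < 1 - k * P.s p := by
  have hs : P.s 1 = 0 := by simp [s, hσ]
  have hsc : ContinuousWithinAt P.s S 1 := continuous_s.continuousWithinAt
  have hden : ContinuousWithinAt (fun p => 1 - k * P.s p) S 1 :=
    continuousWithinAt_const.sub (continuousWithinAt_const.mul hsc)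
  have hq : ContinuousWithinAt (fun p => k / (1 - k * P.s p)) S 1 :=
    continuousWithinAt_const.div hden (by simp [hs])
  have hid : ContinuousWithinAt (fun p : ℝ => p) S 1 := continuousWithinAt_id
  have he : ContinuousWithinAt (fun p => Real.exp (P.c * Z p)) S 1 :=
    (continuousWithinAt_const.mul hZ).rexp
  refine ⟨?_, ?_, ?_⟩
  · have : ContinuousWithinAt (P.barrier Z k) S 1 := by
      unfold barrier
      exact ((continuousWithinAt_const.mul (continuousWithinAt_const.sub hid)).sub
        ((continuousWithinAt_const.mul he).mul (hid.mul hq))).sub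
        ((continuousWithinAt_const.mul hsc).mul
          (continuousWithinAt_const.sub (continuousWithinAt_const.mul hid)))
    have hval : P.barrier Z k 1 = 2 * P.R * (P.Q - 1) - P.β * P.M 1 * k := by
      rw [barrier, exp_eq 1, hV, hs]; simp
    rw [← hval]; exact this
  · simpa [ContinuousWithinAt, hs] using hq
  · have : Tendsto (fun p => 1 - k * P.s p) (𝓝[S] 1) (𝓝 (1 - k * P.s 1)) := hden
    exact this.eventually (lt_mem_nhds (by simp [hs]))

/-- Two-sided bounds of `V` by multiples of `s²` pin down the limit of the cost integrand. -/
theorem tendsto_G_of_barriers {Z : ℝ → ℝ} {l : Filter ℝ} {g : ℝ}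
    (hlim : ∀ k, Tendsto (fun p => k / (1 - k * P.s p)) l (𝓝 k))
    (hpos : ∀ k, ∀ᶠ p in l, 0 < 1 - k * P.s p)
    (hadm : ∀ᶠ p in l, P.s p ≠ 0 ∧ 0 ≤ P.V p (Z p) ∧ (0 < P.s p → P.V p (Z p) < P.s p))
    (hup : ∀ k, g < k → ∀ᶠ p in l, P.V p (Z p) - k * P.s p ^ 2 ≤ 0)
    (hlo : ∀ k, k < g → ∀ᶠ p in l, 0 ≤ P.V p (Z p) - k * P.s p ^ 2) :
    Tendsto (fun p => P.G p (Z p)) l (𝓝 g) := by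
  rw [tendsto_order]
  constructor
  · intro x hx
    obtain ⟨k, hxk, hkg⟩ := exists_between hx
    filter_upwards [hpos k, hadm, hlo k hkg, (hlim k).eventually (lt_mem_nhds hxk)]
      with p h1 h2 h3 h4
    exact h4.trans_le ((barrier_le_G_iff h2.1 h2.2.1 h2.2.2 h1).2 h3)
  · intro x hx
    obtain ⟨k, hgk, hkx⟩ := exists_between hx
    filter_upwards [hpos k, hadm, hup k hgk, (hlim k).eventually (gt_mem_nhds hkx)]
      with p h1 h2 h3 h4
    exact ((G_le_barrier_iff h2.1 h2.2.1 h2.2.2 h1).2 h3).trans_lt h4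

theorem M_one_pos {z : ℝ} (h : P.V 1 z = 0) : 0 < P.M 1 := by
  have := exp_eq (P := P) 1 z
  rw [h] at this; have := Real.exp_pos (P.c * z); linarith

theorem gOne_mul (h : 0 < P.M 1) : P.β * P.M 1 * P.gOne = 2 * P.R * (P.Q - 1) := by
  rw [gOne, mul_div_cancel₀]; exact (mul_pos β_pos h).ne'

namespace Orbit

variable {Z : ℝ → ℝ} {a b : ℝ}

/-- On the right of the singular point `V - k s²` has a derivative of a definite sign near `1` as
soon as `k ≠ gOne`, and it starts from `0`; so `V` lies between all such multiples of `s²`. -/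
theorem tendsto_G_right (h : Orbit P Z 1 b) (hσ : P.σ = 1) (hb : 1 < b)
    (hV : P.V 1 (Z 1) = 0) : Tendsto (fun p => P.G p (Z p)) (𝓝[>] 1) (𝓝 P.gOne) := by
  have hM := M_one_pos hV
  have hs1 : P.s 1 = 0 := by simp [s, hσ]
  have hZ : ContinuousWithinAt Z (Ioi 1) 1 :=
    (h.cont 1 ⟨le_rfl, hb.le⟩).mono_left
      (nhdsWithin_le_of_mem (mem_of_superset (Ioo_mem_nhdsGT hb) Ioo_subset_Icc_self))
  have hb' := fun k => tendsto_barrier hσ hZ hV k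
  have hcont : ∀ k, ContinuousOn (fun p => P.V p (Z p) - k * P.s p ^ 2) (Icc 1 b) := fun k =>
    (continuousOn_V h.cont).sub (continuousOn_const.mul (continuous_s.continuousOn.pow 2))
  refine tendsto_G_of_barriers (fun k => (hb' k).2.1) (fun k => (hb' k).2.2) ?_ ?_ ?_
  · filter_upwards [Ioo_mem_nhdsGT hb] with p hp
    exact ⟨s_ne (by linarith [hp.1]) (by rw [hσ]; exact hp.1.ne'),
      h.nonneg p (Ioo_subset_Icc_self hp), h.below p hp⟩
  · intro k hk
    have hneg : 2 * P.R * (P.Q - 1) - P.β * P.M 1 * k < 0 := by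
      rw [← gOne_mul hM]; nlinarith [mul_pos (β_pos (P := P)) hM]
    have hev := ((hb' k).1.eventually (gt_mem_nhds hneg)).and (hb' k).2.2
    obtain ⟨u, hu, hsub⟩ := (mem_nhdsGT_iff_exists_mem_Ioc_Ioo_subset hb).1 hev
    filter_upwards [Ioo_mem_nhdsGT hu.1] with p hp
    refine nonpos_of_barrier (x := 1) (y := u) ((hcont k).mono (Icc_subset_Icc le_rfl hu.2))
      (by simp [hV, hs1])
      (fun t ht _ => h.hasDerivAt_sub_sq k ⟨ht.1, ht.2.trans_le hu.2⟩
        (by rw [hσ]; exact ht.1.ne')) (fun t ht hpos => ?_) p (Ioo_subset_Icc_self hp)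
    exact (h.deriv_le_barrier ⟨ht.1, ht.2.trans_le hu.2⟩ (by rw [hσ]; exact ht.1.ne')
      (hsub ht).2 hpos).trans (hsub ht).1.le
  · intro k hk
    have hpos : 0 < 2 * P.R * (P.Q - 1) - P.β * P.M 1 * k := by
      rw [← gOne_mul hM]; nlinarith [mul_pos (β_pos (P := P)) hM]
    have hev := ((hb' k).1.eventually (lt_mem_nhds hpos)).and (hb' k).2.2
    obtain ⟨u, hu, hsub⟩ := (mem_nhdsGT_iff_exists_mem_Ioc_Ioo_subset hb).1 hev
    filter_upwards [Ioo_mem_nhdsGT hu.1] with p hp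
    have := nonpos_of_barrier (φ := fun p => -(P.V p (Z p) - k * P.s p ^ 2)) (x := 1) (y := u)
      ((hcont k).mono (Icc_subset_Icc le_rfl hu.2)).neg (by simp [hV, hs1])
      (fun t ht _ => (h.hasDerivAt_sub_sq k ⟨ht.1, ht.2.trans_le hu.2⟩
        (by rw [hσ]; exact ht.1.ne')).neg) (fun t ht hpos => ?_) p (Ioo_subset_Icc_self hp)
    · linarith
    · have := h.barrier_le_deriv (k := k) ⟨ht.1, ht.2.trans_le hu.2⟩
        (by rw [hσ]; exact ht.1.ne') (hsub ht).2 (by linarith)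
      linarith [(hsub ht).1]

/-- If `V` is at least of order `1 - p`, the equation drives `Z` to `-∞` at the singular point. -/
theorem false_of_linear_bound (h : Orbit P Z a 1) (hσ : P.σ = 1) {x μ : ℝ} (hax : a ≤ x)
    (hx : x < 1) (hμ : 0 < μ) (hV : ∀ p ∈ Ioo x 1, μ * (1 - p) ≤ P.V p (Z p)) : False := by
  have hsub : ∀ p ∈ Ioo x 1, p ∈ Ioo a 1 := fun p hp => ⟨hax.trans_lt hp.1, hp.2⟩
  obtain ⟨B, hB⟩ := (isCompact_Icc.bddBelow_image h.cont)
  refine not_bddBelow_of_deriv_le hx hμ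
    (fun p hp => h.ode p (hsub p hp) (by rw [hσ]; exact hp.2.ne)) (fun p hp => ?_)
    (fun p hp => hB (mem_image_of_mem Z (Ioo_subset_Icc_self (hsub p hp))))
  have hp0 := h.a_pos.trans (hsub p hp).1
  have hp1 : 0 < 1 - p := by linarith [hp.2]
  have hlt := h.below p (hsub p hp) ((s_pos_iff hp0).2 ⟨hσ, hp.2⟩)
  have hs : P.s p = p * (1 - p) := by rw [s, hσ]
  have hG : p * P.G p (Z p) = P.V p (Z p) / ((1 - p) * (P.s p - P.V p (Z p))) := by
    rw [G, hs]; field_simp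
  rw [neg_le_neg_iff, hG, div_le_div_iff₀ hp1 (mul_pos hp1 (by linarith))]
  have h1 := hV p hp
  have h2 : P.s p - P.V p (Z p) ≤ 1 - p := by
    have : P.s p ≤ 1 - p := by rw [hs]; nlinarith [hp.2]
    linarith [h.nonneg p (Ioo_subset_Icc_self (hsub p hp))]
  have h3 : 0 < P.s p - P.V p (Z p) := by linarith
  nlinarith [mul_le_mul_of_nonneg_left h2 (mul_pos hμ hp1).le]

/-- On the left of the singular point the sign of the derivative only shows that `V - k s²` cannot
cross `0` in the wrong direction. If it never crossed, `V` would be negative, or at least of order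
`1 - p`, which is excluded by `false_of_linear_bound`. -/
theorem tendsto_G_left (h : Orbit P Z a 1) (hσ : P.σ = 1) (ha : a < 1) :
    Tendsto (fun p => P.G p (Z p)) (𝓝[<] 1) (𝓝 P.gOne) := by
  have hV := h.V_one_eq_zero hσ ha
  have hM := M_one_pos hV
  have hs1 : P.s 1 = 0 := by simp [s, hσ]
  have hZ : ContinuousWithinAt Z (Iio 1) 1 :=
    (h.cont 1 ⟨ha.le, le_rfl⟩).mono_left
      (nhdsWithin_le_of_mem (mem_of_superset (Ioo_mem_nhdsLT ha) Ioo_subset_Icc_self))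
  have hb' := fun k => tendsto_barrier hσ hZ hV k
  have hcont : ∀ k, ContinuousOn (fun p => P.V p (Z p) - k * P.s p ^ 2) (Icc a 1) := fun k =>
    (continuousOn_V h.cont).sub (continuousOn_const.mul (continuous_s.continuousOn.pow 2))
  have hsmall : ∀ k μ : ℝ, 0 < μ → ∀ᶠ p in 𝓝[<] (1 : ℝ), |k| * (1 - p) < μ := by
    intro k μ hμ
    have : Tendsto (fun p : ℝ => |k| * (1 - p)) (𝓝[<] 1) (𝓝 (|k| * (1 - 1))) :=
      (Continuous.tendsto (by fun_prop) 1).mono_left nhdsWithin_le_nhds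
    exact this.eventually (gt_mem_nhds (by simpa using hμ))
  have hsq : ∀ k p : ℝ, p ∈ Ioo 0 1 → |k * P.s p ^ 2| ≤ |k| * (1 - p) * (1 - p) := by
    intro k p hp
    have h2 : p ^ 2 ≤ 1 := by nlinarith [hp.1, hp.2]
    have h3 : P.s p ^ 2 = p ^ 2 * (1 - p) ^ 2 := by rw [s, hσ]; ring
    rw [abs_mul, abs_of_nonneg (sq_nonneg (P.s p)), mul_assoc]
    refine mul_le_mul_of_nonneg_left ?_ (abs_nonneg k)
    rw [h3]; nlinarith [sq_nonneg (1 - p)]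
  refine tendsto_G_of_barriers (fun k => (hb' k).2.1) (fun k => (hb' k).2.2) ?_ ?_ ?_
  · filter_upwards [Ioo_mem_nhdsLT ha] with p hp
    exact ⟨s_ne (h.a_pos.trans hp.1) (by rw [hσ]; exact hp.2.ne),
      h.nonneg p (Ioo_subset_Icc_self hp), h.below p hp⟩
  · intro k hk
    obtain ⟨μ, hμ, hμ'⟩ : ∃ μ, 0 < μ ∧ 2 * P.R * (P.Q - 1) - P.β * P.M 1 * k < -μ := by
      refine ⟨P.β * P.M 1 * (k - P.gOne) / 2, ?_, ?_⟩
      · exact div_pos (mul_pos (mul_pos β_pos hM) (by linarith)) two_pos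
      · rw [← gOne_mul hM]; nlinarith [mul_pos (β_pos (P := P)) hM]
    have hev := (((hb' k).1.eventually (gt_mem_nhds hμ')).and (hb' k).2.2).and
      (hsmall k (μ / 2) (half_pos hμ))
    obtain ⟨x, hx, hsub⟩ := (mem_nhdsLT_iff_exists_mem_Ico_Ioo_subset ha).1 hev
    have hmem : ∀ t ∈ Ioo x 1, t ∈ Ioo a 1 := fun t ht => ⟨hx.1.trans_lt ht.1, ht.2⟩
    have hd := fun t (ht : t ∈ Ioo x 1) =>
      h.hasDerivAt_sub_sq k (hmem t ht) (by rw [hσ]; exact ht.2.ne)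
    have hle := fun t (ht : t ∈ Ioo x 1) (hpos : 0 < P.V t (Z t) - k * P.s t ^ 2) =>
      h.deriv_le_barrier (hmem t ht) (by rw [hσ]; exact ht.2.ne) (hsub ht).1.2 hpos
    by_cases hex : ∃ r ∈ Ioo x 1, P.V r (Z r) - k * P.s r ^ 2 ≤ 0
    · obtain ⟨r, hr, hr0⟩ := hex
      filter_upwards [Ioo_mem_nhdsLT hr.2] with p hp
      have hm : ∀ t ∈ Ioo r 1, t ∈ Ioo x 1 := fun t ht => ⟨hr.1.trans ht.1, ht.2⟩
      exact nonpos_of_barrier ((hcont k).mono (Icc_subset_Icc (hmem r hr).1.le le_rfl)) hr0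
        (fun t ht _ => hd t (hm t ht))
        (fun t ht hpos => by linarith [hle t (hm t ht) hpos, (hsub (hm t ht)).1.1])
        p (Ioo_subset_Icc_self hp)
    · push Not at hex
      exfalso
      -- `V - k s²` stays positive, so it falls to `0` at `1` with a slope bounded away from `0`.
      refine h.false_of_linear_bound hσ hx.1 hx.2 (half_pos hμ) fun p hp => ?_
      have hanti := antitoneOn_Icc_of_hasDerivAt_nonpos
        (f := fun t => (P.V t (Z t) - k * P.s t ^ 2) + μ * t) (a := p) (b := 1)
        (((hcont k).mono (Icc_subset_Icc (hmem p hp).1.le le_rfl)).add (by fun_prop))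
        (fun t ht => (hd t ⟨hp.1.trans ht.1, ht.2⟩).add ((hasDerivAt_id t).const_mul μ))
        (fun t ht => by
          have ht' : t ∈ Ioo x 1 := ⟨hp.1.trans ht.1, ht.2⟩
          linarith [hle t ht' (hex t ht'), (hsub ht').1.1])
        ⟨le_rfl, hp.2.le⟩ ⟨hp.2.le, le_rfl⟩ hp.2.le
      have h1 := hsq k p ⟨h.a_pos.trans (hmem p hp).1, hp.2⟩
      have h2 := (hsub hp).2
      have h3 : 0 < 1 - p := by linarith [hp.2]
      simp only [hV, hs1] at hanti
      have h4 := mul_lt_mul_of_pos_right h2 h3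
      have h5 := neg_abs_le (k * P.s p ^ 2)
      nlinarith
  · intro k hk
    obtain ⟨μ, hμ, hμ'⟩ : ∃ μ, 0 < μ ∧ μ < 2 * P.R * (P.Q - 1) - P.β * P.M 1 * k := by
      refine ⟨P.β * P.M 1 * (P.gOne - k) / 2, ?_, ?_⟩
      · exact div_pos (mul_pos (mul_pos β_pos hM) (by linarith)) two_pos
      · rw [← gOne_mul hM]; nlinarith [mul_pos (β_pos (P := P)) hM]
    have hev := (((hb' k).1.eventually (lt_mem_nhds hμ')).and (hb' k).2.2).and
      (hsmall k (μ / 2) (half_pos hμ))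
    obtain ⟨x, hx, hsub⟩ := (mem_nhdsLT_iff_exists_mem_Ico_Ioo_subset ha).1 hev
    have hmem : ∀ t ∈ Ioo x 1, t ∈ Ioo a 1 := fun t ht => ⟨hx.1.trans_lt ht.1, ht.2⟩
    have hd := fun t (ht : t ∈ Ioo x 1) =>
      h.hasDerivAt_sub_sq k (hmem t ht) (by rw [hσ]; exact ht.2.ne)
    have hle := fun t (ht : t ∈ Ioo x 1) (hpos : P.V t (Z t) - k * P.s t ^ 2 < 0) =>
      h.barrier_le_deriv (hmem t ht) (by rw [hσ]; exact ht.2.ne) (hsub ht).1.2 hpos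
    by_cases hex : ∃ r ∈ Ioo x 1, 0 ≤ P.V r (Z r) - k * P.s r ^ 2
    · obtain ⟨r, hr, hr0⟩ := hex
      filter_upwards [Ioo_mem_nhdsLT hr.2] with p hp
      have hm : ∀ t ∈ Ioo r 1, t ∈ Ioo x 1 := fun t ht => ⟨hr.1.trans ht.1, ht.2⟩
      have := nonpos_of_barrier (φ := fun t => -(P.V t (Z t) - k * P.s t ^ 2))
        ((hcont k).mono (Icc_subset_Icc (hmem r hr).1.le le_rfl)).neg
        (by linarith) (fun t ht _ => (hd t (hm t ht)).neg)
        (fun t ht hpos => by linarith [hle t (hm t ht) (by linarith), (hsub (hm t ht)).1.1])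
        p (Ioo_subset_Icc_self hp)
      linarith
    · push Not at hex
      exfalso
      -- `V - k s²` increases to `0` at `1` with a slope bounded away from `0`, so that `V < 0`.
      obtain ⟨p, hp⟩ := exists_between hx.2
      have hp : p ∈ Ioo x 1 := hp
      have hmono := monotoneOn_Icc_of_hasDerivAt_nonneg
        (f := fun t => (P.V t (Z t) - k * P.s t ^ 2) - μ * t) (a := p) (b := 1)
        (((hcont k).mono (Icc_subset_Icc (hmem p hp).1.le le_rfl)).sub (by fun_prop))
        (fun t ht => (hd t ⟨hp.1.trans ht.1, ht.2⟩).sub ((hasDerivAt_id t).const_mul μ))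
        (fun t ht => by
          have ht' : t ∈ Ioo x 1 := ⟨hp.1.trans ht.1, ht.2⟩
          linarith [hle t ht' (hex t ht'), (hsub ht').1.1])
        ⟨le_rfl, hp.2.le⟩ ⟨hp.2.le, le_rfl⟩ hp.2.le
      have h1 := hsq k p ⟨h.a_pos.trans (hmem p hp).1, hp.2⟩
      have h3 : 0 < 1 - p := by linarith [hp.2]
      have h4 := mul_lt_mul_of_pos_right (hsub hp).2 h3
      have h5 := le_abs_self (k * P.s p ^ 2)
      have h6 := h.nonneg p (Ioo_subset_Icc_self (hmem p hp))
      simp only [hV, hs1] at hmono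
      nlinarith

/-- An orbit can arrive at the singular point only if the turning point of `m` is not below it. -/
theorem one_le_Q_of_left (h : Orbit P Z a 1) (hσ : P.σ = 1) (ha : a < 1) : 1 ≤ P.Q := by
  have hM := M_one_pos (h.V_one_eq_zero hσ ha)
  have h0 : 0 ≤ P.gOne := by
    refine ge_of_tendsto (h.tendsto_G_left hσ ha) ?_
    filter_upwards [Ioo_mem_nhdsLT ha] with p hp
    exact h.G_nonneg hp
  have h1 := gOne_mul hM
  have h2 := mul_nonneg (mul_pos (β_pos (P := P)) hM).le h0
  by_contra hQ
  nlinarith [mul_pos P.R_pos (by linarith : 0 < 1 - P.Q)]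

end Orbit
end Params
end MertonTC

namespace MertonTC
namespace Params

variable {P : Params} {Z W : ℝ → ℝ} {a b : ℝ}

/-! ### Position of the free boundaries -/

/-- Away from the singular point an orbit can touch `m` only at the turning point. -/
theorem Orbit.eq_Q_of_V_eq_zero (h : Orbit P Z a b) {p : ℝ} (hp : p ∈ Ioo a b) (hσ : p ≠ P.σ)
    (hV : P.V p (Z p) = 0) : p = P.Q := by
  have hmin : IsLocalMin (fun t => P.V t (Z t)) p := by
    filter_upwards [Ioo_mem_nhds hp.1 hp.2] with t ht
    rw [hV]; exact h.nonneg t (Ioo_subset_Icc_self ht)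
  have := hmin.hasDerivAt_eq_zero (h.hasDerivAt_V hp hσ)
  rw [G, hV] at this
  simp only [zero_div, mul_zero, sub_zero, mul_eq_zero, OfNat.ofNat_ne_zero, false_or] at this
  rcases this with h1 | h1
  · exact absurd h1 P.R_pos.ne'
  · linarith

/-- An orbit which starts below a nonsingular turning point `Q` is strictly above `m` at `Q`. -/
theorem Orbit.V_Q_ne_zero (h : Orbit P Z a b) (ha : a < P.Q) (hb : P.Q ≤ b) (hσ : P.Q ≠ P.σ) :
    P.V P.Q (Z P.Q) ≠ 0 := by
  intro hV
  obtain ⟨x, hax, hxQ, hx⟩ : ∃ x, a < x ∧ x < P.Q ∧ ∀ p ∈ Icc x P.Q, p ≠ P.σ := by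
    rcases lt_or_gt_of_ne hσ with h1 | h1
    · obtain ⟨x, hx⟩ := exists_between ha
      exact ⟨x, hx.1, hx.2, fun p hp => (hp.2.trans_lt h1).ne⟩
    · obtain ⟨x, hx⟩ := exists_between (max_lt ha h1)
      exact ⟨x, (le_max_left _ _).trans_lt hx.1, hx.2,
        fun p hp => (((le_max_right _ _).trans_lt hx.1).trans_le hp.1).ne'⟩
  have hsubI : Icc x P.Q ⊆ Icc a b := Icc_subset_Icc hax.le hb
  have hd : ∀ p ∈ Icc x P.Q, 0 < P.s p * (P.s p - P.V p (Z p)) := by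
    intro p hp
    have hp0 := h.pos_of_mem (hsubI hp)
    refine denom_pos (s_ne hp0 (hx p hp)) (h.nonneg p (hsubI hp)) fun hs => ?_
    rcases eq_or_lt_of_le hp.2 with rfl | hlt
    · rw [hV]; exact hs
    · exact h.below p ⟨hax.trans_le hp.1, hlt.trans_le hb⟩ hs
  have hcV := (continuousOn_V (P := P) h.cont).mono hsubI
  have hcont : ContinuousOn (fun p => P.β * Real.exp (P.c * Z p) *
      (p / (P.s p * (P.s p - P.V p (Z p))))) (Icc x P.Q) :=
    (continuousOn_const.mul (continuousOn_const.mul (h.cont.mono hsubI)).rexp).mul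
      (continuousOn_id.div (continuous_s.continuousOn.mul (continuous_s.continuousOn.sub hcV))
        fun p hp => (hd p hp).ne')
  -- With `K` a bound for `β n p G / V`, the function `V exp (K p)` increases up to `Q`, as
  -- `2 R (Q - p) ≥ 0` there. A zero at `Q` would make it vanish on an interval.
  obtain ⟨K, hK⟩ := isCompact_Icc.bddAbove_image hcont
  have hIoo : ∀ p ∈ Ioo x P.Q, p ∈ Ioo a b := fun p hp => ⟨hax.trans hp.1, hp.2.trans_le hb⟩
  have hder : ∀ p ∈ Ioo x P.Q, HasDerivAt (fun p => P.V p (Z p) * Real.exp (K * p))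
      ((2 * P.R * (P.Q - p) - P.β * Real.exp (P.c * Z p) * (p * P.G p (Z p))) * Real.exp (K * p)
        + P.V p (Z p) * (Real.exp (K * p) * K)) p := fun p hp =>
    (h.hasDerivAt_V (hIoo p hp) (hx p (Ioo_subset_Icc_self hp))).mul
      (((hasDerivAt_id p).const_mul K).exp.congr_deriv (by simp))
  have hmono := monotoneOn_Icc_of_hasDerivAt_nonneg
    (hcV.mul (by fun_prop : Continuous fun p : ℝ => Real.exp (K * p)).continuousOn) hder
    (fun p hp => by
      have h1 : P.β * Real.exp (P.c * Z p) * (p * P.G p (Z p)) ≤ K * P.V p (Z p) := by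
        have h2 := hK (mem_image_of_mem _ (Ioo_subset_Icc_self hp))
        have h3 := mul_le_mul_of_nonneg_right h2
          (h.nonneg p (Ioo_subset_Icc_self (hIoo p hp)))
        refine le_trans (le_of_eq ?_) h3
        rw [G]; ring
      have h4 : 0 ≤ 2 * P.R * (P.Q - p) :=
        mul_nonneg (mul_nonneg two_pos.le P.R_pos.le) (by linarith [hp.2])
      have h5 := mul_nonneg (by linarith :
        0 ≤ 2 * P.R * (P.Q - p) - P.β * Real.exp (P.c * Z p) * (p * P.G p (Z p))
          + K * P.V p (Z p)) (Real.exp_pos (K * p)).le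
      linarith)
  obtain ⟨y, hxy, hyQ⟩ := exists_between hxQ
  have h1 : P.V y (Z y) * Real.exp (K * y) ≤ P.V P.Q (Z P.Q) * Real.exp (K * P.Q) :=
    hmono ⟨hxy.le, hyQ.le⟩ ⟨hxQ.le, le_rfl⟩ hyQ.le
  rw [hV, zero_mul] at h1
  have h2 := h.nonneg y (Ioo_subset_Icc_self (hIoo y ⟨hxy, hyQ⟩))
  have h3 : P.V y (Z y) = 0 :=
    le_antisymm (by nlinarith [Real.exp_pos (K * y)]) h2
  exact hyQ.ne (h.eq_Q_of_V_eq_zero (hIoo y ⟨hxy, hyQ⟩)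
    (hx y ⟨hxy.le, hyQ.le⟩) h3)

namespace FB

/-- `Z` decreases and `m` is symmetric about `Q`, so the end comes no later than the mirror image of
the start. -/
theorem add_le (h : FB P Z a b) : a + b ≤ 2 * P.Q := by
  have h1 : P.V b (Z b) ≤ P.V b (Z a) :=
    V_le_V_iff.2 (h.antitoneOn ⟨le_rfl, h.lt.le⟩ ⟨h.lt.le, le_rfl⟩ h.lt.le)
  have h2 := V_sub_V (P := P) b a (Z a)
  rw [h.right] at h1
  rw [h.left] at h2
  by_contra hlt
  nlinarith [mul_pos P.R_pos (mul_pos (sub_pos.2 h.lt) (by linarith : 0 < b + a - 2 * P.Q))]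

theorem a_lt_Q (h : FB P Z a b) : a < P.Q := by linarith [h.add_le, h.lt]

theorem V_pos (h : FB P Z a b) {p : ℝ} (hp : p ∈ Ioo a b) (hσ : p ≠ P.σ) : 0 < P.V p (Z p) := by
  refine lt_of_le_of_ne (h.nonneg p (Ioo_subset_Icc_self hp)) fun h0 => ?_
  have hQ := h.eq_Q_of_V_eq_zero hp hσ h0.symm
  subst hQ
  exact h.V_Q_ne_zero h.a_lt_Q h.le_b hσ h0.symm

theorem Q_lt_b (h : FB P Z a b) (hσ : P.Q ≠ P.σ) : P.Q < b := by
  refine lt_of_le_of_ne h.le_b fun hb => ?_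
  exact h.V_Q_ne_zero h.a_lt_Q h.le_b hσ (by rw [hb]; exact h.right)

theorem b_lt_one (h : FB P Z a b) (hσ : P.σ = 1) (hQ : P.Q < 1) : b < 1 := by
  by_contra hb
  have ha := h.a_lt_Q.trans hQ
  linarith [(h.toOrbit.mono le_rfl (not_lt.1 hb)).one_le_Q_of_left hσ ha]

/-- Every solution passes through the singular point on the graph of `m`. -/
theorem V_one (h : FB P Z a b) (hσ : P.σ = 1) (ha : a ≤ 1) (hb : 1 ≤ b) : P.V 1 (Z 1) = 0 := by
  rcases eq_or_lt_of_le ha with rfl | ha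
  · exact h.left
  · exact (h.toOrbit.mono le_rfl hb).V_one_eq_zero hσ ha

/-- A turning point at the singular point is itself the upper boundary. -/
theorem b_eq_one (h : FB P Z a b) (hσ : P.σ = 1) (hQ : P.Q = 1) : b = 1 := by
  have hb1 : 1 ≤ b := hQ ▸ h.le_b
  have ha1 : a < 1 := hQ ▸ h.a_lt_Q
  by_contra hne
  have hlt : 1 < b := lt_of_le_of_ne hb1 (Ne.symm hne)
  have h1 : P.V b (Z b) ≤ P.V b (Z 1) :=
    V_le_V_iff.2 (h.antitoneOn ⟨ha1.le, hb1⟩ ⟨h.lt.le, le_rfl⟩ hb1)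
  have h2 := V_sub_V (P := P) b 1 (Z 1)
  rw [h.right] at h1
  rw [h.V_one hσ ha1.le hb1, hQ] at h2
  nlinarith [mul_pos P.R_pos (mul_pos (sub_pos.2 hlt) (sub_pos.2 hlt))]

/-- The part of a solution beyond the singular point solves the problem started there. -/
theorem restrict_one (h : FB P Z a b) (hσ : P.σ = 1) (ha : a ≤ 1) (hQ : 1 < P.Q) : FB P Z 1 b where
  toOrbit := h.toOrbit.mono ha le_rfl
  lt := hQ.trans_le h.le_b
  left := h.V_one hσ ha (hQ.le.trans h.le_b)
  right := h.right
  le_b := h.le_b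

theorem below_Icc (h : FB P Z a b) {p : ℝ} (hp : p ∈ Icc a b) (hs : 0 < P.s p) :
    P.V p (Z p) < P.s p := by
  rcases eq_or_lt_of_le hp.1 with rfl | h1
  · rw [h.left]; exact hs
  rcases eq_or_lt_of_le hp.2 with rfl | h2
  · rw [h.right]; exact hs
  · exact h.below p ⟨h1, h2⟩ hs

theorem denom_pos (h : FB P Z a b) {p : ℝ} (hp : p ∈ Icc a b) (hσ : p ≠ P.σ) :
    0 < P.s p * (P.s p - P.V p (Z p)) :=
  Params.denom_pos (s_ne (h.pos_of_mem hp) hσ) (h.nonneg p hp) (h.below_Icc hp)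

end FB

/-! ### The cost integrand along a solution -/

/-- The cost integrand along `Z`, with its forced value at the singular point. -/
noncomputable def g (P : Params) (Z : ℝ → ℝ) (p : ℝ) : ℝ :=
  if p = P.σ then P.gOne else P.G p (Z p)

theorem g_of_ne {p : ℝ} (h : p ≠ P.σ) : P.g Z p = P.G p (Z p) := if_neg h

namespace FB

theorem σ_eq_one (h : FB P Z a b) (hm : P.σ ∈ Icc a b) : P.σ = 1 := by
  rcases P.σ_eq with h1 | h1
  · exact h1
  · have := h.pos_of_mem hm; rw [h1] at this; norm_num at this

theorem continuousOn_g (h : FB P Z a b) : ContinuousOn (P.g Z) (Icc a b) := by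
  intro p hp
  rcases eq_or_ne p P.σ with rfl | hne
  · have hσ := h.σ_eq_one hp
    rw [hσ] at hp ⊢
    rw [← continuousWithinAt_sdiff_self]
    have hunion : Icc a b \ {1} ⊆ Ico a 1 ∪ Ioc 1 b := by
      rintro t ⟨ht, hne⟩
      rcases lt_or_gt_of_ne hne with h1 | h1
      · exact Or.inl ⟨ht.1, h1⟩
      · exact Or.inr ⟨h1, ht.2⟩
    refine ContinuousWithinAt.mono ?_ hunion
    have hg : ∀ l : Filter ℝ, (∀ᶠ t in l, t ≠ 1) → Tendsto (fun p => P.G p (Z p)) l (𝓝 P.gOne) →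
        Tendsto (P.g Z) l (𝓝 (P.g Z 1)) := by
      intro l hl ht
      rw [show P.g Z 1 = P.gOne by simp [g, hσ]]
      refine ht.congr' ?_
      filter_upwards [hl] with t ht
      rw [g_of_ne (by rw [hσ]; exact ht)]
    refine ContinuousWithinAt.union ?_ ?_
    · rcases eq_or_lt_of_le hp.1 with ha | ha
      · rw [ha, Ico_self, ContinuousWithinAt, nhdsWithin_empty]; exact tendsto_bot
      · refine (hg (𝓝[<] 1) (eventually_mem_nhdsWithin.mono fun t ht => ne_of_lt ht)
          ((h.toOrbit.mono le_rfl hp.2).tendsto_G_left hσ ha)).mono_left ?_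
        exact nhdsWithin_mono _ fun t ht => ht.2
    · rcases eq_or_lt_of_le hp.2 with hb | hb
      · rw [← hb, Ioc_self, ContinuousWithinAt, nhdsWithin_empty]; exact tendsto_bot
      · refine (hg (𝓝[>] 1) (eventually_mem_nhdsWithin.mono fun t ht => ne_of_gt ht)
          ((h.toOrbit.mono hp.1 le_rfl).tendsto_G_right hσ hb
            (h.V_one hσ hp.1 hp.2))).mono_left ?_
        exact nhdsWithin_mono _ fun t ht => ht.1
  · have h1 : ContinuousWithinAt (fun p => P.G p (Z p)) (Icc a b) p := by
      have hs : ContinuousWithinAt P.s (Icc a b) p := continuous_s.continuousWithinAt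
      have hV := continuousOn_V (P := P) h.cont p hp
      exact hV.div (hs.mul (hs.sub hV)) (h.denom_pos hp hne).ne'
    refine h1.congr_of_eventuallyEq ?_ (g_of_ne hne)
    filter_upwards [mem_nhdsWithin_of_mem_nhds (isOpen_ne.mem_nhds hne)] with t ht
    exact g_of_ne ht

/-- A solution is continuously differentiable up to the ends and through the singular point. -/
theorem hasDerivWithinAt (h : FB P Z a b) {p : ℝ} (hp : p ∈ Icc a b) :
    HasDerivWithinAt Z (-(p * P.g Z p)) (Icc a b) p :=
  hasDerivWithinAt_Icc_of_off (g := fun p => -(p * P.g Z p)) P.σ h.cont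
    (continuousOn_id.mul h.continuousOn_g).neg
    (fun t ht hne => by rw [g_of_ne hne]; exact h.ode t ht hne) p hp

theorem g_nonneg (h : FB P Z a b) {p : ℝ} (hp : p ∈ Icc a b) : 0 ≤ P.g Z p := by
  have hopen : ∀ t ∈ Icc a b, t ≠ P.σ → 0 ≤ P.g Z t := fun t ht hne => by
    rw [g_of_ne hne]
    exact Params.G_nonneg (h.nonneg t ht) (h.below_Icc ht)
  rcases eq_or_ne p P.σ with rfl | hne
  · have h1 := h.hasDerivWithinAt hp
    have h2 : derivWithin Z (Icc a b) P.σ ≤ 0 := h.antitoneOn.derivWithin_nonpos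
    rw [h1.derivWithin (uniqueDiffOn_Icc h.lt _ hp)] at h2
    exact nonneg_of_mul_nonneg_right (by linarith) (h.pos_of_mem hp)
  · exact hopen p hp hne

theorem intervalIntegrable_g (h : FB P Z a b) {u v : ℝ} (hu : u ∈ Icc a b) (hv : v ∈ Icc a b) :
    IntervalIntegrable (P.g Z) volume u v :=
  (h.continuousOn_g.mono (uIcc_subset_Icc hu hv)).intervalIntegrable

end FB

theorem ae_g_eq : ∀ᵐ p : ℝ, P.g Z p = P.G p (Z p) := by
  have : ∀ᵐ p : ℝ, p ≠ P.σ := by simp [ae_iff, measure_singleton]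
  filter_upwards [this] with p hp
  exact g_of_ne hp

theorem integral_g (u v : ℝ) : ∫ p in u..v, P.g Z p = ∫ p in u..v, P.G p (Z p) :=
  intervalIntegral.integral_congr_ae (ae_g_eq.mono fun _ h _ => h)

namespace FB

theorem intervalIntegrable_G (h : FB P Z a b) :
    IntervalIntegrable (fun p => P.G p (Z p)) volume a b :=
  (h.intervalIntegrable_g ⟨le_rfl, h.lt.le⟩ ⟨h.lt.le, le_rfl⟩).congr_ae
    (ae_restrict_of_ae ae_g_eq)

theorem integral_g_pos (h : FB P Z a b) {v : ℝ} (hav : a < v) (hv : v ≤ b) :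
    0 < ∫ p in a..v, P.g Z p := by
  obtain ⟨x, hx, hxσ⟩ : ∃ x ∈ Ioo a v, x ≠ P.σ := by
    obtain ⟨x, hx⟩ := exists_between hav
    rcases eq_or_ne x P.σ with h1 | h1
    · obtain ⟨y, hy⟩ := exists_between hx.1
      exact ⟨y, ⟨hy.1, hy.2.trans hx.2⟩, by rw [← h1]; exact hy.2.ne⟩
    · exact ⟨x, hx, h1⟩
  have hm : x ∈ Ioo a b := ⟨hx.1, hx.2.trans_le hv⟩
  refine intervalIntegral.integral_pos hav (h.continuousOn_g.mono (Icc_subset_Icc le_rfl hv))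
    (fun p hp => h.g_nonneg ⟨hp.1.le, hp.2.trans hv⟩) ⟨x, Ioo_subset_Icc_self hx, ?_⟩
  rw [g_of_ne hxσ]
  exact div_pos (h.V_pos hm hxσ) (h.denom_pos (Ioo_subset_Icc_self hm) hxσ)

theorem integral_mul_g (h : FB P Z a b) {u v : ℝ} (hu : a ≤ u) (huv : u ≤ v) (hv : v ≤ b) :
    ∫ p in u..v, p * P.g Z p = Z u - Z v := by
  have hsub := Icc_subset_Icc hu hv
  have := intervalIntegral.integral_eq_sub_of_hasDerivAt_of_le (f := Z)
    (f' := fun p => -(p * P.g Z p)) huv (h.cont.mono hsub)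
    (fun p hp => (h.hasDerivWithinAt (hsub (Ioo_subset_Icc_self hp))).hasDerivAt
      (Icc_mem_nhds (hu.trans_lt hp.1) (hp.2.trans_le hv)))
    (((continuousOn_id.mul h.continuousOn_g).neg.mono hsub).intervalIntegrable_of_Icc huv)
  rw [intervalIntegral.integral_neg] at this
  linarith

end FB

/-! ### Comparison of solutions -/

theorem Orbit.le_of_le (hZ : Orbit P Z a b) (hW : Orbit P W a b) (h0 : Z a ≤ W a) :
    ∀ p ∈ Icc a b, Z p ≤ W p := by
  have hne : ∀ p ∈ Ioo a b, 0 < Z p - W p → p ≠ P.σ := by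
    rintro p hp hpos rfl
    have hσ : P.σ = 1 := by
      rcases P.σ_eq with h1 | h1
      · exact h1
      · have := hZ.a_pos.trans hp.1; rw [h1] at this; norm_num at this
    rw [hσ] at hp hpos
    have h1 := (hZ.mono le_rfl hp.2.le).V_one_eq_zero hσ hp.1
    have h2 := (hW.mono le_rfl hp.2.le).V_one_eq_zero hσ hp.1
    have := V_eq_V_iff.1 (h1.trans h2.symm)
    linarith
  intro p hp
  have := nonpos_of_barrier (φ := fun p => Z p - W p) (hZ.cont.sub hW.cont) (by linarith)
    (fun t ht hpos => (hZ.ode t ht (hne t ht hpos)).sub (hW.ode t ht (hne t ht hpos)))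
    (fun t ht hpos => by
      have h1 := G_mono (hW.nonneg t (Ioo_subset_Icc_self ht)) (hZ.below t ht)
        (by linarith : W t ≤ Z t)
      have h2 := mul_le_mul_of_nonneg_left h1 (hZ.a_pos.trans ht.1).le
      linarith) p hp
  linarith

namespace FB

variable {a₁ b₁ a₂ b₂ : ℝ}

theorem le_of_le_left (h₁ : FB P Z a₁ b₁) (h₂ : FB P W a₂ b₂) (ha : a₂ ≤ a₁) :
    ∀ p ∈ Icc a₁ (min b₁ b₂), Z p ≤ W p := by
  have hab : a₁ ≤ b₂ := (h₁.a_lt_Q.trans_le h₂.le_b).le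
  refine (h₁.toOrbit.mono le_rfl (min_le_left _ _)).le_of_le
    (h₂.toOrbit.mono ha (min_le_right _ _)) ?_
  rw [← V_le_V_iff (P := P) (p := a₁), h₁.left]
  exact h₂.nonneg a₁ ⟨ha, hab⟩

/-- A solution that starts further left ends further right. -/
theorem b_le_b (h₁ : FB P Z a₁ b₁) (h₂ : FB P W a₂ b₂) (ha : a₂ ≤ a₁) : b₁ ≤ b₂ := by
  by_contra! hlt
  have hab : a₁ < b₂ := h₁.a_lt_Q.trans_le h₂.le_b
  have h1 := h₁.le_of_le_left h₂ ha b₂ ⟨hab.le, by rw [min_eq_right hlt.le]⟩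
  rw [← V_le_V_iff (P := P) (p := b₂), h₂.right] at h1
  rcases eq_or_ne b₂ P.σ with hσ | hσ
  · have hσ1 : P.σ = 1 := h₂.σ_eq_one (hσ ▸ ⟨h₂.lt.le, le_rfl⟩)
    rw [hσ1] at hσ
    rcases lt_or_eq_of_le (hσ ▸ h₂.le_b : P.Q ≤ 1) with hQ | hQ
    · linarith [h₂.b_lt_one hσ1 hQ]
    · linarith [h₁.b_eq_one hσ1 hQ]
  · linarith [h₁.V_pos ⟨hab, hlt⟩ hσ]

theorem unique (h₁ : FB P Z a b₁) (h₂ : FB P W a b₂) : b₁ = b₂ ∧ ∀ p ∈ Icc a b₁, Z p = W p := by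
  have hb := le_antisymm (h₁.b_le_b h₂ le_rfl) (h₂.b_le_b h₁ le_rfl)
  subst hb
  refine ⟨rfl, fun p hp => le_antisymm ?_ ?_⟩
  · exact h₁.le_of_le_left h₂ le_rfl p (by rwa [min_self])
  · exact h₂.le_of_le_left h₁ le_rfl p (by rwa [min_self])

theorem integral_eq (h₁ : FB P Z a b₁) (h₂ : FB P W a b₂) :
    ∫ p in a..b₁, P.G p (Z p) = ∫ p in a..b₂, P.G p (W p) := by
  obtain ⟨rfl, he⟩ := h₁.unique h₂
  refine intervalIntegral.integral_congr fun p hp => ?_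
  rw [uIcc_of_le h₁.lt.le] at hp
  simp only [he p hp]

theorem g_le_g (h₁ : FB P Z a₁ b₁) (h₂ : FB P W a₂ b₂) (ha : a₂ ≤ a₁) {p : ℝ}
    (hp : p ∈ Icc a₁ b₁) : P.g Z p ≤ P.g W p := by
  have hb := h₁.b_le_b h₂ ha
  rcases eq_or_ne p P.σ with rfl | hσ
  · simp [g]
  · rw [g_of_ne hσ, g_of_ne hσ]
    exact G_mono (h₁.nonneg p hp) (h₂.below_Icc ⟨ha.trans hp.1, hp.2.trans hb⟩)
      (h₁.le_of_le_left h₂ ha p (by rwa [min_eq_left hb]))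

/-- The weighted cost is monotone in the solution, with the initial part split off. -/
theorem integral_weight_le (h₁ : FB P Z a₁ b₁) (h₂ : FB P W a₂ b₂) (ha : a₂ ≤ a₁) {w : ℝ → ℝ}
    (hw : Continuous w) (hw0 : ∀ p, a₂ ≤ p → 0 ≤ w p) :
    (∫ p in a₂..a₁, w p * P.g W p) + ∫ p in a₁..b₁, w p * P.g Z p ≤
      ∫ p in a₂..b₂, w p * P.g W p := by
  have hb := h₁.b_le_b h₂ ha
  have ha2 : a₂ ∈ Icc a₂ b₂ := ⟨le_rfl, h₂.lt.le⟩
  have hb2 : b₂ ∈ Icc a₂ b₂ := ⟨h₂.lt.le, le_rfl⟩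
  have ha1 : a₁ ∈ Icc a₂ b₂ := ⟨ha, h₁.lt.le.trans hb⟩
  have hb1 : b₁ ∈ Icc a₂ b₂ := ⟨ha.trans h₁.lt.le, hb⟩
  have hi : ∀ {u v}, u ∈ Icc a₂ b₂ → v ∈ Icc a₂ b₂ →
      IntervalIntegrable (fun p => w p * P.g W p) volume u v := fun hu hv =>
    ((hw.continuousOn.mul h₂.continuousOn_g).mono (uIcc_subset_Icc hu hv)).intervalIntegrable
  have hi1 : IntervalIntegrable (fun p => w p * P.g Z p) volume a₁ b₁ :=
    (hw.continuousOn.mul h₁.continuousOn_g).intervalIntegrable_of_Icc h₁.lt.le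
  have e1 := intervalIntegral.integral_add_adjacent_intervals (hi ha2 ha1) (hi ha1 hb1)
  have e2 := intervalIntegral.integral_add_adjacent_intervals (hi ha2 hb1) (hi hb1 hb2)
  have e3 : ∫ p in a₁..b₁, w p * P.g Z p ≤ ∫ p in a₁..b₁, w p * P.g W p :=
    intervalIntegral.integral_mono_on h₁.lt.le hi1 (hi ha1 hb1) fun p hp =>
      mul_le_mul_of_nonneg_left (h₁.g_le_g h₂ ha hp) (hw0 p (ha.trans hp.1))
  have e4 : 0 ≤ ∫ p in b₁..b₂, w p * P.g W p :=
    intervalIntegral.integral_nonneg hb fun p hp =>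
      mul_nonneg (hw0 p (hb1.1.trans hp.1)) (h₂.g_nonneg ⟨hb1.1.trans hp.1, hp.2⟩)
  linarith

/-- Starting strictly earlier makes the cost strictly larger. -/
theorem integral_lt (h₁ : FB P Z a₁ b₁) (h₂ : FB P W a₂ b₂) (ha : a₂ < a₁) :
    ∫ p in a₁..b₁, P.G p (Z p) < ∫ p in a₂..b₂, P.G p (W p) := by
  have h := h₁.integral_weight_le h₂ ha.le (w := fun _ => 1) continuous_const (by simp)
  simp only [one_mul, integral_g] at h
  have hpos := h₂.integral_g_pos ha (h₁.a_lt_Q.trans_le h₂.le_b).le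
  rw [integral_g] at hpos
  linarith

/-- The cost changes by no more than the initial value does. This needs no continuity of
the final point, because `Z' = -p G` lets the weight `p - a₂` be integrated exactly. -/
theorem integral_sub_le (h₁ : FB P Z a₁ b₁) (h₂ : FB P W a₂ b₂) (ha : a₂ ≤ a₁) :
    a₂ * (∫ p in a₂..b₂, P.G p (W p)) - a₂ * (∫ p in a₁..b₁, P.G p (Z p)) ≤ W a₂ - Z a₁ := by
  have h := h₁.integral_weight_le h₂ ha (w := fun p => p - a₂) (by fun_prop)
    (fun p hp => by simpa using hp)
  have hb := h₁.b_le_b h₂ ha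
  have e : ∀ {Y : ℝ → ℝ} {u v : ℝ}, FB P Y u v →
      ∫ p in u..v, (p - a₂) * P.g Y p = Y u - Y v - a₂ * ∫ p in u..v, P.G p (Y p) := by
    intro Y u v hY
    have h1 := hY.integral_mul_g le_rfl hY.lt.le le_rfl
    rw [← integral_g, ← intervalIntegral.integral_const_mul, ← h1,
      ← intervalIntegral.integral_sub]
    · exact intervalIntegral.integral_congr fun p _ => by ring
    · exact (continuousOn_id.mul hY.continuousOn_g).intervalIntegrable_of_Icc hY.lt.le
    · exact (continuousOn_const.mul hY.continuousOn_g).intervalIntegrable_of_Icc hY.lt.le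
  have h0 : 0 ≤ ∫ p in a₂..a₁, (p - a₂) * P.g W p :=
    intervalIntegral.integral_nonneg ha fun p hp =>
      mul_nonneg (by linarith [hp.1]) (h₂.g_nonneg ⟨hp.1, hp.2.trans (h₁.lt.le.trans hb)⟩)
  rw [e h₁, e h₂] at h
  -- The final values are ordered because `m` moves away from its turning value beyond `Q`.
  have hend : Z b₁ ≤ W b₂ := by
    rw [← V_le_V_iff (P := P) (p := b₁), h₁.right]
    have h1 := V_sub_V (P := P) b₁ b₂ (W b₂)
    rw [h₂.right] at h1
    have h2 := h₁.le_b
    nlinarith [mul_nonneg P.R_pos.le (mul_nonneg (sub_nonneg.2 hb)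
      (by linarith : 0 ≤ b₁ + b₂ - 2 * P.Q))]
  linarith

/-- Away from the singular point, starting strictly earlier means stopping strictly later. -/
theorem b_lt_b (h₁ : FB P Z a₁ b₁) (h₂ : FB P W a₂ b₂) (ha : a₂ < a₁)
    (hσ : P.σ ∉ Icc a₁ b₁) : b₁ < b₂ := by
  refine lt_of_le_of_ne (h₁.b_le_b h₂ ha.le) fun hb => ?_
  subst hb
  have hne : ∀ p ∈ Icc a₁ b₁, p ≠ P.σ := by rintro p hp rfl; exact hσ hp
  have hsub : Icc a₁ b₁ ⊆ Icc a₂ b₁ := Icc_subset_Icc ha.le le_rfl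
  have hle : ∀ p ∈ Icc a₁ b₁, Z p ≤ W p := fun p hp =>
    h₁.le_of_le_left h₂ ha.le p (by rwa [min_self])
  have hd : ∀ p ∈ Icc a₁ b₁, 0 < (P.s p - P.V p (Z p)) * (P.s p - P.V p (W p)) := by
    intro p hp
    have d1 := h₁.denom_pos hp (hne p hp)
    have d2 := h₂.denom_pos (hsub hp) (hne p hp)
    rcases lt_or_gt_of_ne (left_ne_zero_of_mul d1.ne') with hs | hs
    · exact mul_pos_of_neg_of_neg (neg_of_mul_pos_right d1 hs.le) (neg_of_mul_pos_right d2 hs.le)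
    · exact mul_pos (pos_of_mul_pos_right d1 hs.le) (pos_of_mul_pos_right d2 hs.le)
  -- Convexity of the exponential gives a Lipschitz bound for `V`.
  have hV : ∀ p ∈ Icc a₁ b₁, P.V p (W p) - P.V p (Z p) ≤
      P.β * (Real.exp (P.c * Z p) + Real.exp (P.c * W p)) * (W p - Z p) := by
    intro p hp
    have hexp : ∀ x y : ℝ, Real.exp x - Real.exp y ≤ Real.exp x * (x - y) := by
      intro x y
      have := mul_le_mul_of_nonneg_left (Real.add_one_le_exp (y - x)) (Real.exp_pos x).le
      rw [← Real.exp_add] at this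
      ring_nf at this ⊢
      linarith
    have hD := sub_nonneg.2 (hle p hp)
    have e0 : P.V p (W p) - P.V p (Z p) =
        (Real.exp (P.c * W p) - Real.exp (P.c * Z p)) / P.κ := by rw [V, V]; ring
    have e1 := hexp (P.c * W p) (P.c * Z p)
    have e2 := hexp (P.c * Z p) (P.c * W p)
    have pZ := Real.exp_pos (P.c * Z p)
    have pW := Real.exp_pos (P.c * W p)
    rw [e0, β]
    rcases P.sign_cases with ⟨k, hc⟩ | ⟨k, hc⟩
    · rw [div_le_iff₀ k]
      have : P.c / P.κ * (Real.exp (P.c * Z p) + Real.exp (P.c * W p)) * (W p - Z p) * P.κ =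
          (Real.exp (P.c * Z p) + Real.exp (P.c * W p)) * (P.c * (W p - Z p)) := by
        field_simp
      rw [this]
      nlinarith [mul_nonneg pZ.le (mul_nonneg hc.le hD)]
    · rw [div_le_iff_of_neg k]
      have : P.c / P.κ * (Real.exp (P.c * Z p) + Real.exp (P.c * W p)) * (W p - Z p) * P.κ =
          (Real.exp (P.c * Z p) + Real.exp (P.c * W p)) * (P.c * (W p - Z p)) := by
        field_simp [k.ne]
      rw [this]
      nlinarith [mul_nonneg pW.le (mul_nonneg (neg_nonneg.2 hc.le) hD)]
  have hcont : ContinuousOn (fun p => p * (P.β * (Real.exp (P.c * Z p) + Real.exp (P.c * W p))) /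
      ((P.s p - P.V p (Z p)) * (P.s p - P.V p (W p)))) (Icc a₁ b₁) := by
    have hcW := h₂.cont.mono hsub
    exact (continuousOn_id.mul (continuousOn_const.mul
      ((continuousOn_const.mul h₁.cont).rexp.add (continuousOn_const.mul hcW).rexp))).div
      ((continuous_s.continuousOn.sub (continuousOn_V h₁.cont)).mul
        (continuous_s.continuousOn.sub (continuousOn_V hcW))) fun p hp => (hd p hp).ne'
  -- off the singular point the equation is Lipschitz, so `(W - Z) exp (K p)` increases
  obtain ⟨K, hK⟩ := isCompact_Icc.bddAbove_image hcont
  have hmono := monotoneOn_Icc_of_hasDerivAt_nonneg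
    (f := fun p => (W p - Z p) * Real.exp (K * p)) (a := a₁) (b := b₁)
    (f' := fun p => (-(p * P.G p (W p)) - -(p * P.G p (Z p))) * Real.exp (K * p) +
      (W p - Z p) * (Real.exp (K * p) * K))
    (((h₂.cont.mono hsub).sub h₁.cont).mul
      (by fun_prop : Continuous fun p : ℝ => Real.exp (K * p)).continuousOn)
    (fun p hp => ((h₂.ode p ⟨ha.trans hp.1, hp.2⟩ (hne p (Ioo_subset_Icc_self hp))).sub
      (h₁.ode p hp (hne p (Ioo_subset_Icc_self hp)))).mul
      (((hasDerivAt_id p).const_mul K).exp.congr_deriv (by simp)))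
    (fun p hp => by
      have hp' := Ioo_subset_Icc_self hp
      have hp0 := h₁.pos_of_mem hp'
      have h1 := G_sub_G (P := P) (s_ne hp0 (hne p hp')) (left_ne_zero_of_mul (hd p hp').ne')
        (right_ne_zero_of_mul (hd p hp').ne')
      have h2 : p * P.G p (W p) - p * P.G p (Z p) ≤ K * (W p - Z p) := by
        rw [← mul_sub, h1]
        refine le_trans ?_ (mul_le_mul_of_nonneg_right (hK (mem_image_of_mem _ hp'))
          (sub_nonneg.2 (hle p hp')))
        rw [← mul_div_assoc, div_mul_eq_mul_div, div_le_div_iff_of_pos_right (hd p hp')]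
        nlinarith [mul_le_mul_of_nonneg_left (hV p hp') hp0.le]
      have h3 := mul_nonneg (sub_nonneg.2 h2) (Real.exp_pos (K * p)).le
      linarith)
    ⟨le_rfl, h₁.lt.le⟩ ⟨h₁.lt.le, le_rfl⟩ h₁.lt.le
  have hend : W b₁ = Z b₁ := V_eq_V_iff.1 (h₂.right.trans h₁.right.symm)
  simp only [hend, sub_self, zero_mul] at hmono
  have hstart : Z a₁ < W a₁ := by
    rw [← V_lt_V_iff (P := P) (p := a₁), h₁.left]
    exact h₂.V_pos ⟨ha, h₁.lt⟩ (hne a₁ ⟨le_rfl, h₁.lt.le⟩)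
  nlinarith [mul_pos (sub_pos.2 hstart) (Real.exp_pos (K * a₁))]

end FB
end Params
end MertonTC

namespace MertonTC

/-! ### Existence of solutions of truncated equations -/

theorem exists_first_zero {f : ℝ → ℝ} {x y : ℝ} (hxy : x ≤ y) (hc : ContinuousOn f (Icc x y))
    (hx : 0 ≤ f x) (hy : f y ≤ 0) : ∃ b ∈ Icc x y, f b = 0 ∧ ∀ p ∈ Icc x b, 0 ≤ f p := by
  have hcl : IsCompact (Icc x y ∩ f ⁻¹' Iic 0) :=
    isCompact_Icc.of_isClosed_subset (hc.preimage_isClosed_of_isClosed isClosed_Icc isClosed_Iic)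
      inter_subset_left
  obtain ⟨b, hb⟩ := hcl.exists_isLeast ⟨y, ⟨hxy, le_rfl⟩, hy⟩
  have hpos : ∀ p ∈ Icc x y, p < b → 0 < f p := by
    intro p hp hpb
    by_contra hneg
    exact absurd (hb.2 ⟨hp, not_lt.1 hneg⟩) (not_le.2 hpb)
  have hb0 : f b = 0 := by
    refine le_antisymm hb.1.2 ?_
    by_contra hneg
    push Not at hneg
    have hbx : x ≤ b := hb.1.1.1
    obtain ⟨r, hr, hr0⟩ := intermediate_value_Icc' hbx
      (hc.mono (Icc_subset_Icc le_rfl hb.1.1.2)) ⟨hneg.le, hx⟩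
    have : r = b := le_antisymm hr.2 (hb.2 ⟨⟨hr.1, hr.2.trans hb.1.1.2⟩, hr0.le⟩)
    rw [this] at hr0; linarith
  refine ⟨b, hb.1.1, hb0, fun p hp => ?_⟩
  rcases eq_or_lt_of_le hp.2 with rfl | h
  · exact hb0.ge
  · exact (hpos p ⟨hp.1, hp.2.trans hb.1.1.2⟩ h).le

namespace Params

variable {P : Params} {Z W : ℝ → ℝ} {a b : ℝ}

/-- A truncation `u p` of `V`, acting at the points `p ∈ D`, which keeps the equation away from
its singularity `V = s`. -/
structure Clip (P : Params) (u : ℝ → ℝ → ℝ) (D : Set ℝ) : Prop where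
  pos : ∀ p ∈ D, 0 < p
  mono : ∀ p ∈ D, Monotone (u p)
  nonneg : ∀ p ∈ D, ∀ w, 0 ≤ u p w
  eq_zero : ∀ p ∈ D, ∀ w ≤ 0, u p w = 0
  denom : ∀ p ∈ D, ∀ w, 0 < P.s p * (P.s p - u p w)

/-- The right-hand side of the equation, up to sign, as a function of the truncated `V`. -/
noncomputable def F (P : Params) (p w : ℝ) : ℝ := p * (w / (P.s p * (P.s p - w)))

/-- `Z` solves the equation with `V` replaced by its truncation. -/
structure ClipSol (P : Params) (u : ℝ → ℝ → ℝ) (Z : ℝ → ℝ) (D : Set ℝ) : Prop where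
  cont : ContinuousOn Z D
  ode : ∀ p ∈ interior D, HasDerivAt Z (-P.F p (u p (P.V p (Z p)))) p

theorem F_sub_F {p w w' : ℝ} (h : 0 < P.s p * (P.s p - w)) (h' : 0 < P.s p * (P.s p - w')) :
    P.F p w' - P.F p w = p * (w' - w) / ((P.s p - w) * (P.s p - w')) := by
  have h1 := left_ne_zero_of_mul h.ne'
  have h2 := right_ne_zero_of_mul h.ne'
  have h3 := right_ne_zero_of_mul h'.ne'
  rw [F, F]; field_simp; ring

theorem denom_mul_pos {p w w' : ℝ} (h : 0 < P.s p * (P.s p - w))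
    (h' : 0 < P.s p * (P.s p - w')) : 0 < (P.s p - w) * (P.s p - w') := by
  rcases lt_or_gt_of_ne (left_ne_zero_of_mul h.ne') with hs | hs
  · exact mul_pos_of_neg_of_neg (neg_of_mul_pos_right h hs.le) (neg_of_mul_pos_right h' hs.le)
  · exact mul_pos (pos_of_mul_pos_right h hs.le) (pos_of_mul_pos_right h' hs.le)

section Clip

variable {u : ℝ → ℝ → ℝ} {D : Set ℝ}

theorem Clip.F_mono (hu : Clip P u D) {p z w : ℝ} (hp : p ∈ D) (hzw : z ≤ w) :
    P.F p (u p (P.V p z)) ≤ P.F p (u p (P.V p w)) := by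
  have h1 := hu.denom p hp (P.V p z)
  have h2 := hu.denom p hp (P.V p w)
  rw [← sub_nonneg, F_sub_F h1 h2]
  exact div_nonneg (mul_nonneg (hu.pos p hp).le
    (sub_nonneg.2 (hu.mono p hp (V_le_V_iff.2 hzw)))) (denom_mul_pos h1 h2).le

theorem Clip.F_nonneg (hu : Clip P u D) {p z : ℝ} (hp : p ∈ D) : 0 ≤ P.F p (u p z) :=
  mul_nonneg (hu.pos p hp).le (div_nonneg (hu.nonneg p hp z) (hu.denom p hp z).le)

theorem ClipSol.antitoneOn {x y : ℝ} (hu : Clip P u (Ioo x y)) (h : ClipSol P u Z (Icc x y)) :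
    AntitoneOn Z (Icc x y) :=
  antitoneOn_Icc_of_hasDerivAt_nonpos h.cont (fun p hp => h.ode p (by rwa [interior_Icc]))
    fun _ hp => neg_nonpos.2 (hu.F_nonneg hp)

theorem ClipSol.mono {D' : Set ℝ} (h : ClipSol P u Z D) (hD : D' ⊆ D) : ClipSol P u Z D' :=
  ⟨h.cont.mono hD, fun p hp => h.ode p (interior_mono hD hp)⟩

theorem ClipSol.le_of_le {x y : ℝ} (hu : Clip P u (Ioo x y)) (hZ : ClipSol P u Z (Icc x y))
    (hW : ClipSol P u W (Icc x y)) (h0 : Z x ≤ W x) : ∀ p ∈ Icc x y, Z p ≤ W p := by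
  intro p hp
  have := nonpos_of_barrier (φ := fun p => Z p - W p) (hZ.cont.sub hW.cont) (by linarith)
    (fun t ht _ => (hZ.ode t (by rwa [interior_Icc])).sub (hW.ode t (by rwa [interior_Icc])))
    (fun t ht hpos => by
      have h1 := hu.F_mono ht (by linarith : W t ≤ Z t)
      linarith) p hp
  linarith

/-- The equation is contracting forwards, because its right-hand side is decreasing. -/
theorem ClipSol.sub_le_sub {x y : ℝ} (hu : Clip P u (Ioo x y)) (hZ : ClipSol P u Z (Icc x y))
    (hW : ClipSol P u W (Icc x y)) (h0 : Z x ≤ W x) :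
    ∀ p ∈ Icc x y, W p - Z p ≤ W x - Z x := by
  have hle := ClipSol.le_of_le hu hZ hW h0
  intro p hp
  exact antitoneOn_Icc_of_hasDerivAt_nonpos (hW.cont.sub hZ.cont)
    (fun t ht => (hW.ode t (by rwa [interior_Icc])).sub (hZ.ode t (by rwa [interior_Icc])))
    (fun t ht => by
      have h1 := hu.F_mono ht (hle t (Ioo_subset_Icc_self ht))
      linarith) ⟨le_rfl, hp.1.trans hp.2⟩ hp hp.1

/-- Before the turning point a solution cannot fall below `m`. -/
theorem ClipSol.V_nonneg {x y : ℝ} (hu : Clip P u (Ioo x y)) (hZ : ClipSol P u Z (Icc x y))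
    (hQ : y ≤ P.Q) (h0 : 0 ≤ P.V x (Z x)) : ∀ p ∈ Icc x y, 0 ≤ P.V p (Z p) := by
  intro p hp
  have := nonpos_of_barrier (φ := fun p => -P.V p (Z p)) (continuousOn_V hZ.cont).neg
    (by linarith)
    (fun t ht _ => (hasDerivAt_V (P := P) (hZ.ode t (by rwa [interior_Icc]))).neg)
    (fun t ht hpos => by
      rw [hu.eq_zero t ht _ (by linarith), F]
      have := mul_nonneg P.R_pos.le (by linarith [ht.2] : 0 ≤ P.Q - t)
      simp only [zero_div, mul_zero, neg_zero, zero_add]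
      linarith) p hp
  linarith

theorem abs_exp_sub_exp_le {x y r : ℝ} (hx : x ≤ r) (hy : y ≤ r) :
    |Real.exp x - Real.exp y| ≤ Real.exp r * |x - y| := by
  have key : ∀ x y : ℝ, y ≤ x → x ≤ r → Real.exp x - Real.exp y ≤ Real.exp r * (x - y) := by
    intro x y hxy hx
    have h1 := mul_le_mul_of_nonneg_left (Real.add_one_le_exp (y - x)) (Real.exp_pos x).le
    rw [← Real.exp_add] at h1
    have h2 := mul_le_mul_of_nonneg_right (Real.exp_le_exp.2 hx) (sub_nonneg.2 hxy)
    ring_nf at h1 h2 ⊢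
    linarith
  rcases le_total y x with h | h
  · rw [abs_of_nonneg (sub_nonneg.2 (Real.exp_le_exp.2 h)), abs_of_nonneg (sub_nonneg.2 h)]
    exact key x y h hx
  · rw [abs_sub_comm, abs_sub_comm x y, abs_of_nonneg (sub_nonneg.2 (Real.exp_le_exp.2 h)),
      abs_of_nonneg (sub_nonneg.2 h)]
    exact key y x h hy

theorem abs_V_sub_V_le {p z w r : ℝ} (hz : |z| ≤ r) (hw : |w| ≤ r) :
    |P.V p z - P.V p w| ≤ Real.exp (|P.c| * r) * |P.c| / |P.κ| * |z - w| := by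
  have h1 : P.V p z - P.V p w = (Real.exp (P.c * z) - Real.exp (P.c * w)) / P.κ := by
    rw [V, V]; ring
  have hb : ∀ t, |t| ≤ r → P.c * t ≤ |P.c| * r := fun t ht =>
    (le_abs_self _).trans (by rw [abs_mul]; exact mul_le_mul_of_nonneg_left ht (abs_nonneg _))
  have h2 := abs_exp_sub_exp_le (hb z hz) (hb w hw)
  rw [h1, abs_div, div_mul_eq_mul_div]
  refine div_le_div_of_nonneg_right ?_ (abs_nonneg _)
  rw [← mul_sub, abs_mul] at h2
  linarith

/-- A uniform Lipschitz bound for the truncated right-hand side. -/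
theorem abs_F_sub_F_le (hu : Clip P u D) (hLip : ∀ p ∈ D, ∀ w w', |u p w - u p w'| ≤ |w - w'|)
    {d T r : ℝ} (hd : 0 < d) (hD : ∀ p ∈ D, p ≤ T ∧ ∀ w, d ≤ |P.s p - u p w|) {p z w : ℝ}
    (hp : p ∈ D) (hz : |z| ≤ r) (hw : |w| ≤ r) :
    |P.F p (u p (P.V p z)) - P.F p (u p (P.V p w))| ≤
      T / (d * d) * (Real.exp (|P.c| * r) * |P.c| / |P.κ|) * |z - w| := by
  have h1 := hu.denom p hp (P.V p z)
  have h2 := hu.denom p hp (P.V p w)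
  have hp0 := hu.pos p hp
  have hT : 0 < T := hp0.trans_le (hD p hp).1
  have hdd : d * d ≤ |P.s p - u p (P.V p w)| * |P.s p - u p (P.V p z)| :=
    mul_le_mul ((hD p hp).2 _) ((hD p hp).2 _) hd.le (abs_nonneg _)
  rw [F_sub_F h2 h1, abs_div, abs_mul, abs_mul, abs_of_pos hp0]
  have h3 := (hLip p hp (P.V p z) (P.V p w)).trans (abs_V_sub_V_le (P := P) (p := p) hz hw)
  refine (div_le_div₀ (mul_nonneg hT.le (abs_nonneg _))
    (mul_le_mul_of_nonneg_right (hD p hp).1 (abs_nonneg _)) (mul_pos hd hd) hdd).trans ?_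
  rw [mul_div_right_comm, mul_assoc (T / (d * d))]
  exact mul_le_mul_of_nonneg_left h3 (div_pos hT (mul_pos hd hd)).le

/-- Picard–Lindelöf for the truncated equation. Its right-hand side is bounded by `B`, so
the solution exists on the whole interval. -/
theorem exists_clipSol {x y d B z₀ : ℝ} (hxy : x ≤ y) (hu : Clip P u (Icc x y))
    (hLip : ∀ p ∈ Icc x y, ∀ w w', |u p w - u p w'| ≤ |w - w'|)
    (hcont : Continuous (Function.uncurry u)) (hd : 0 < d)
    (hD : ∀ p ∈ Icc x y, ∀ w, d ≤ |P.s p - u p w|)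
    (hB : ∀ p ∈ Icc x y, ∀ w, P.F p (u p w) ≤ B) :
    ∃ Z, Z x = z₀ ∧ ClipSol P u Z (Icc x y) := by
  have hx : x ∈ Icc x y := ⟨le_rfl, hxy⟩
  have hB0 : 0 ≤ B := (hu.F_nonneg hx).trans (hB x hx 0)
  have hy0 : 0 < y := hu.pos y ⟨hxy, le_rfl⟩
  set r := |z₀| + B * (y - x) with hr
  have hr0 : 0 ≤ B * (y - x) := mul_nonneg hB0 (sub_nonneg.2 hxy)
  have hK0 : 0 ≤ y / (d * d) * (Real.exp (|P.c| * r) * |P.c| / |P.κ|) := by positivity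
  have hball : ∀ z ∈ Metric.closedBall z₀ (B * (y - x)), |z| ≤ r := by
    intro z hz
    rw [Metric.mem_closedBall, Real.dist_eq] at hz
    have := abs_add_le (z - z₀) z₀
    rw [sub_add_cancel] at this
    linarith
  have hPL : IsPicardLindelof (fun p z => -P.F p (u p (P.V p z))) (⟨x, hx⟩ : Icc x y) z₀
      ⟨B * (y - x), hr0⟩ 0 ⟨B, hB0⟩ ⟨_, hK0⟩ := by
    constructor
    · intro p hp
      refine LipschitzOnWith.of_dist_le_mul fun z hz w hw => ?_
      rw [Real.dist_eq, Real.dist_eq, neg_sub_neg, abs_sub_comm]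
      exact abs_F_sub_F_le hu hLip hd (fun t ht => ⟨ht.2, hD t ht⟩) hp (hball z hz) (hball w hw)
    · intro z hz
      have h1 : Continuous fun p => u p (P.V p z) := by
        have : Continuous fun p => P.V p z := by
          unfold V; exact (continuous_const.sub continuous_M).div_const _
        exact hcont.comp (continuous_id.prodMk this)
      refine ContinuousOn.neg (continuousOn_id.mul (h1.continuousOn.div
        (continuous_s.continuousOn.mul (continuous_s.continuousOn.sub h1.continuousOn)) ?_))
      exact fun p hp => (hu.denom p hp _).ne'
    · intro p hp z hz
      rw [norm_neg, Real.norm_eq_abs, abs_of_nonneg (hu.F_nonneg hp)]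
      exact hB p hp _
    · simp only [NNReal.coe_zero, sub_zero, sub_self]
      rw [max_eq_left (sub_nonneg.2 hxy)]
      exact le_rfl
  obtain ⟨Z, hZ0, hZ⟩ := hPL.exists_eq_forall_mem_Icc_hasDerivWithinAt
    (Metric.mem_closedBall_self le_rfl)
  refine ⟨Z, hZ0, fun p hp => (hZ p hp).continuousWithinAt, fun p hp => ?_⟩
  rw [interior_Icc] at hp
  exact (hZ p (Ioo_subset_Icc_self hp)).hasDerivAt (Icc_mem_nhds hp.1 hp.2)

end Clip

theorem exists_V_eq_zero {p : ℝ} (h : 0 < P.M p) : ∃ z, P.V p z = 0 :=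
  ⟨Real.log (P.M p) / P.c, by
    rw [V, mul_div_cancel₀ _ c_ne, Real.exp_log h, sub_self, zero_div]⟩

/-! ### Solutions where `s` is negative -/

/-- Where `s < 0` it is enough to truncate at `0`. -/
theorem clip_neg {D : Set ℝ} (hD : ∀ p ∈ D, 0 < p ∧ P.σ < p) :
    Clip P (fun _ w => max w 0) D where
  pos := fun p hp => (hD p hp).1
  mono := fun p _ => fun w w' h => max_le_max_right 0 h
  nonneg := fun p _ w => le_max_right w 0
  eq_zero := fun p _ w hw => max_eq_right hw
  denom := fun p hp w => mul_pos_of_neg_of_neg (s_neg (hD p hp).2 (hD p hp).1)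
    (by linarith [s_neg (hD p hp).2 (hD p hp).1, le_max_right w 0])

theorem le_abs_s_sub {x p w : ℝ} (hx : 0 < x) (hσ : P.σ < x) (hp : x ≤ p) :
    x * (x - P.σ) ≤ |P.s p - max w 0| := by
  have h1 := s_neg (P := P) (hσ.trans_le hp) (hx.trans_le hp)
  rw [abs_of_neg (by linarith [le_max_right w 0])]
  have h2 : x * (x - P.σ) ≤ p * (p - P.σ) :=
    mul_le_mul hp (by linarith) (by linarith) (by linarith)
  have h3 : P.s p = -(p * (p - P.σ)) := by rw [s]; ring
  linarith [le_max_right w 0]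

theorem exists_clipSol_neg {x y z₀ : ℝ} (hx : 0 < x) (hσ : P.σ < x) (hxy : x ≤ y) :
    ∃ Z, Z x = z₀ ∧ ClipSol P (fun _ w => max w 0) Z (Icc x y) := by
  have hu : Clip P (fun _ w => max w 0) (Icc x y) :=
    clip_neg fun p hp => ⟨hx.trans_le hp.1, hσ.trans_le hp.1⟩
  refine exists_clipSol (d := x * (x - P.σ)) (B := 1 / (x - P.σ)) hxy hu
    (fun p _ w w' => abs_max_sub_max_le_abs w w' 0) (by fun_prop)
    (mul_pos hx (by linarith)) (fun p hp w => le_abs_s_sub hx hσ hp.1) fun p hp w => ?_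
  have hp0 := hu.pos p hp
  have hd := hu.denom p hp w
  have hσp : 0 < p - P.σ := by linarith [hp.1]
  have hs := s_neg (P := P) (by linarith) hp0
  have hw : 0 ≤ max w 0 := le_max_right w 0
  have h1 : P.F p (max w 0) = max w 0 / (P.s p - max w 0) / (P.σ - p) := by
    rw [F, s]
    have h2 : P.σ - p ≠ 0 := by linarith
    have h3 : p * (P.σ - p) - max w 0 ≠ 0 := right_ne_zero_of_mul hd.ne'
    field_simp
  have h2 : P.F p (max w 0) = max w 0 / (max w 0 - P.s p) / (p - P.σ) := by
    rw [h1, ← neg_sub (max w 0), ← neg_sub p, div_neg, div_neg, neg_div, neg_neg]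
  rw [h2]
  refine div_le_div₀ zero_le_one ?_ (by linarith) (by linarith [hp.1])
  rw [div_le_one (by linarith)]
  linarith

/-- A truncated solution followed until it meets `m` again solves the reduced problem: it does so
no later than at the mirror image of its starting point. -/
theorem FB.of_clipSol_neg (ha : 0 < a) (hσ : P.σ ≤ a) (hQ : a < P.Q)
    (h : ClipSol P (fun _ w => max w 0) Z (Icc a (2 * P.Q - a))) (h0 : P.V a (Z a) = 0) :
    ∃ b, FB P Z a b := by
  have hu : ∀ {x y}, a ≤ x → Clip P (fun _ w => max w 0) (Ioo x y) := fun hx =>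
    clip_neg fun p hp => ⟨ha.trans (hx.trans_lt hp.1), hσ.trans_lt (hx.trans_lt hp.1)⟩
  have hpre := ClipSol.V_nonneg (hu le_rfl)
    (h.mono (Icc_subset_Icc le_rfl (by linarith : P.Q ≤ 2 * P.Q - a))) le_rfl h0.ge
  -- `m` takes the same value at the mirror image, whereas `Z` has decreased
  have hend : P.V (2 * P.Q - a) (Z (2 * P.Q - a)) ≤ 0 := by
    have h1 : P.V (2 * P.Q - a) (Z (2 * P.Q - a)) ≤ P.V (2 * P.Q - a) (Z a) :=
      V_le_V_iff.2 (ClipSol.antitoneOn (hu le_rfl) h ⟨le_rfl, by linarith⟩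
        ⟨by linarith, le_rfl⟩ (by linarith))
    have h2 := V_sub_V (P := P) (2 * P.Q - a) a (Z a)
    have h3 : P.R * ((a - (2 * P.Q - a)) * (2 * P.Q - a + a - 2 * P.Q)) = 0 := by ring
    linarith
  obtain ⟨b, hb, hb0, hbpos⟩ := exists_first_zero (by linarith : P.Q ≤ 2 * P.Q - a)
    ((continuousOn_V h.cont).mono (Icc_subset_Icc hQ.le le_rfl))
    (hpre P.Q ⟨hQ.le, le_rfl⟩) hend
  have hnn : ∀ p ∈ Icc a b, 0 ≤ P.V p (Z p) := by
    intro p hp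
    rcases le_total p P.Q with hpQ | hpQ
    · exact hpre p ⟨hp.1, hpQ⟩
    · exact hbpos p ⟨hpQ, hp.2⟩
  refine ⟨b, ⟨ha, h.cont.mono (Icc_subset_Icc le_rfl hb.2), ?_, hnn, ?_⟩, hQ.trans_le hb.1, h0, hb0,
    hb.1⟩
  · intro p hp _
    have := h.ode p (by rw [interior_Icc]; exact ⟨hp.1, hp.2.trans_le hb.2⟩)
    rwa [max_eq_left (hnn p (Ioo_subset_Icc_self hp))] at this
  · intro p hp hs
    exact absurd hs (not_lt.2 (s_neg (hσ.trans_lt hp.1) (ha.trans hp.1)).le)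

theorem exists_FB_of_σ_lt (ha : 0 < a) (hσ : P.σ < a) (hQ : a < P.Q) (hM : 0 < P.M a) :
    ∃ Z b, FB P Z a b := by
  obtain ⟨z, hz⟩ := exists_V_eq_zero hM
  obtain ⟨Z, hZ0, hZ⟩ := exists_clipSol_neg (P := P) (z₀ := z) (y := 2 * P.Q - a) ha hσ
    (by linarith)
  exact ⟨Z, FB.of_clipSol_neg ha hσ.le hQ hZ (by rw [hZ0, hz])⟩

end Params
end MertonTC

namespace MertonTC
namespace Params

variable {P : Params} {Z W : ℝ → ℝ} {a b : ℝ}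

/-! ### Starting from the singular point -/

theorem clipSol_unique {u : ℝ → ℝ → ℝ} {x y : ℝ} (hu : Clip P u (Ioo x y))
    (hZ : ClipSol P u Z (Icc x y)) (hW : ClipSol P u W (Icc x y)) (h0 : Z x = W x) :
    ∀ p ∈ Icc x y, Z p = W p := fun p hp =>
  le_antisymm (ClipSol.le_of_le hu hZ hW h0.le p hp) (ClipSol.le_of_le hu hW hZ h0.ge p hp)

/-- The equation has a solution starting at the singular point itself: the solutions started at
points decreasing to `1` form a uniform Cauchy sequence, by contraction. -/
theorem exists_clipSol_one (hσ : P.σ = 1) (hQ : 1 < P.Q) (hM : 0 < P.M 1) :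
    ∃ Z, P.V 1 (Z 1) = 0 ∧ ClipSol P (fun _ w => max w 0) Z (Icc 1 (2 * P.Q - 1)) := by
  set E := 2 * P.Q with hE
  have hQE : P.Q < E := by linarith
  set z₁ := Real.log (P.M 1) / P.c with hz₁
  have hζ : ∀ {p}, 0 < P.M p → P.V p (Real.log (P.M p) / P.c) = 0 := by
    intro p hp
    rw [V, mul_div_cancel₀ _ c_ne, Real.exp_log hp, sub_self, zero_div]
  obtain ⟨η, hη, hη1⟩ : ∃ η, 0 < η ∧ ∀ p ∈ Icc 1 (1 + η), 0 < P.M p ∧ p < P.Q := by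
    have h1 : ∀ᶠ p in 𝓝 (1 : ℝ), 0 < P.M p ∧ p < P.Q :=
      ((continuous_M (P := P)).continuousAt.eventually (lt_mem_nhds hM)).and (gt_mem_nhds hQ)
    obtain ⟨ε, hε, hsub⟩ := Metric.eventually_nhds_iff.1 h1
    refine ⟨ε / 2, half_pos hε, fun p hp => hsub ?_⟩
    rw [Real.dist_eq, abs_of_nonneg (by linarith [hp.1])]
    linarith [hp.2]
  -- starting points `α n ↓ 1`, all below `Q` and with `m > 0`
  set α : ℕ → ℝ := fun n => 1 + η / (n + 1) with hα
  have hα1 : ∀ n, 1 < α n := fun n => by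
    have : 0 < η / ((n : ℝ) + 1) := by positivity
    simp only [hα]; linarith
  have hαη : ∀ n, α n ∈ Icc 1 (1 + η) := fun n => ⟨(hα1 n).le, by
    simp only [hα]
    have : η / ((n : ℝ) + 1) ≤ η := div_le_self hη.le (by linarith [Nat.cast_nonneg (α := ℝ) n])
    linarith⟩
  have hαmono : ∀ {n m}, n ≤ m → α m ≤ α n := by
    intro n m hnm
    simp only [hα]
    have : (n : ℝ) ≤ m := by exact_mod_cast hnm
    gcongr
  have hαlim : Tendsto α atTop (𝓝 1) := by
    have := (tendsto_const_div_atTop_nhds_zero_nat η).comp (tendsto_add_atTop_nat 1)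
    have h2 := this.const_add 1
    simpa [hα, Function.comp_def] using h2
  have hex : ∀ n, ∃ Z, Z (α n) = Real.log (P.M (α n)) / P.c ∧
      ClipSol P (fun _ w => max w 0) Z (Icc (α n) E) := fun n =>
    exists_clipSol_neg (by linarith [hα1 n]) (by rw [hσ]; exact hα1 n)
      (by linarith [(hη1 _ (hαη n)).2])
  choose Zs hZs0 hZs using hex
  have hu : ∀ {x y : ℝ}, 1 ≤ x → Clip P (fun _ w => max w 0) (Ioo x y) := fun hx =>
    clip_neg fun p hp => ⟨by linarith [hp.1], by rw [hσ]; linarith [hp.1]⟩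
  set ζ : ℕ → ℝ := fun n => Real.log (P.M (α n)) / P.c with hζdef
  replace hZs0 : ∀ n, Zs n (α n) = ζ n := hZs0
  have hζn : ∀ n, P.V (α n) (ζ n) = 0 := fun n => hζ (hη1 _ (hαη n)).1
  have hζz : ∀ n, ζ n ≤ z₁ := by
    intro n
    rw [← V_le_V_iff (P := P) (p := 1), hζ hM]
    have h1 := V_sub_V (P := P) 1 (α n) (ζ n)
    have h3 := (hη1 _ (hαη n)).2
    rw [hζn] at h1
    nlinarith [mul_pos P.R_pos (mul_pos (sub_pos.2 (hα1 n))
      (by linarith : 0 < 2 * P.Q - 1 - α n))]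
  -- At `α n` a solution started later in the sequence lies between the starting values `ζ n` and
  -- `z₁` at `α n` and `1`.
  have hbound : ∀ {n m}, n ≤ m → ζ n ≤ Zs m (α n) ∧ Zs m (α n) ≤ z₁ := by
    intro n m hnm
    have hnQ := (hη1 _ (hαη n)).2
    have hmem : α n ∈ Icc (α m) P.Q := ⟨hαmono hnm, hnQ.le⟩
    constructor
    · rw [← V_le_V_iff (P := P) (p := α n), hζn]
      refine ClipSol.V_nonneg (hu (hα1 m).le)
        ((hZs m).mono (Icc_subset_Icc le_rfl hQE.le)) le_rfl ?_ _ hmem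
      rw [hZs0, hζn]
    · refine le_trans ?_ (hζz m)
      rw [← hZs0 m]
      exact ClipSol.antitoneOn (hu (hα1 m).le) (hZs m) ⟨le_rfl, hmem.1.trans (hnQ.trans hQE).le⟩
        ⟨hmem.1, (hnQ.trans hQE).le⟩ hmem.1
  -- extension of the `n`-th solution to the left of its starting point by the constant `z₁`
  set Y : ℕ → ℝ → ℝ := fun n p => if α n ≤ p then Zs n p else z₁ with hY
  have hYdist : ∀ {n m}, n ≤ m → ∀ p ∈ Icc 1 E, |Y n p - Y m p| ≤ z₁ - ζ n := by
    intro n m hnm p hp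
    have hb := hbound hnm
    have hE' := (hη1 _ (hαη n)).2.trans hQE
    rcases le_or_gt (α n) p with h1 | h1
    · have h2 := (hαmono hnm).trans h1
      simp only [hY, if_pos h1, if_pos h2]
      have hW := (hZs m).mono (Icc_subset_Icc (hαmono hnm) le_rfl)
      have h0 : Zs n (α n) ≤ Zs m (α n) := by rw [hZs0]; exact hb.1
      have h3 := ClipSol.le_of_le (hu (hα1 n).le) (hZs n) hW h0 p ⟨h1, hp.2⟩
      have h4 := ClipSol.sub_le_sub (hu (hα1 n).le) (hZs n) hW h0 p ⟨h1, hp.2⟩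
      rw [hZs0] at h4
      rw [abs_sub_comm, abs_of_nonneg (by linarith)]
      linarith [hb.2]
    · rcases le_or_gt (α m) p with h2 | h2
      · simp only [hY, if_neg (not_le.2 h1), if_pos h2]
        have hanti := ClipSol.antitoneOn (hu (hα1 m).le) (hZs m)
        have h3 : Zs m (α n) ≤ Zs m p :=
          hanti ⟨h2, hp.2⟩ ⟨hαmono hnm, hE'.le⟩ h1.le
        have h4 : Zs m p ≤ ζ m := by
          have := hanti ⟨le_rfl, h2.trans hp.2⟩ ⟨h2, hp.2⟩ h2
          rwa [hZs0] at this
        have h5 := hζz m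
        rw [abs_of_nonneg (by linarith)]
        linarith [hb.1]
      · simp only [hY, if_neg (not_le.2 h1), if_neg (not_le.2 h2), sub_self, abs_zero]
        linarith [hζz n]
  have hlim0 : Tendsto (fun n => z₁ - ζ n) atTop (𝓝 0) := by
    have h1 : ContinuousAt (fun p => Real.log (P.M p) / P.c) 1 :=
      (continuous_M.continuousAt.log hM.ne').div_const _
    have := (h1.tendsto.comp hαlim).const_sub z₁
    simpa [hz₁] using this
  have hex : ∀ p ∈ Icc 1 E, ∃ l, Tendsto (fun n => Y n p) atTop (𝓝 l) := by
    intro p hp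
    refine cauchySeq_tendsto_of_complete (cauchySeq_of_le_tendsto_0' (fun n => z₁ - ζ n) ?_ hlim0)
    intro n m hnm
    rw [Real.dist_eq]; exact hYdist hnm p hp
  choose! Z hZ using hex
  have hZdist : ∀ n, ∀ p ∈ Icc 1 E, |Y n p - Z p| ≤ z₁ - ζ n := by
    intro n p hp
    refine le_of_tendsto ((tendsto_const_nhds.sub (hZ p hp)).abs) ?_
    filter_upwards [eventually_ge_atTop n] with m hm
    exact hYdist hm p hp
  have h1E : (1 : ℝ) ∈ Icc 1 E := ⟨le_rfl, by linarith⟩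
  have hZ1 : Z 1 = z₁ := by
    refine tendsto_nhds_unique (hZ 1 h1E) ?_
    have : (fun n => Y n 1) = fun _ => z₁ := by
      funext n; simp only [hY, if_neg (not_le.2 (hα1 n))]
    rw [this]; exact tendsto_const_nhds
  obtain ⟨r, hr⟩ : ∃ r, ∀ n, ∀ p ∈ Icc 1 E, |Y n p| ≤ r ∧ |Z p| ≤ r := by
    obtain ⟨r₀, hr₀⟩ := isCompact_Icc.exists_bound_of_continuousOn (hZs 0).cont
    have h0 : ∀ p ∈ Icc 1 E, |Y 0 p| ≤ max r₀ |z₁| := by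
      intro p hp
      rcases le_or_gt (α 0) p with h1 | h1
      · simp only [hY, if_pos h1]; exact (hr₀ p ⟨h1, hp.2⟩).trans (le_max_left _ _)
      · simp only [hY, if_neg (not_le.2 h1)]; exact le_max_right _ _
    refine ⟨max r₀ |z₁| + (z₁ - ζ 0), fun n p hp => ⟨?_, ?_⟩⟩
    · have h1 := hYdist (Nat.zero_le n) p hp
      have h2 := abs_add_le (Y n p - Y 0 p) (Y 0 p)
      rw [sub_add_cancel, abs_sub_comm] at h2
      linarith [h0 p hp]
    · have h1 := hZdist 0 p hp
      have h2 := abs_add_le (Z p - Y 0 p) (Y 0 p)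
      rw [sub_add_cancel, abs_sub_comm] at h2
      linarith [h0 p hp]
  -- The right-hand sides converge uniformly away from `1`, so the limit solves the equation.
  have hder : ∀ p ∈ Ioo 1 E, HasDerivAt Z (-P.F p (max (P.V p (Z p)) 0)) p := by
    intro p hp
    obtain ⟨x, hx1, hxp⟩ := exists_between hp.1
    have hsub : ∀ t ∈ Ioo x E, t ∈ Icc 1 E := fun t ht => ⟨(hx1.trans ht.1).le, ht.2.le⟩
    refine hasDerivAt_of_tendstoUniformlyOn (f := Y) (g' := fun t => -P.F t (max (P.V t (Z t)) 0))
      (f' := fun n t => -P.F t (max (P.V t (Y n t)) 0)) (l := atTop)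
      isOpen_Ioo ?_ ?_ (fun t ht => hZ t (hsub t ht)) ⟨hxp, hp.2⟩
    · set K := E / ((x * (x - 1)) * (x * (x - 1))) *
        (Real.exp (|P.c| * r) * |P.c| / |P.κ|) with hK
      have hK0 : Tendsto (fun n => K * (z₁ - ζ n)) atTop (𝓝 0) := by
        simpa using hlim0.const_mul K
      rw [Metric.tendstoUniformlyOn_iff]
      intro ε hε
      filter_upwards [hK0.eventually (gt_mem_nhds hε)] with n hn t ht
      have hux : Clip P (fun _ w => max w 0) (Ioo x E) := hu hx1.le
      have hd : 0 < x * (x - 1) := mul_pos (by linarith) (by linarith)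
      rw [Real.dist_eq, neg_sub_neg]
      have h1 := abs_F_sub_F_le hux (fun p _ w w' => abs_max_sub_max_le_abs w w' 0) (T := E)
        (r := r) hd (fun p hp => ⟨hp.2.le, fun w => by
          have := le_abs_s_sub (P := P) (x := x) (p := p) (w := w) (by linarith)
            (by rw [hσ]; exact hx1) hp.1.le
          rwa [hσ] at this⟩) ht
        (hr n t (hsub t ht)).1 (hr n t (hsub t ht)).2
      have h2 := hZdist n t (hsub t ht)
      have hE0 : 0 < E := by linarith
      have hK1 : 0 ≤ K := by positivity
      exact (h1.trans (mul_le_mul_of_nonneg_left h2 hK1)).trans_lt hn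
    · filter_upwards [hαlim.eventually (gt_mem_nhds hx1)] with n hn t ht
      have heq : Y n =ᶠ[𝓝 t] Zs n := by
        filter_upwards [lt_mem_nhds (hn.trans ht.1)] with y hy
        simp only [hY, if_pos hy.le]
      have h1 : Y n t = Zs n t := heq.eq_of_nhds
      rw [h1]
      exact ((hZs n).ode t
        (by rw [interior_Icc]; exact ⟨hn.trans ht.1, ht.2⟩)).congr_of_eventuallyEq heq
  refine ⟨Z, by rw [hZ1]; exact hζ hM, ?_, ?_⟩
  · intro p hp
    rcases eq_or_lt_of_le hp.1 with rfl | h1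
    · rw [Metric.continuousWithinAt_iff]
      intro ε hε
      obtain ⟨n, hn⟩ := (hlim0.eventually (gt_mem_nhds hε)).exists
      refine ⟨α n - 1, by linarith [hα1 n], fun y hy hdist => ?_⟩
      rw [Real.dist_eq, abs_of_nonneg (by linarith [hy.1])] at hdist
      have h2 := hZdist n y ⟨hy.1, by linarith [hy.2]⟩
      simp only [hY, if_neg (not_le.2 (by linarith : y < α n))] at h2
      rw [Real.dist_eq, hZ1, abs_sub_comm]
      linarith
    · exact (hder p ⟨h1, by linarith [hp.2]⟩).continuousAt.continuousWithinAt
  · intro p hp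
    rw [interior_Icc] at hp
    exact hder p ⟨hp.1, by linarith [hp.2]⟩

theorem exists_FB_one (hσ : P.σ = 1) (hQ : 1 < P.Q) (hM : 0 < P.M 1) : ∃ Z b, FB P Z 1 b := by
  obtain ⟨Z, hZ0, hZ⟩ := exists_clipSol_one hσ hQ hM
  exact ⟨Z, FB.of_clipSol_neg one_pos hσ.le hQ hZ hZ0⟩

/-! ### Starting below the singular point -/

/-- Where `s > 0` the truncation to `[0, θ s]` with `θ < 1` keeps the equation regular. -/
theorem clip_pos {θ : ℝ} (hσ : P.σ = 1) (h0 : 0 ≤ θ) (h1 : θ < 1) {D : Set ℝ}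
    (hD : ∀ p ∈ D, 0 < p ∧ p < 1) : Clip P (fun p w => min (max w 0) (θ * P.s p)) D := by
  have hs : ∀ p ∈ D, 0 < P.s p := fun p hp => (s_pos_iff (hD p hp).1).2 ⟨hσ, (hD p hp).2⟩
  have hnn : ∀ p ∈ D, 0 ≤ θ * P.s p := fun p hp => mul_nonneg h0 (hs p hp).le
  exact {
    pos := fun p hp => (hD p hp).1
    mono := fun p _ => fun w w' h => min_le_min_right _ (max_le_max_right 0 h)
    nonneg := fun p hp w => le_min (le_max_right w 0) (hnn p hp)
    eq_zero := fun p hp w hw => by rw [max_eq_right hw, min_eq_left (hnn p hp)]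
    denom := fun p hp w => mul_pos (hs p hp) (by
      have := min_le_right (max w 0) (θ * P.s p)
      nlinarith [hs p hp]) }

theorem exists_clipSol_pos {θ x y z₀ : ℝ} (hσ : P.σ = 1) (h0 : 0 ≤ θ) (h1 : θ < 1) (hx : 0 < x)
    (hxy : x ≤ y) (hy : y < 1) :
    ∃ Z, Z x = z₀ ∧ ClipSol P (fun p w => min (max w 0) (θ * P.s p)) Z (Icc x y) := by
  have hu : Clip P (fun p w => min (max w 0) (θ * P.s p)) (Icc x y) :=
    clip_pos hσ h0 h1 fun p hp => ⟨hx.trans_le hp.1, hp.2.trans_lt hy⟩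
  have hs : ∀ p ∈ Icc x y, x * (1 - y) ≤ P.s p := fun p hp => by
    rw [s, hσ]
    exact mul_le_mul hp.1 (by linarith [hp.2]) (by linarith) (hx.le.trans hp.1)
  have hxy0 : 0 < x * (1 - y) := mul_pos hx (by linarith)
  refine exists_clipSol (d := (1 - θ) * (x * (1 - y))) (B := 1 / ((1 - θ) * (1 - y))) hxy hu
    (fun p _ w w' => ?_) ?_ (mul_pos (by linarith) hxy0) (fun p hp w => ?_) (fun p hp w => ?_)
  · refine (abs_min_sub_min_le_max _ _ _ _).trans ?_
    rw [sub_self, abs_zero, max_eq_left (abs_nonneg _)]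
    exact abs_max_sub_max_le_abs w w' 0
  · have := continuous_s (P := P)
    unfold Function.uncurry
    fun_prop
  · have h2 := min_le_right (max w 0) (θ * P.s p)
    have h3 := hs p hp
    refine le_trans ?_ (le_abs_self _)
    nlinarith
  · have h2 := min_le_right (max w 0) (θ * P.s p)
    have h3 := hu.nonneg p hp w
    set v := min (max w 0) (θ * P.s p) with hv
    have h4 := hs p hp
    have h5 : 0 < P.s p := hxy0.trans_le h4
    have hp1 : 0 < 1 - p := by linarith [hp.2]
    have hp0 := hu.pos p hp
    have hsp : P.s p = p * (1 - p) := by rw [s, hσ]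
    have h6 : P.F p v = v / (P.s p - v) / (1 - p) := by
      have h7 : P.s p - v ≠ 0 := right_ne_zero_of_mul (hu.denom p hp w).ne'
      rw [F]
      rw [hsp] at h7 ⊢
      field_simp
    rw [h6, ← div_div]
    have hden : 0 < P.s p - v := by nlinarith
    refine div_le_div₀ (by apply div_nonneg <;> linarith) ?_ (by linarith) (by linarith [hp.2])
    rw [div_le_div_iff₀ hden (by linarith)]
    nlinarith

/-- Truncated solutions on all intervals `[a, T]`, `T < 1`, fit together. -/
theorem exists_clipSol_Ico {θ z₀ : ℝ} (hσ : P.σ = 1) (h0 : 0 ≤ θ) (h1 : θ < 1) (ha : 0 < a)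
    (ha1 : a < 1) : ∃ Z, Z a = z₀ ∧ ∀ T ∈ Ioo a 1,
      ClipSol P (fun p w => min (max w 0) (θ * P.s p)) Z (Icc a T) := by
  have hex : ∀ T ∈ Ioo a 1, ∃ Z, Z a = z₀ ∧
      ClipSol P (fun p w => min (max w 0) (θ * P.s p)) Z (Icc a T) := fun T hT =>
    exists_clipSol_pos hσ h0 h1 ha hT.1.le hT.2
  choose! Zs hZs0 hZs using hex
  have hmid : ∀ p ∈ Ico a 1, (1 + p) / 2 ∈ Ioo a 1 := fun p hp =>
    ⟨by linarith [hp.1], by linarith [hp.2]⟩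
  have heq : ∀ T ∈ Ioo a 1, ∀ p ∈ Icc a T, Zs ((1 + p) / 2) p = Zs T p := by
    intro T hT p hp
    have hp1 : p ∈ Ico a 1 := ⟨hp.1, hp.2.trans_lt hT.2⟩
    have hm := hmid p hp1
    have hle : p ≤ min ((1 + p) / 2) T := le_min (by linarith [hp1.2]) hp.2
    refine clipSol_unique (x := a) (y := min ((1 + p) / 2) T)
      (clip_pos hσ h0 h1 fun t ht => ⟨ha.trans ht.1, ?_⟩)
      ((hZs _ hm).mono (Icc_subset_Icc le_rfl (min_le_left _ _)))
      ((hZs _ hT).mono (Icc_subset_Icc le_rfl (min_le_right _ _)))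
      (by rw [hZs0 _ hm, hZs0 _ hT]) p ⟨hp.1, hle⟩
    exact (ht.2.trans_le (min_le_right _ _)).trans hT.2
  refine ⟨fun p => Zs ((1 + p) / 2) p, hZs0 _ (hmid a ⟨le_rfl, ha1⟩), fun T hT => ⟨?_, ?_⟩⟩
  · exact (hZs T hT).cont.congr fun p hp => heq T hT p hp
  · intro p hp
    have hev : (fun p => Zs ((1 + p) / 2) p) =ᶠ[𝓝 p] Zs T := by
      filter_upwards [mem_interior_iff_mem_nhds.1 hp] with t ht
      exact heq T hT t ht
    have h2 := (hZs T hT).ode p hp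
    rw [← hev.eq_of_nhds] at h2
    exact h2.congr_of_eventuallyEq hev

/-- The quadratic `ℓ` lies above its chord over `[0, 1]`. -/
theorem chord_le_ell {p : ℝ} (hσ : P.σ = 1) (hp : p ∈ Icc 0 1) :
    (1 - p) + p * P.M 1 ≤ P.M p + P.κ * P.s p := by
  have h : P.M p + P.κ * P.s p - ((1 - p) + p * P.M 1) = P.κ * (1 - P.R) * (p * (1 - p)) := by
    rw [M, M, s, hσ]; ring
  have := mul_nonneg P.κ_mul_pos.le (mul_nonneg hp.1 (sub_nonneg.2 hp.2))
  linarith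

/-- Close to the graph of `ℓ` the solution `n = exp (c Z)` is bounded away from `0`. -/
theorem exists_exp_lower_bound {z₀ : ℝ} (hσ : P.σ = 1) (hM : P.κ < 0 ∨ 0 < P.M 1) :
    ∃ c₀ > 0, ∃ θ₀ < 1, ∀ θ, θ₀ ≤ θ → θ < 1 → ∀ p ∈ Ioo (0 : ℝ) 1, ∀ z ≤ z₀,
      θ * P.s p ≤ P.V p z → c₀ ≤ Real.exp (P.c * z) := by
  rcases P.sign_cases with ⟨hκ, hc⟩ | ⟨hκ, hc⟩
  · have hM1 : 0 < P.M 1 := hM.resolve_left (not_lt.2 hκ.le)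
    set l := min 1 (P.M 1) with hl
    have hl0 : 0 < l := lt_min one_pos hM1
    refine ⟨l / 2, half_pos hl0, 1 - l / (2 * P.κ), by
      have : 0 < l / (2 * P.κ) := by positivity
      linarith, fun θ hθ hθ1 p hp z _ hV => ?_⟩
    have h1 := chord_le_ell hσ (Ioo_subset_Icc_self hp)
    have h2 : l ≤ (1 - p) + p * P.M 1 := by
      have := min_le_left 1 (P.M 1)
      have := min_le_right 1 (P.M 1)
      nlinarith [hp.1, hp.2]
    have hs : 0 < P.s p := (s_pos_iff hp.1).2 ⟨hσ, hp.2⟩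
    have hs1 : P.s p ≤ 1 := by rw [s, hσ]; nlinarith [hp.1, hp.2]
    have h3 : P.κ * (1 - θ) ≤ l / 2 := by
      have : 1 - θ ≤ l / (2 * P.κ) := by linarith
      have := mul_le_mul_of_nonneg_left this hκ.le
      have e : P.κ * (l / (2 * P.κ)) = l / 2 := by field_simp
      linarith
    have h4 := mul_le_mul_of_nonneg_left hV hκ.le
    have h5 : P.κ * (1 - θ) * P.s p ≤ l / 2 := by
      have := mul_nonneg hκ.le (sub_nonneg.2 hθ1.le)
      nlinarith
    rw [exp_eq p]
    nlinarith
  · refine ⟨Real.exp (P.c * z₀), Real.exp_pos _, 0, one_pos, fun θ _ _ p _ z hz _ => ?_⟩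
    exact Real.exp_le_exp.2 (mul_le_mul_of_nonpos_left hz hc.le)

/-- For `θ` close to `1` the truncation is never active. -/
theorem exists_untruncated {z₀ : ℝ} (hσ : P.σ = 1) (ha : 0 < a) (ha1 : a < 1)
    (h0 : P.V a z₀ = 0) (hM : P.κ < 0 ∨ 0 < P.M 1) :
    ∃ θ Z, 0 ≤ θ ∧ θ < 1 ∧ Z a = z₀ ∧
      (∀ T ∈ Ioo a 1, ClipSol P (fun p w => min (max w 0) (θ * P.s p)) Z (Icc a T)) ∧
      ∀ p ∈ Ico a 1, P.V p (Z p) ≤ θ * P.s p := by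
  obtain ⟨c₀, hc₀, θ₀, hθ₀, hlow⟩ := exists_exp_lower_bound (z₀ := z₀) hσ hM
  have hRQ := mul_pos P.R_pos P.Q_pos
  set N := 2 * P.R * P.Q + 1 with hN
  have hN0 : 0 < N := by linarith
  have hβ := β_pos (P := P)
  obtain ⟨θ, hθ₀', hθ2, hθ3, hθ1⟩ : ∃ θ, θ₀ ≤ θ ∧ 1 / 2 ≤ θ ∧
      N * (1 - θ) ≤ P.β * c₀ * (1 / 2) ∧ θ < 1 := by
    refine ⟨max (max θ₀ (1 / 2)) (1 - P.β * c₀ / (2 * N)),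
      (le_max_left _ _).trans (le_max_left _ _), (le_max_right _ _).trans (le_max_left _ _), ?_,
      max_lt (max_lt hθ₀ (by norm_num)) ?_⟩
    · have h1 := le_max_right (max θ₀ (1 / 2)) (1 - P.β * c₀ / (2 * N))
      have h2 := mul_le_mul_of_nonneg_left h1 hN0.le
      have e : N * (1 - P.β * c₀ / (2 * N)) = N - P.β * c₀ * (1 / 2) := by field_simp
      linarith
    · have : 0 < P.β * c₀ / (2 * N) := by positivity
      linarith
  have hθ0 : 0 ≤ θ := by linarith
  obtain ⟨Z, hZ0, hZ⟩ := exists_clipSol_Ico (P := P) (z₀ := z₀) hσ hθ0 hθ1 ha ha1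
  refine ⟨θ, Z, hθ0, hθ1, hZ0, hZ, fun p hp => ?_⟩
  obtain ⟨T, hpT, hT1⟩ := exists_between hp.2
  have hT : T ∈ Ioo a 1 := ⟨hp.1.trans_lt hpT, hT1⟩
  have hu : Clip P (fun p w => min (max w 0) (θ * P.s p)) (Ioo a T) :=
    clip_pos hσ hθ0 hθ1 fun t ht => ⟨ha.trans ht.1, ht.2.trans hT1⟩
  have hanti := ClipSol.antitoneOn hu (hZ T hT)
  have hsa : 0 < P.s a := (s_pos_iff ha).2 ⟨hσ, ha1⟩
  -- Where `V > θ s`, the truncated slope is `θ / ((1 - θ) (1 - p))`, and with `n ≥ c₀` the choice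
  -- of `θ` makes it dominate the derivative of `m` and `θ s`.
  have := nonpos_of_barrier (φ := fun t => P.V t (Z t) - θ * P.s t)
    ((continuousOn_V (hZ T hT).cont).sub (continuousOn_const.mul continuous_s.continuousOn))
    (by rw [hZ0, h0]; nlinarith)
    (fun t ht _ => (hasDerivAt_V (P := P) ((hZ T hT).ode t (by rwa [interior_Icc]))).sub
      ((hasDerivAt_s t).const_mul θ))
    (fun t ht hpos => by
      have ht0 := ha.trans ht.1
      have ht1 := ht.2.trans hT1
      have hs : 0 < P.s t := (s_pos_iff ht0).2 ⟨hσ, ht1⟩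
      have hVt : θ * P.s t ≤ P.V t (Z t) := by linarith
      have hzt : Z t ≤ z₀ := by
        rw [← hZ0]; exact hanti ⟨le_rfl, hT.1.le⟩ (Ioo_subset_Icc_self ht) ht.1.le
      have hn := hlow θ hθ₀' hθ1 t ⟨ht0, ht1⟩ (Z t) hzt hVt
      have hmax : max (P.V t (Z t)) 0 = P.V t (Z t) :=
        max_eq_left ((mul_nonneg hθ0 hs.le).trans hVt)
      have hF : P.F t (θ * P.s t) = θ / (1 - θ) / (1 - t) := by
        have h1 : P.s t = t * (1 - t) := by rw [s, hσ]
        have h2 : 1 - t ≠ 0 := by linarith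
        have h3 : 1 - θ ≠ 0 := by linarith
        have h4 : t * (1 - t) - θ * (t * (1 - t)) ≠ 0 := by
          rw [← one_sub_mul]; exact mul_ne_zero h3 (mul_ne_zero ht0.ne' h2)
        rw [F, h1]; field_simp
      rw [hmax, min_eq_right hVt, hF, hσ]
      have h5 : N ≤ P.β * c₀ * (θ / (1 - θ)) := by
        rw [← mul_div_assoc, le_div_iff₀ (by linarith)]
        have := mul_pos hβ hc₀
        nlinarith
      have h6 : θ / (1 - θ) ≤ θ / (1 - θ) / (1 - t) :=
        le_div_self (div_nonneg hθ0 (by linarith)) (by linarith) (by linarith)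
      have h7 : P.β * c₀ * (θ / (1 - θ)) ≤
          P.β * Real.exp (P.c * Z t) * (θ / (1 - θ) / (1 - t)) := by
        have h8 : 0 ≤ θ / (1 - θ) := div_nonneg hθ0 (by linarith)
        exact mul_le_mul (mul_le_mul_of_nonneg_left hn hβ.le) h6 h8
          (mul_pos hβ (Real.exp_pos _)).le
      have h9 : 0 ≤ P.R * t := (mul_pos P.R_pos ht0).le
      nlinarith) p ⟨hp.1, hpT.le⟩
  linarith

/-- A solution started below the singular point either returns to `m` before it or runs into it. -/
theorem exists_FB_or_orbit_one (hσ : P.σ = 1) (ha : 0 < a) (ha1 : a < 1) (haQ : a < P.Q)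
    (hMa : 0 < P.M a) (hM : P.κ < 0 ∨ 0 < P.M 1) :
    (∃ Z b, FB P Z a b) ∨ ∃ Z, Orbit P Z a 1 ∧ P.V a (Z a) = 0 := by
  obtain ⟨z₀, hz₀⟩ := exists_V_eq_zero hMa
  obtain ⟨θ, Z, hθ0, hθ1, hZ0, hZ, hle⟩ := exists_untruncated hσ ha ha1 hz₀ hM
  have hu : ∀ T ∈ Ioo a 1, Clip P (fun p w => min (max w 0) (θ * P.s p)) (Ioo a T) := fun T hT =>
    clip_pos hσ hθ0 hθ1 fun t ht => ⟨ha.trans ht.1, ht.2.trans hT.2⟩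
  have hs : ∀ p ∈ Ico a 1, 0 < P.s p := fun p hp =>
    (s_pos_iff (ha.trans_le hp.1)).2 ⟨hσ, hp.2⟩
  have hlt : ∀ p ∈ Ico a 1, P.V p (Z p) < P.s p := fun p hp =>
    (hle p hp).trans_lt (by nlinarith [hs p hp])
  have hpre : ∀ p ∈ Ico a 1, p ≤ P.Q → 0 ≤ P.V p (Z p) := by
    intro p hp hpQ
    rcases eq_or_lt_of_le hp.1 with rfl | hap
    · rw [hZ0, hz₀]
    · exact ClipSol.V_nonneg (hu p ⟨hap, hp.2⟩) (hZ p ⟨hap, hp.2⟩) hpQ (by rw [hZ0, hz₀]) p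
        ⟨hap.le, le_rfl⟩
  have hode : ∀ p ∈ Ioo a 1, 0 ≤ P.V p (Z p) → HasDerivAt Z (-(p * P.G p (Z p))) p := by
    intro p hp hV
    obtain ⟨T, hpT, hT1⟩ := exists_between hp.2
    have h1 := (hZ T ⟨hp.1.trans hpT, hT1⟩).ode p (by rw [interior_Icc]; exact ⟨hp.1, hpT⟩)
    rwa [max_eq_left hV, min_eq_left (hle p ⟨hp.1.le, hp.2⟩)] at h1
  by_cases hex : ∃ y ∈ Ioo a 1, P.Q ≤ y ∧ P.V y (Z y) ≤ 0
  · left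
    obtain ⟨y, hy, hQy, hVy⟩ := hex
    obtain ⟨b, hb, hb0, hbpos⟩ := exists_first_zero hQy
      ((continuousOn_V (hZ y hy).cont).mono (Icc_subset_Icc haQ.le le_rfl))
      (hpre P.Q ⟨haQ.le, hQy.trans_lt hy.2⟩ le_rfl) hVy
    have hb1 : b < 1 := hb.2.trans_lt hy.2
    have hnn : ∀ p ∈ Icc a b, 0 ≤ P.V p (Z p) := by
      intro p hp
      rcases le_total p P.Q with hpQ | hpQ
      · exact hpre p ⟨hp.1, hp.2.trans_lt hb1⟩ hpQ
      · exact hbpos p ⟨hpQ, hp.2⟩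
    exact ⟨Z, b, ⟨ha, (hZ y hy).cont.mono (Icc_subset_Icc le_rfl hb.2),
      fun p hp _ => hode p ⟨hp.1, hp.2.trans hb1⟩ (hnn p (Ioo_subset_Icc_self hp)), hnn,
      fun p hp _ => hlt p ⟨hp.1.le, hp.2.trans hb1⟩⟩, haQ.trans_le hb.1, by rw [hZ0, hz₀], hb0,
      hb.1⟩
  · right
    push Not at hex
    have hnn : ∀ p ∈ Ico a 1, 0 ≤ P.V p (Z p) := by
      intro p hp
      rcases le_total p P.Q with hpQ | hpQ
      · exact hpre p hp hpQ
      · exact (hex p ⟨haQ.trans_le hpQ, hp.2⟩ hpQ).le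
    have hs1 : P.s 1 = 0 := by simp [s, hσ]
    -- `V` is squeezed to `0`, so `n` tends to `m 1`.
    have hVlim : Tendsto (fun p => P.V p (Z p)) (𝓝[<] 1) (𝓝 0) := by
      have h2 : Tendsto P.s (𝓝[<] 1) (𝓝 0) := by
        rw [← hs1]; exact continuous_s.continuousAt.mono_left nhdsWithin_le_nhds
      refine tendsto_of_tendsto_of_tendsto_of_le_of_le' tendsto_const_nhds h2 ?_ ?_
      · filter_upwards [Ioo_mem_nhdsLT ha1] with p hp using hnn p ⟨hp.1.le, hp.2⟩
      · filter_upwards [Ioo_mem_nhdsLT ha1] with p hp using (hlt p ⟨hp.1.le, hp.2⟩).le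
    have hexp : Tendsto (fun p => Real.exp (P.c * Z p)) (𝓝[<] 1) (𝓝 (P.M 1)) := by
      have h1 : Tendsto P.M (𝓝[<] 1) (𝓝 (P.M 1)) :=
        continuous_M.continuousAt.mono_left nhdsWithin_le_nhds
      have h2 := h1.add (hVlim.const_mul P.κ)
      rw [mul_zero, add_zero] at h2
      exact h2.congr fun p => (exp_eq p (Z p)).symm
    have hM1 : 0 < P.M 1 := by
      rcases P.sign_cases with ⟨hκ, _⟩ | ⟨_, hc⟩
      · exact hM.resolve_left (not_lt.2 hκ.le)
      · refine (Real.exp_pos (P.c * z₀)).trans_le (ge_of_tendsto hexp ?_)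
        filter_upwards [Ioo_mem_nhdsLT ha1] with p hp
        have hZp : Z p ≤ z₀ := by
          rw [← hZ0]
          exact ClipSol.antitoneOn (hu p hp) (hZ p hp) ⟨le_rfl, hp.1.le⟩ ⟨hp.1.le, le_rfl⟩ hp.1.le
        exact Real.exp_le_exp.2 (mul_le_mul_of_nonpos_left hZp hc.le)
    -- `Z` gets the limit `z₁` as its value at `1`, since the truncated equation only determines
    -- it on `[a, 1)`.
    obtain ⟨z₁, hz₁⟩ := exists_V_eq_zero hM1
    have hZlim : Tendsto Z (𝓝[<] 1) (𝓝 z₁) := by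
      have h1 := (hexp.log hM1.ne').div_const P.c
      have e1 : Real.log (P.M 1) / P.c = z₁ := by
        have := exp_eq (P := P) 1 z₁
        rw [hz₁, mul_zero, add_zero] at this
        rw [← this, Real.log_exp, mul_div_cancel_left₀ _ c_ne]
      rw [e1] at h1
      refine h1.congr fun p => ?_
      rw [Real.log_exp, mul_div_cancel_left₀ _ c_ne]
    have heq : ∀ p, p ≠ 1 → Function.update Z 1 z₁ p = Z p := fun p hp =>
      Function.update_of_ne hp _ _
    have heqV : ∀ p, p ≠ 1 → P.V p (Function.update Z 1 z₁ p) = P.V p (Z p) := fun p hp => by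
      rw [heq p hp]
    have hev : ∀ p, p ≠ 1 → Function.update Z 1 z₁ =ᶠ[𝓝 p] Z := fun p hp => by
      filter_upwards [isOpen_ne.mem_nhds hp] with t ht using heq t ht
    refine ⟨Function.update Z 1 z₁, ⟨ha, ?_, ?_, ?_, ?_⟩, ?_⟩
    · intro p hp
      rcases eq_or_lt_of_le hp.2 with rfl | hp1
      · rw [continuousWithinAt_update_same]
        exact hZlim.mono_left (nhdsWithin_mono _ fun t ht => lt_of_le_of_ne ht.1.2 ht.2)
      · obtain ⟨T, hpT, hT1⟩ := exists_between hp1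
        have h1 := (hZ T ⟨hp.1.trans_lt hpT, hT1⟩).cont p ⟨hp.1, hpT.le⟩
        have h2 : ContinuousWithinAt Z (Icc a 1) p := by
          refine h1.mono_of_mem_nhdsWithin ?_
          filter_upwards [self_mem_nhdsWithin, mem_nhdsWithin_of_mem_nhds (gt_mem_nhds hpT)]
            with t ht htT using ⟨ht.1, le_of_lt htT⟩
        exact h2.congr_of_eventuallyEq ((hev p hp1.ne).filter_mono nhdsWithin_le_nhds)
          (heq p hp1.ne)
    · intro p hp _
      rw [heq p hp.2.ne]
      exact (hode p hp (hnn p ⟨hp.1.le, hp.2⟩)).congr_of_eventuallyEq (hev p hp.2.ne)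
    · intro p hp
      rcases eq_or_lt_of_le hp.2 with rfl | hp1
      · rw [Function.update_self, hz₁]
      · rw [heqV p hp1.ne]; exact hnn p ⟨hp.1, hp1⟩
    · intro p hp _
      rw [heqV p hp.2.ne]; exact hlt p ⟨hp.1.le, hp.2⟩
    · rw [heqV a ha1.ne, hZ0, hz₀]

/-- An orbit into the singular point continues along the solution started there. -/
theorem Orbit.glue_one {Y : ℝ → ℝ} (hσ : P.σ = 1) (ha : a < 1) (hZ : Orbit P Z a 1)
    (h0 : P.V a (Z a) = 0) (hY : FB P Y 1 b) : ∃ W, FB P W a b := by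
  have h1 : Z 1 = Y 1 := V_eq_V_iff.1 ((hZ.V_one_eq_zero hσ ha).trans hY.left.symm)
  set W : ℝ → ℝ := fun p => if p ≤ 1 then Z p else Y p with hW
  have hWZ : ∀ p, p ≤ 1 → W p = Z p := fun p hp => if_pos hp
  have hWY : ∀ p, 1 ≤ p → W p = Y p := fun p hp => by
    rcases eq_or_lt_of_le hp with rfl | hp
    · rw [hWZ 1 le_rfl, h1]
    · exact if_neg (not_le.2 hp)
  have hb := hY.lt
  refine ⟨W, ⟨hZ.a_pos, ?_, ?_, ?_, ?_⟩, ha.trans hb, ?_, ?_, hY.le_b⟩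
  · rw [← Icc_union_Icc_eq_Icc ha.le hb.le]
    exact (hZ.cont.congr fun p hp => hWZ p hp.2).union_of_isClosed
      (hY.cont.congr fun p hp => hWY p hp.1) isClosed_Icc isClosed_Icc
  · intro p hp hne
    rw [hσ] at hne
    rcases lt_or_gt_of_ne hne with hp1 | hp1
    · rw [hWZ p hp1.le]
      refine (hZ.ode p ⟨hp.1, hp1⟩ (by rw [hσ]; exact hne)).congr_of_eventuallyEq ?_
      filter_upwards [gt_mem_nhds hp1] with t ht using hWZ t (le_of_lt ht)
    · rw [hWY p hp1.le]
      refine (hY.ode p ⟨hp1, hp.2⟩ (by rw [hσ]; exact hne)).congr_of_eventuallyEq ?_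
      filter_upwards [lt_mem_nhds hp1] with t ht using hWY t (le_of_lt ht)
  · intro p hp
    rcases le_total p 1 with hp1 | hp1
    · rw [hWZ p hp1]; exact hZ.nonneg p ⟨hp.1, hp1⟩
    · rw [hWY p hp1]; exact hY.nonneg p ⟨hp1, hp.2⟩
  · intro p hp hs
    have hp1 := ((s_pos_iff (hZ.a_pos.trans hp.1)).1 hs).2
    rw [hWZ p hp1.le]; exact hZ.below p ⟨hp.1, hp1⟩ hs
  · rw [hWZ a ha.le, h0]
  · rw [hWY b hb.le, hY.right]

/-- The reduced problem is solvable from every starting point below `Q` at which `m` is positive,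
provided `m 1 > 0` when the singular point matters. -/
theorem exists_FB (ha : 0 < a) (haQ : a < P.Q) (hMa : 0 < P.M a)
    (hM : P.σ = 1 → P.κ < 0 ∨ 0 < P.M 1) : ∃ Z b, FB P Z a b := by
  rcases P.σ_eq with hσ | hσ
  · rcases lt_trichotomy a 1 with ha1 | rfl | ha1
    · rcases exists_FB_or_orbit_one hσ ha ha1 haQ hMa (hM hσ) with h | ⟨Z, hZ, hZ0⟩
      · exact h
      · rcases eq_or_lt_of_le (hZ.one_le_Q_of_left hσ ha1) with hQ | hQ
        · exact ⟨Z, 1, hZ, ha1, hZ0, hZ.V_one_eq_zero hσ ha1, hQ.ge⟩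
        · obtain ⟨Y, b, hY⟩ := exists_FB_one hσ hQ (M_one_pos (hZ.V_one_eq_zero hσ ha1))
          obtain ⟨W, hW⟩ := hZ.glue_one hσ ha1 hZ0 hY
          exact ⟨W, b, hW⟩
    · exact exists_FB_one hσ haQ hMa
    · exact exists_FB_of_σ_lt ha (by rw [hσ]; exact ha1) haQ hMa
  · exact exists_FB_of_σ_lt ha (by rw [hσ]; linarith) haQ hMa

end Params
end MertonTC

namespace MertonTC
namespace Params

variable {P : Params} {Z W : ℝ → ℝ} {a b : ℝ}

/-! ### The cost as a function of the starting point -/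

/-- `[a, b]` carries a solution of the reduced problem with total cost `L = log (1 + ξ)`. -/
def Cost (P : Params) (a b L : ℝ) : Prop :=
  ∃ Z, FB P Z a b ∧ ∫ p in a..b, P.G p (Z p) = L

namespace Cost

variable {a₁ b₁ L₁ a₂ b₂ L₂ L : ℝ}

theorem unique (h₁ : P.Cost a b₁ L₁) (h₂ : P.Cost a b₂ L₂) : b₁ = b₂ ∧ L₁ = L₂ := by
  obtain ⟨Z, hZ, rfl⟩ := h₁
  obtain ⟨W, hW, rfl⟩ := h₂
  exact ⟨(hZ.unique hW).1, hZ.integral_eq hW⟩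

theorem lt_of_lt (h₁ : P.Cost a₁ b₁ L₁) (h₂ : P.Cost a₂ b₂ L₂) (ha : a₂ < a₁) : L₁ < L₂ := by
  obtain ⟨Z, hZ, rfl⟩ := h₁
  obtain ⟨W, hW, rfl⟩ := h₂
  exact hZ.integral_lt hW ha

theorem b_le (h₁ : P.Cost a₁ b₁ L₁) (h₂ : P.Cost a₂ b₂ L₂) (ha : a₂ ≤ a₁) : b₁ ≤ b₂ := by
  obtain ⟨Z, hZ, rfl⟩ := h₁
  obtain ⟨W, hW, rfl⟩ := h₂
  exact hZ.b_le_b hW ha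

/-- A larger cost means an earlier start. -/
theorem a_lt_of_lt (h₁ : P.Cost a₁ b₁ L₁) (h₂ : P.Cost a₂ b₂ L₂) (hL : L₁ < L₂) : a₂ < a₁ := by
  by_contra! hle
  rcases eq_or_lt_of_le hle with rfl | hlt
  · exact hL.ne (h₁.unique h₂).2
  · exact absurd (h₂.lt_of_lt h₁ hlt) (not_lt.2 hL.le)

theorem a_eq_of_eq (h₁ : P.Cost a₁ b₁ L) (h₂ : P.Cost a₂ b₂ L) : a₁ = a₂ := by
  rcases lt_trichotomy a₁ a₂ with h | h | h
  · exact absurd (h₂.lt_of_lt h₁ h) (lt_irrefl _)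
  · exact h
  · exact absurd (h₁.lt_of_lt h₂ h) (lt_irrefl _)

theorem a_pos (h : P.Cost a b L) : 0 < a := by obtain ⟨Z, hZ, -⟩ := h; exact hZ.a_pos
theorem a_lt_Q (h : P.Cost a b L) : a < P.Q := by obtain ⟨Z, hZ, -⟩ := h; exact hZ.a_lt_Q
theorem lt (h : P.Cost a b L) : a < b := by obtain ⟨Z, hZ, -⟩ := h; exact hZ.lt
theorem add_le (h : P.Cost a b L) : a + b ≤ 2 * P.Q := by obtain ⟨Z, hZ, -⟩ := h; exact hZ.add_le
theorem Q_lt_b (h : P.Cost a b L) (hσ : P.Q ≠ P.σ) : P.Q < b := by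
  obtain ⟨Z, hZ, -⟩ := h; exact hZ.Q_lt_b hσ
theorem b_lt_one (h : P.Cost a b L) (hσ : P.σ = 1) (hQ : P.Q < 1) : b < 1 := by
  obtain ⟨Z, hZ, -⟩ := h; exact hZ.b_lt_one hσ hQ

theorem L_pos (h : P.Cost a b L) : 0 < L := by
  obtain ⟨Z, hZ, rfl⟩ := h
  rw [← integral_g]; exact hZ.integral_g_pos hZ.lt le_rfl

/-- Away from the singular point a larger cost means a strictly later end. -/
theorem b_lt (h₁ : P.Cost a₁ b₁ L₁) (h₂ : P.Cost a₂ b₂ L₂) (hL : L₁ < L₂)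
    (hσ : P.σ = 1 → P.Q < 1) : b₁ < b₂ := by
  have ha := h₁.a_lt_of_lt h₂ hL
  obtain ⟨Z, hZ, rfl⟩ := h₁
  obtain ⟨W, hW, rfl⟩ := h₂
  refine hZ.b_lt_b hW ha fun hm => ?_
  have h1 := hZ.σ_eq_one hm
  have := hZ.b_lt_one h1 (hσ h1)
  rw [h1] at hm
  linarith [hm.2]

/-- Beyond the singular point all solutions which pass through it coincide. -/
theorem b_eq_of_le_one (h₁ : P.Cost a₁ b₁ L₁) (h₂ : P.Cost a₂ b₂ L₂) (hσ : P.σ = 1)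
    (hQ : 1 < P.Q) (ha₁ : a₁ ≤ 1) (ha₂ : a₂ ≤ 1) : b₁ = b₂ := by
  obtain ⟨Z, hZ, rfl⟩ := h₁
  obtain ⟨W, hW, rfl⟩ := h₂
  exact ((hZ.restrict_one hσ ha₁ hQ).unique (hW.restrict_one hσ ha₂ hQ)).1

end Cost

theorem M_pos_of_le {p A : ℝ} (hp : 0 < p) (hpA : p ≤ A) (hA : A < P.Q) (hM : 0 < P.M A) :
    0 < P.M p := by
  have hR := P.R_pos
  rcases P.sign_cases with ⟨hκ, _⟩ | ⟨hκ, _⟩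
  · have h1 := M_sub_M (P := P) p A
    have h2 : 0 ≤ P.κ * P.R * ((p - A) * (p + A - 2 * P.Q)) :=
      mul_nonneg (mul_pos hκ hR).le (mul_nonneg_of_nonpos_of_nonpos (by linarith) (by linarith))
    linarith
  · have h1 : 0 ≤ P.κ * P.R * (p * (p - 2 * P.Q)) :=
      mul_nonneg_of_nonpos_of_nonpos (mul_neg_of_neg_of_pos hκ hR).le
        (mul_nonpos_of_nonneg_of_nonpos hp.le (by linarith))
    rw [M]; linarith

theorem FB.Z_left (h : FB P Z a b) : 0 < P.M a ∧ Z a = Real.log (P.M a) / P.c := by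
  have h1 := exp_eq (P := P) a (Z a)
  rw [h.left, mul_zero, add_zero] at h1
  rw [← h1, Real.log_exp, mul_div_cancel_left₀ _ c_ne]
  exact ⟨Real.exp_pos _, rfl⟩

theorem ne_σ_of_le_half {p : ℝ} (h0 : 0 < p) (h1 : p ≤ 1 / 2) : p ≠ P.σ := by
  rintro rfl
  rcases P.σ_eq with h2 | h2 <;> rw [h2] at h0 h1 <;> linarith

theorem s_bounds {p : ℝ} (h0 : 0 < p) (h1 : p ≤ 1 / 2) :
    (0 < P.s p ∧ p / 2 ≤ P.s p ∧ P.s p ≤ p) ∨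
      (P.s p < 0 ∧ P.s p ≤ -p ∧ -(2 * p) ≤ P.s p) := by
  rcases P.σ_eq with h2 | h2
  · left; rw [s, h2]; refine ⟨?_, ?_, ?_⟩ <;> nlinarith
  · right; rw [s, h2]; refine ⟨?_, ?_, ?_⟩ <;> nlinarith

/-- Near `p = 0` the excess `V` grows at least linearly along every solution. -/
theorem exists_linear_lower_bound (P : Params) : ∃ θ p₀ : ℝ, 0 < θ ∧ θ ≤ 1 / 4 ∧ 0 < p₀ ∧
    p₀ ≤ 1 / 2 ∧ p₀ < P.Q ∧ ∀ Z a b, FB P Z a b → ∀ p ∈ Icc a p₀, θ * (p - a) ≤ P.V p (Z p) := by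
  have hR := P.R_pos
  have hQ := P.Q_pos
  have hβ := β_pos (P := P)
  have hRQ := mul_pos hR hQ
  set p₀ := min (P.Q / 2) (1 / 2) with hp₀
  have hp₀pos : 0 < p₀ := lt_min (by linarith) (by norm_num)
  have hp₀Q : p₀ ≤ P.Q / 2 := min_le_left _ _
  have hp₀1 : p₀ ≤ 1 / 2 := min_le_right _ _
  obtain ⟨N₀, hN₀⟩ := (isCompact_Icc (a := 0) (b := p₀)).exists_bound_of_continuousOn
    (continuous_M (P := P)).continuousOn
  set N := |N₀| + |P.κ| with hN
  have hN0 : 0 ≤ N := by positivity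
  set θ := min (1 / 4) (P.R * P.Q / (1 + 8 * P.β * N)) with hθ
  have hden : 0 < 1 + 8 * P.β * N := by positivity
  have hθ0 : 0 < θ := lt_min (by norm_num) (div_pos hRQ hden)
  have hθ4 : θ ≤ 1 / 4 := min_le_left _ _
  have hθN : θ * (1 + 8 * P.β * N) ≤ P.R * P.Q := by
    have h1 := min_le_right (1 / 4) (P.R * P.Q / (1 + 8 * P.β * N))
    rwa [le_div_iff₀ hden] at h1
  refine ⟨θ, p₀, hθ0, hθ4, hp₀pos, hp₀1, by linarith, fun Z a b h => ?_⟩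
  have ha0 := h.a_pos
  have hp₀b : p₀ < b := by linarith [h.le_b]
  have := nonpos_of_barrier (φ := fun p => θ * (p - a) - P.V p (Z p)) (x := a) (y := p₀)
    ((by fun_prop : Continuous fun p : ℝ => θ * (p - a)).continuousOn.sub
      (continuousOn_V (h.cont.mono (Icc_subset_Icc le_rfl hp₀b.le))))
    (by rw [sub_self, mul_zero, h.left, sub_zero])
    (fun t ht _ => (((hasDerivAt_id t).sub_const a).const_mul θ).sub
      (h.hasDerivAt_V ⟨ht.1, ht.2.trans hp₀b⟩ (ne_σ_of_le_half (ha0.trans ht.1)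
        (ht.2.le.trans hp₀1))))
    (fun t ht hpos => by
      have ht0 : 0 < t := ha0.trans ht.1
      have htm : t ∈ Ioo a b := ⟨ht.1, ht.2.trans hp₀b⟩
      have hV0 := h.nonneg t (Ioo_subset_Icc_self htm)
      have hθa : 0 ≤ θ * a := (mul_pos hθ0 ha0).le
      have hV1 : P.V t (Z t) ≤ θ * t := by linarith
      have hθt : θ * t ≤ 1 / 4 * t := mul_le_mul_of_nonneg_right hθ4 ht0.le
      have hexp : Real.exp (P.c * Z t) ≤ N := by
        rw [exp_eq t]
        have h1 := hN₀ t ⟨ht0.le, ht.2.le⟩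
        rw [Real.norm_eq_abs] at h1
        have h2 : P.κ * P.V t (Z t) ≤ |P.κ| * 1 :=
          (mul_le_mul_of_nonneg_right (le_abs_self _) hV0).trans
            (mul_le_mul_of_nonneg_left (by linarith [ht.2]) (abs_nonneg _))
        linarith [le_abs_self (P.M t), le_abs_self N₀]
      have hden : t * t / 8 ≤ P.s t * (P.s t - P.V t (Z t)) := by
        have h4 : P.V t (Z t) ≤ t / 4 := by linarith
        rcases s_bounds (P := P) ht0 (ht.2.le.trans hp₀1) with ⟨-, h2, -⟩ | ⟨h1, h2, -⟩
        · have h3 : t / 4 ≤ P.s t - P.V t (Z t) := by linarith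
          have := mul_le_mul h2 h3 (by linarith) (by linarith)
          linarith
        · have h3 : t ≤ -(P.s t - P.V t (Z t)) := by linarith
          have := mul_le_mul (by linarith : t ≤ -P.s t) h3 ht0.le (by linarith)
          have h5 : 0 ≤ t * t := mul_self_nonneg t
          linarith
      have hG : t * P.G t (Z t) ≤ 8 * θ := by
        rw [G, ← mul_div_assoc, div_le_iff₀ (lt_of_lt_of_le (by positivity) hden)]
        have h1 := mul_le_mul_of_nonneg_left hV1 ht0.le
        have h2 := mul_le_mul_of_nonneg_left hden (mul_pos (by norm_num : (0 : ℝ) < 8) hθ0).le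
        linarith
      have hG0 : 0 ≤ t * P.G t (Z t) := mul_nonneg ht0.le (h.G_nonneg htm)
      have h5 : P.β * Real.exp (P.c * Z t) * (t * P.G t (Z t)) ≤ P.β * N * (8 * θ) :=
        mul_le_mul (mul_le_mul_of_nonneg_left hexp hβ.le) hG hG0 (mul_nonneg hβ.le hN0)
      have h6 := mul_le_mul_of_nonneg_left (by linarith [ht.2] : P.Q ≤ 2 * (P.Q - t)) hR.le
      linarith)
  exact fun p hp => by linarith [this p hp]

/-- As the starting point approaches `0` the cost grows beyond all bounds, because the cost
integrand is at least of order `1 / p`. -/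
theorem exists_large_cost (P : Params) (K : ℝ) :
    ∃ A > 0, ∀ a ∈ Ioo 0 A, ∀ Z b, FB P Z a b → K ≤ ∫ p in a..b, P.G p (Z p) := by
  obtain ⟨θ, p₀, hθ0, hθ4, hp₀pos, hp₀1, hp₀Q, hlow⟩ := exists_linear_lower_bound P
  refine ⟨p₀ / 2 * Real.exp (-(12 * |K| / θ)), by positivity, fun a ha Z b h => ?_⟩
  replace hlow := hlow Z a b h
  have hexp1 : Real.exp (-(12 * |K| / θ)) ≤ 1 := by
    rw [Real.exp_le_one_iff, neg_nonpos]; positivity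
  have ha2 : 2 * a < p₀ := by
    have := mul_le_mul_of_nonneg_left hexp1 (half_pos hp₀pos).le
    linarith [ha.2]
  have ha0 := ha.1
  have hp₀b : p₀ < b := hp₀Q.trans_le h.le_b
  -- `V` is of order `p` and `s` at most of order `p`, hence `G` is at least of order `1 / p`
  have hGlow : ∀ p ∈ Icc (2 * a) p₀, θ / 12 * p⁻¹ ≤ P.g Z p := by
    intro p hp
    have hp0 : 0 < p := by linarith [hp.1]
    have hm : p ∈ Icc a b := ⟨by linarith [hp.1], hp.2.trans hp₀b.le⟩
    have hp1 : p ≤ 1 / 2 := hp.2.trans hp₀1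
    have hne := ne_σ_of_le_half (P := P) hp0 hp1
    have hV : θ * p / 2 ≤ P.V p (Z p) := by
      have h1 := hlow p ⟨hm.1, hp.2⟩
      have h2 := mul_le_mul_of_nonneg_left (by linarith [hp.1] : p / 2 ≤ p - a) hθ0.le
      linarith
    have hV0 := h.nonneg p hm
    have hd := h.denom_pos hm hne
    rw [g_of_ne hne, G, ← div_eq_mul_inv, div_div, div_le_div_iff₀ (by positivity) hd]
    rcases s_bounds (P := P) hp0 hp1 with ⟨h1, -, h3⟩ | ⟨h1, -, h3⟩
    · have e1 : P.s p * (P.s p - P.V p (Z p)) ≤ p * p :=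
        mul_le_mul h3 (by linarith) (pos_of_mul_pos_right hd h1.le).le hp0.le
      have e2 := mul_le_mul_of_nonneg_left e1 hθ0.le
      have e3 := mul_le_mul_of_nonneg_left hV hp0.le
      have e4 : 0 ≤ θ * (p * p) := by positivity
      linarith
    · have e1 : P.s p * (P.s p - P.V p (Z p)) ≤ 2 * p * (2 * p + P.V p (Z p)) := by
        rw [← neg_mul_neg (P.s p)]
        exact mul_le_mul (by linarith) (by linarith) (by linarith) (by linarith)
      have e2 := mul_le_mul_of_nonneg_left e1 hθ0.le
      have e3 := mul_le_mul_of_nonneg_left hV hp0.le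
      have e4 : 0 ≤ p * P.V p (Z p) := mul_nonneg hp0.le hV0
      have e5 : θ * (p * P.V p (Z p)) ≤ 1 / 4 * (p * P.V p (Z p)) :=
        mul_le_mul_of_nonneg_right hθ4 e4
      have e6 : 0 ≤ θ * (p * p) := by positivity
      linarith
  have hmem1 : 2 * a ∈ Icc a b := ⟨by linarith, by linarith⟩
  have hmem2 : p₀ ∈ Icc a b := ⟨by linarith, hp₀b.le⟩
  have hmema : a ∈ Icc a b := ⟨le_rfl, h.lt.le⟩
  have hmemb : b ∈ Icc a b := ⟨h.lt.le, le_rfl⟩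
  have hint : ∫ p in (2 * a)..p₀, θ / 12 * p⁻¹ = θ / 12 * Real.log (p₀ / (2 * a)) := by
    rw [intervalIntegral.integral_const_mul, integral_inv_of_pos (by linarith) hp₀pos]
  have hle : ∫ p in (2 * a)..p₀, θ / 12 * p⁻¹ ≤ ∫ p in (2 * a)..p₀, P.g Z p := by
    refine intervalIntegral.integral_mono_on ha2.le ?_ (h.intervalIntegrable_g hmem1 hmem2) hGlow
    refine ContinuousOn.intervalIntegrable_of_Icc ha2.le (continuousOn_const.mul ?_)
    exact continuousOn_id.inv₀ fun p hp => by simp only [id]; linarith [hp.1]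
  have hmid : ∫ p in (2 * a)..p₀, P.g Z p ≤ ∫ p in a..b, P.g Z p := by
    refine intervalIntegral.integral_mono_interval hmem1.1 ha2.le hp₀b.le ?_
      (h.intervalIntegrable_g hmema hmemb)
    refine (ae_restrict_iff' measurableSet_Ioc).2 (ae_of_all _ fun p hp => ?_)
    exact h.g_nonneg (Ioc_subset_Icc_self hp)
  have hlog : 12 * |K| / θ ≤ Real.log (p₀ / (2 * a)) := by
    rw [Real.le_log_iff_exp_le (by positivity), le_div_iff₀ (by linarith)]
    have h1 := ha.2
    rw [Real.exp_neg, ← div_eq_mul_inv, lt_div_iff₀ (Real.exp_pos _)] at h1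
    linarith
  have hK : |K| ≤ θ / 12 * Real.log (p₀ / (2 * a)) := by
    have h1 := mul_le_mul_of_nonneg_left hlog (by positivity : 0 ≤ θ / 12)
    have e : θ / 12 * (12 * |K| / θ) = |K| := by field_simp
    linarith
  rw [integral_g a b] at hmid
  rw [hint] at hle
  linarith [le_abs_self K]

/-- Every cost at least as large as that of a given starting point is attained, by continuity. -/
theorem exists_cost_of_le {A L : ℝ} (hA0 : 0 < A) (hAQ : A < P.Q) (hMA : 0 < P.M A)
    (hM : P.σ = 1 → P.κ < 0 ∨ 0 < P.M 1)
    (hA : ∀ Z b, FB P Z A b → ∫ p in A..b, P.G p (Z p) ≤ L) : ∃ a ≤ A, ∃ b, P.Cost a b L := by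
  have hMpos : ∀ a ∈ Ioc 0 A, 0 < P.M a := fun a ha => M_pos_of_le ha.1 ha.2 hAQ hMA
  have hex : ∀ a ∈ Ioc 0 A, ∃ Z b, FB P Z a b := fun a ha =>
    exists_FB ha.1 (ha.2.trans_lt hAQ) (hMpos a ha) hM
  choose! Zs bs hZs using hex
  obtain ⟨x₁, hx₁, hlarge⟩ := exists_large_cost P L
  set x := min A (x₁ / 2) with hx
  have hx0 : 0 < x := lt_min hA0 (by linarith)
  have hxA : x ≤ A := min_le_left _ _
  have hxx : x < x₁ := (min_le_right _ _).trans_lt (by linarith)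
  have hmem : ∀ a ∈ Icc x A, a ∈ Ioc 0 A := fun a ha => ⟨hx0.trans_le ha.1, ha.2⟩
  set f : ℝ → ℝ := fun a => ∫ p in a..bs a, P.G p (Zs a p) with hf
  set ζ : ℝ → ℝ := fun a => Real.log (P.M a) / P.c with hζ
  -- the difference of costs is controlled by the difference of the starting values `ζ`
  have hbound : ∀ a ∈ Icc x A, ∀ a' ∈ Icc x A, |f a' - f a| ≤ |ζ a' - ζ a| / x := by
    have key : ∀ a ∈ Icc x A, ∀ a' ∈ Icc x A, a' ≤ a → |f a' - f a| ≤ |ζ a' - ζ a| / x := by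
      intro a ha a' ha' hle
      have h1 := hZs a (hmem a ha)
      have h2 := hZs a' (hmem a' ha')
      have h3 := h1.integral_sub_le h2 hle
      have h4 : f a ≤ f a' := by
        rcases eq_or_lt_of_le hle with rfl | hlt
        · exact le_rfl
        · exact (h1.integral_lt h2 hlt).le
      rw [h1.Z_left.2, h2.Z_left.2, ← mul_sub] at h3
      rw [abs_of_nonneg (by linarith), le_div_iff₀ hx0]
      have h5 := mul_le_mul_of_nonneg_right ha'.1 (sub_nonneg.2 h4)
      have h6 := le_abs_self (ζ a' - ζ a)
      simp only [hf, hζ] at h3 h5 h6 ⊢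
      linarith
    intro a ha a' ha'
    rcases le_total a' a with hle | hle
    · exact key a ha a' ha' hle
    · rw [abs_sub_comm, abs_sub_comm (ζ a')]; exact key a' ha' a ha hle
  have hζc : ContinuousOn ζ (Icc x A) :=
    (continuous_M.continuousOn.log fun p hp => (hMpos p (hmem p hp)).ne').div_const _
  have hfc : ContinuousOn f (Icc x A) := by
    intro a ha
    have h1 : Tendsto (fun a' => |ζ a' - ζ a| / x) (𝓝[Icc x A] a) (𝓝 0) := by
      have := (((hζc a ha).sub continuousWithinAt_const).abs).div_const x
        (f := fun a' => |ζ a' - ζ a|)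
      simpa [ContinuousWithinAt] using this
    rw [ContinuousWithinAt, tendsto_iff_norm_sub_tendsto_zero]
    refine squeeze_zero' (Eventually.of_forall fun _ => norm_nonneg _) ?_ h1
    filter_upwards [self_mem_nhdsWithin] with a' ha'
    exact hbound a ha a' ha'
  have hfA : f A ≤ L := hA _ _ (hZs A ⟨hA0, le_rfl⟩)
  have hfx : L ≤ f x := hlarge x ⟨hx0, hxx⟩ _ _ (hZs x ⟨hx0, hxA⟩)
  obtain ⟨a, ha, hfa⟩ := intermediate_value_Icc' hxA hfc ⟨hfA, hfx⟩
  exact ⟨a, ha.2, bs a, Zs a, hZs a (hmem a ha), hfa⟩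

/-! ### Small costs -/

/-- If `m` is positive at its turning point, the cost vanishes as the starting point tends to it. -/
theorem eventually_cost_le (hM : 0 < P.M P.Q) {L : ℝ} (hL : 0 < L) :
    ∀ᶠ a in 𝓝[<] P.Q, ∀ Z b, FB P Z a b → ∫ p in a..b, P.G p (Z p) ≤ L := by
  have hQ := P.Q_pos
  have hc : ContinuousAt (fun a => Real.log (P.M a) / P.c) P.Q :=
    (continuous_M.continuousAt.log hM.ne').div_const _
  have h1 : ∀ᶠ a in 𝓝[<] P.Q, Real.log (P.M a) / P.c - Real.log (P.M P.Q) / P.c < P.Q / 2 * L := by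
    have h2 : Tendsto (fun a => Real.log (P.M a) / P.c - Real.log (P.M P.Q) / P.c) (𝓝[<] P.Q)
        (𝓝 0) := by
      have := (hc.tendsto.sub_const (Real.log (P.M P.Q) / P.c)).mono_left
        (nhdsWithin_le_nhds (s := Iio P.Q))
      rwa [sub_self] at this
    exact h2.eventually (gt_mem_nhds (by positivity))
  filter_upwards [h1, Ioo_mem_nhdsLT (by linarith : P.Q / 2 < P.Q)] with a ha haI Z b h
  have hab := h.lt.le
  have e1 := h.integral_mul_g le_rfl hab le_rfl
  have hζ : Real.log (P.M P.Q) / P.c ≤ Z b := by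
    have h2 : P.V P.Q (Real.log (P.M P.Q) / P.c) = 0 := by
      rw [V, mul_div_cancel₀ _ c_ne, Real.exp_log hM, sub_self, zero_div]
    rw [← V_le_V_iff (P := P) (p := P.Q), h2]
    have h3 := V_sub_V (P := P) P.Q b (Z b)
    rw [h.right, sub_zero] at h3
    rw [h3]
    have := h.le_b
    exact mul_nonneg P.R_pos.le (mul_nonneg (by linarith) (by linarith))
  -- `a L ≤ ∫ p G = Z a - Z b`, and `Z b` is at least the value of `m` at `Q` in the variable `Z`
  have e2 : a * ∫ p in a..b, P.g Z p ≤ ∫ p in a..b, p * P.g Z p := by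
    rw [← intervalIntegral.integral_const_mul]
    refine intervalIntegral.integral_mono_on hab
      ((continuousOn_const.mul h.continuousOn_g).intervalIntegrable_of_Icc hab)
      ((continuousOn_id.mul h.continuousOn_g).intervalIntegrable_of_Icc hab) fun p hp => ?_
    exact mul_le_mul_of_nonneg_right hp.1 (h.g_nonneg hp)
  rw [integral_g, e1, h.Z_left.2] at e2
  by_contra! hlt
  have h0 : 0 < ∫ p in a..b, P.G p (Z p) := hL.trans hlt
  nlinarith [haI.1]

/-- If `m` vanishes at `r₁ ≤ Q`, with `m` nonpositive from there to the mirror image of `r₁`, then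
the cost tends to at most the integral for `n = 0` as the starting point tends to `r₁`. -/
theorem eventually_cost_le_of_root {r₁ L : ℝ} (hκ : 0 < P.κ) (hr0 : 0 < r₁) (hrQ : r₁ ≤ P.Q)
    (hr : P.M r₁ = 0) (hM1 : P.σ = 1 → 0 < P.M 1)
    (hL : ∫ p in r₁..(2 * P.Q - r₁), -P.M p / (P.s p * (P.M p + P.κ * P.s p)) < L) :
    ∀ᶠ a in 𝓝[<] r₁, ∀ Z b, FB P Z a b → ∫ p in a..b, P.G p (Z p) ≤ L := by
  set r₂ := 2 * P.Q - r₁ with hr₂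
  have hr12 : r₁ ≤ r₂ := by linarith
  have hR := P.R_pos
  have hfac : ∀ p, P.M p = P.κ * P.R * ((p - r₁) * (p - r₂)) := by
    intro p
    have := M_sub_M (P := P) p r₁
    rw [hr, sub_zero] at this
    rw [this, hr₂]; ring
  have hκR : 0 < P.κ * P.R := mul_pos hκ hR
  set ℓ : ℝ → ℝ := fun p => P.M p + P.κ * P.s p with hℓ
  have hℓc : Continuous ℓ := continuous_M.add (continuous_const.mul continuous_s)
  have hsℓ : ∀ p ∈ Icc r₁ r₂, 0 < P.s p * ℓ p := by
    intro p hp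
    have hp0 := hr0.trans_le hp.1
    have hMp : P.M p ≤ 0 := by
      rw [hfac]
      exact mul_nonpos_of_nonneg_of_nonpos hκR.le
        (mul_nonpos_of_nonneg_of_nonpos (by linarith [hp.1]) (by linarith [hp.2]))
    rcases lt_trichotomy (P.s p) 0 with h | h | h
    · exact mul_pos_of_neg_of_neg h (by simp only [hℓ]; nlinarith)
    · exfalso
      have : p = P.σ := by by_contra hne; exact s_ne hp0 hne h
      rcases P.σ_eq with h1 | h1
      · rw [h1] at this; rw [this] at hMp; linarith [hM1 h1]
      · rw [h1] at this; linarith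
    · have h1 := (s_pos_iff hp0).1 h
      have h2 := chord_le_ell h1.1 ⟨hp0.le, h1.2.le⟩
      have h3 := mul_pos hp0 (hM1 h1.1)
      exact mul_pos h (by simp only [hℓ]; linarith [h1.2])
  have hsℓc : Continuous fun p => P.s p * ℓ p := continuous_s.mul hℓc
  -- `s ℓ` stays positive a little beyond both roots, where the solution may extend
  obtain ⟨δ, hδ, hδ'⟩ : ∃ δ > 0, ∀ p ∈ Icc (r₁ - δ) (r₂ + δ), 0 < P.s p * ℓ p := by
    obtain ⟨δ₁, h1, h1'⟩ := Metric.eventually_nhds_iff.1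
      (hsℓc.continuousAt.eventually (lt_mem_nhds (hsℓ r₁ ⟨le_rfl, hr12⟩)))
    obtain ⟨δ₂, h2, h2'⟩ := Metric.eventually_nhds_iff.1
      (hsℓc.continuousAt.eventually (lt_mem_nhds (hsℓ r₂ ⟨hr12, le_rfl⟩)))
    refine ⟨min δ₁ δ₂ / 2, half_pos (lt_min h1 h2), fun p hp => ?_⟩
    have e1 := min_le_left δ₁ δ₂
    have e2 := min_le_right δ₁ δ₂
    have e0 : 0 < min δ₁ δ₂ := lt_min h1 h2
    rcases lt_or_ge p r₁ with h | h
    · exact h1' (by rw [Real.dist_eq, abs_sub_lt_iff]; constructor <;> linarith [hp.1])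
    rcases lt_or_ge r₂ p with h' | h'
    · exact h2' (by rw [Real.dist_eq, abs_sub_lt_iff]; constructor <;> linarith [hp.2])
    · exact hsℓ p ⟨h, h'⟩
  obtain ⟨d, hd, hd'⟩ : ∃ d > 0, ∀ p ∈ Icc (r₁ - δ) (r₂ + δ), 2 * d ≤ |ℓ p| := by
    obtain ⟨x, hx, hmin⟩ := (isCompact_Icc (a := r₁ - δ) (b := r₂ + δ)).exists_isMinOn
      ⟨r₁, by linarith, by linarith⟩ hℓc.abs.continuousOn
    refine ⟨|ℓ x| / 2, half_pos (abs_pos.2 (right_ne_zero_of_mul (hδ' x hx).ne')), fun p hp => ?_⟩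
    have : |ℓ x| ≤ |ℓ p| := hmin hp
    linarith
  set J := ∫ p in r₁..r₂, -P.M p / (P.s p * ℓ p) with hJ
  set w := 2 * (P.Q - r₁ + δ) with hw
  have hw0 : 0 < w := by linarith
  set C := P.κ / (2 * d * d) * w with hC
  have hC0 : 0 < C := by positivity
  have hMlim : Tendsto P.M (𝓝[<] r₁) (𝓝 0) := by
    rw [← hr]; exact continuous_M.continuousAt.mono_left nhdsWithin_le_nhds
  filter_upwards [hMlim.eventually (gt_mem_nhds hd),
    hMlim.eventually (gt_mem_nhds (div_pos (sub_pos.2 hL) hC0)),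
    Ioo_mem_nhdsLT (by linarith : r₁ - δ < r₁)] with a had haC haI Z b h
  have hab := h.lt.le
  have hbr : b ≤ r₂ + δ := by linarith [h.add_le, haI.1]
  have hsub : ∀ p ∈ Icc a b, p ∈ Icc (r₁ - δ) (r₂ + δ) := fun p hp =>
    ⟨haI.1.le.trans hp.1, hp.2.trans hbr⟩
  have hMa := h.Z_left.1
  -- the end lies on the graph of `m` with `n > 0`, beyond `Q`, hence beyond the larger root
  have hbr₂ : r₂ < b := by
    have h1 := exp_eq (P := P) b (Z b)
    rw [h.right, mul_zero, add_zero, hfac] at h1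
    have h2 : 0 < (b - r₁) * (b - r₂) :=
      pos_of_mul_pos_right (h1 ▸ Real.exp_pos _) hκR.le
    have h3 := h.le_b
    have h4 := pos_of_mul_pos_right h2 (by linarith)
    linarith
  have hc0 : 0 < P.c := by
    rcases P.sign_cases with h1 | h1
    · exact h1.2
    · linarith [h1.1]
  -- The integrand exceeds its value at `n = 0` by a multiple of `n ≤ m a`.
  have hpt : ∀ p ∈ Icc a b, P.G p (Z p) ≤ -P.M p / (P.s p * ℓ p) + P.M a * (P.κ / (2 * d * d)) := by
    intro p hp
    have hp' := hsub p hp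
    have hpos := hδ' p hp'
    have hs0 : P.s p ≠ 0 := left_ne_zero_of_mul hpos.ne'
    have hl0 : ℓ p ≠ 0 := right_ne_zero_of_mul hpos.ne'
    have hpσ : p ≠ P.σ := by
      rintro rfl; exact hs0 (by simp [s])
    have hden := h.denom_pos hp hpσ
    set n := Real.exp (P.c * Z p) with hn
    have hn0 : 0 < n := Real.exp_pos _
    have hna : n ≤ P.M a := by
      have h1 : Real.exp (P.c * Z p) ≤ Real.exp (P.c * Z a) :=
        Real.exp_le_exp.2 (mul_le_mul_of_nonneg_left
          (h.antitoneOn ⟨le_rfl, hab⟩ hp hp.1) hc0.le)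
      rwa [exp_eq a (Z a), h.left, mul_zero, add_zero] at h1
    have hκV : P.κ * P.V p (Z p) = n - P.M p := by rw [hn, exp_eq p]; ring
    have hlκ : P.κ * (P.s p - P.V p (Z p)) = ℓ p - n := by simp only [hℓ]; rw [mul_sub, hκV]; ring
    have hln : 0 < P.s p * (ℓ p - n) := by
      rw [← hlκ, mul_left_comm]; exact mul_pos hκ hden
    have hln0 : ℓ p - n ≠ 0 := right_ne_zero_of_mul hln.ne'
    have hGn : P.G p (Z p) = (n - P.M p) / (P.s p * (ℓ p - n)) := by
      rw [G, ← hκV, ← hlκ, mul_left_comm, mul_div_mul_left _ _ hκ.ne']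
    have hdiff : P.G p (Z p) - -P.M p / (P.s p * ℓ p) = n * (P.κ / (ℓ p * (ℓ p - n))) := by
      rw [hGn]
      have hMs : P.M p = ℓ p - P.κ * P.s p := by simp only [hℓ]; ring
      rw [hMs]
      field_simp
      ring
    have hll : 2 * d * d ≤ ℓ p * (ℓ p - n) := by
      have h1 := hd' p hp'
      rcases lt_or_gt_of_ne hs0 with hs | hs
      · have h2 := neg_of_mul_pos_right hpos hs.le
        rw [abs_of_neg h2] at h1
        nlinarith
      · have h2 := pos_of_mul_pos_right hpos hs.le
        rw [abs_of_pos h2] at h1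
        have h3 : d ≤ ℓ p - n := by linarith
        nlinarith
    have h4 : P.κ / (ℓ p * (ℓ p - n)) ≤ P.κ / (2 * d * d) :=
      div_le_div_of_nonneg_left hκ.le (by positivity) hll
    have h5 : n * (P.κ / (ℓ p * (ℓ p - n))) ≤ P.M a * (P.κ / (2 * d * d)) :=
      mul_le_mul hna h4 (div_nonneg hκ.le (lt_of_lt_of_le (by positivity) hll).le) hMa.le
    linarith
  have hcont : ContinuousOn (fun p => -P.M p / (P.s p * ℓ p)) (Icc a b) :=
    continuous_M.continuousOn.neg.div hsℓc.continuousOn fun p hp => (hδ' p (hsub p hp)).ne'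
  have har : a ≤ r₁ := haI.2.le
  have hI : ∀ {u v}, u ∈ Icc a b → v ∈ Icc a b →
      IntervalIntegrable (fun p => -P.M p / (P.s p * ℓ p)) volume u v := fun hu hv =>
    (hcont.mono (uIcc_subset_Icc hu hv)).intervalIntegrable
  have ma : a ∈ Icc a b := ⟨le_rfl, hab⟩
  have mb : b ∈ Icc a b := ⟨hab, le_rfl⟩
  have m1 : r₁ ∈ Icc a b := ⟨har, hr12.trans hbr₂.le⟩
  have m2 : r₂ ∈ Icc a b := ⟨har.trans hr12, hbr₂.le⟩
  -- outside the roots `m` is nonnegative, so the integrand for `n = 0` is nonpositive there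
  have hJle : ∫ p in a..b, -P.M p / (P.s p * ℓ p) ≤ J := by
    have e1 := intervalIntegral.integral_add_adjacent_intervals (hI ma m1) (hI m1 m2)
    have e2 := intervalIntegral.integral_add_adjacent_intervals (hI ma m2) (hI m2 mb)
    have hneg : ∀ p ∈ Icc a b, 0 ≤ P.M p → -P.M p / (P.s p * ℓ p) ≤ 0 := fun p hp h1 =>
      div_nonpos_of_nonpos_of_nonneg (by linarith) (hδ' p (hsub p hp)).le
    have e3 : ∫ p in a..r₁, -P.M p / (P.s p * ℓ p) ≤ 0 := by
      have := intervalIntegral.integral_mono_on har (hI ma m1)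
        (intervalIntegrable_const (c := (0 : ℝ))) fun p hp =>
        hneg p ⟨hp.1, hp.2.trans m1.2⟩ (by
          rw [hfac]; exact mul_nonneg hκR.le
            (mul_nonneg_of_nonpos_of_nonpos (by linarith [hp.2]) (by linarith [hp.2])))
      simpa using this
    have e4 : ∫ p in r₂..b, -P.M p / (P.s p * ℓ p) ≤ 0 := by
      have := intervalIntegral.integral_mono_on hbr₂.le (hI m2 mb)
        (intervalIntegrable_const (c := (0 : ℝ))) fun p hp =>
        hneg p ⟨m2.1.trans hp.1, hp.2⟩ (by
          rw [hfac]; exact mul_nonneg hκR.le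
            (mul_nonneg (by linarith [hp.1]) (by linarith [hp.1])))
      simpa using this
    linarith
  have hle : ∫ p in a..b, P.G p (Z p) ≤
      ∫ p in a..b, (-P.M p / (P.s p * ℓ p) + P.M a * (P.κ / (2 * d * d))) :=
    intervalIntegral.integral_mono_on hab h.intervalIntegrable_G
      ((hI ma mb).add intervalIntegrable_const) hpt
  rw [intervalIntegral.integral_add (hI ma mb) intervalIntegrable_const,
    intervalIntegral.integral_const, smul_eq_mul] at hle
  have hwab : b - a ≤ w := by linarith [h.add_le, haI.1]
  have hfin : (b - a) * (P.M a * (P.κ / (2 * d * d))) ≤ P.M a * C := by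
    have h1 : 0 ≤ P.M a * (P.κ / (2 * d * d)) := by positivity
    have h2 := mul_le_mul_of_nonneg_right hwab h1
    have e : w * (P.M a * (P.κ / (2 * d * d))) = P.M a * C := by rw [hC]; ring
    linarith
  rw [lt_div_iff₀ hC0] at haC
  linarith

/-- For small costs the upper boundary moves much faster than the cost: with `x = Q - a` and
`y = b - Q`, the cost is of order `x³` and `x² - y²` is at most of that order. -/
theorem eventually_cost_lt_b_sub (hσ : P.σ < P.Q) (C : ℝ) :
    ∀ᶠ a in 𝓝[<] P.Q, ∀ b L, P.Cost a b L → C * (Real.exp L - 1) < b - P.Q := by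
  have hR := P.R_pos
  have hQ := P.Q_pos
  have hβ := β_pos (P := P)
  obtain ⟨a₁, ha₁, ha₁Q⟩ := exists_between (max_lt hσ hQ)
  have ha₁σ : P.σ < a₁ := (le_max_left _ _).trans_lt ha₁
  have ha₁0 : 0 < a₁ := (le_max_right _ _).trans_lt ha₁
  set s₀ := a₁ * (a₁ - P.σ) with hs₀
  have hs₀0 : 0 < s₀ := mul_pos ha₁0 (by linarith)
  obtain ⟨N, hN⟩ := (isCompact_Icc (a := 0) (b := 2 * P.Q)).exists_bound_of_continuousOn
    (continuous_M (P := P)).continuousOn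
  have hN0 : 0 ≤ N := (norm_nonneg _).trans (hN 0 ⟨le_rfl, by linarith⟩)
  set C₁ := 2 * P.R / (s₀ * s₀) with hC₁
  have hC₁0 : 0 < C₁ := by positivity
  set C₂ := P.β * N * (2 * P.Q) with hC₂
  have hC₂0 : 0 ≤ C₂ := by positivity
  have hx : Tendsto (fun a => P.Q - a) (𝓝[<] P.Q) (𝓝 0) := by
    have : Tendsto (fun a => P.Q - a) (𝓝[<] P.Q) (𝓝 (P.Q - P.Q)) :=
      (Continuous.tendsto (by fun_prop) _).mono_left nhdsWithin_le_nhds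
    rwa [sub_self] at this
  have hx' : ∀ k : ℝ, ∀ ε > 0, ∀ᶠ a in 𝓝[<] P.Q, k * (P.Q - a) < ε := fun k ε hε =>
    (by simpa using hx.const_mul k : Tendsto (fun a => k * (P.Q - a)) (𝓝[<] P.Q)
      (𝓝 0)).eventually (gt_mem_nhds hε)
  filter_upwards [Ioo_mem_nhdsLT ha₁Q, hx' 1 1 one_pos, hx' C₁ 1 one_pos,
    hx' (C₁ * C₂) (P.R / 2) (by positivity), hx' (4 * |C| * C₁) 1 one_pos]
    with a ha hx1 hx2 hx3 hx4 b L hcost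
  obtain ⟨Z, h, rfl⟩ := hcost
  set L := ∫ p in a..b, P.G p (Z p) with hLdef
  set x := P.Q - a with hxdef
  set y := b - P.Q with hydef
  have hx0 : 0 < x := by linarith [ha.2]
  have hab := h.lt.le
  have hy0 : 0 ≤ y := by linarith [h.le_b]
  have hsum := h.add_le
  have ha0 := h.a_pos
  have hne : ∀ p ∈ Icc a b, p ≠ P.σ := fun p hp => (ha₁σ.trans (ha.1.trans_le hp.1)).ne'
  -- `V ≤ R x²` because `Z` decreases, and `|s| ≥ s₀`
  have hg : ∀ p ∈ Icc a b, P.g Z p ≤ P.R * x ^ 2 / (s₀ * s₀) := by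
    intro p hp
    have hp0 := h.pos_of_mem hp
    have hs := s_neg (P := P) (ha₁σ.trans (ha.1.trans_le hp.1)) hp0
    have hV0 := h.nonneg p hp
    have hV1 : P.V p (Z p) ≤ P.R * x ^ 2 := by
      have h1 : P.V p (Z p) ≤ P.V p (Z a) :=
        V_le_V_iff.2 (h.antitoneOn ⟨le_rfl, hab⟩ hp hp.1)
      have h2 := V_sub_V (P := P) p a (Z a)
      rw [h.left, sub_zero] at h2
      have e : (a - p) * (p + a - 2 * P.Q) = x ^ 2 - (p - P.Q) ^ 2 := by rw [hxdef]; ring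
      rw [h2, e] at h1
      nlinarith [sq_nonneg (p - P.Q)]
    have hs1 : s₀ ≤ -P.s p := by
      have e : -P.s p = p * (p - P.σ) := by rw [s]; ring
      rw [e, hs₀]
      have : a₁ ≤ p := ha.1.le.trans hp.1
      exact mul_le_mul this (by linarith) (by linarith) hp0.le
    rw [g_of_ne (hne p hp), G]
    refine div_le_div₀ (by positivity) hV1 (by positivity) ?_
    rw [← neg_mul_neg (P.s p)]
    exact mul_le_mul hs1 (by linarith) hs₀0.le (by linarith)
  have hL0 : 0 ≤ L := by
    rw [hLdef, ← integral_g]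
    exact (h.integral_g_pos h.lt le_rfl).le
  have hL1 : L ≤ C₁ * x ^ 3 := by
    have h1 := intervalIntegral.integral_mono_on hab
      (h.intervalIntegrable_g ⟨le_rfl, hab⟩ ⟨hab, le_rfl⟩)
      (intervalIntegrable_const (c := P.R * x ^ 2 / (s₀ * s₀))) hg
    rw [integral_g, intervalIntegral.integral_const, smul_eq_mul] at h1
    have h2 : b - a ≤ 2 * x := by linarith
    have h3 : (b - a) * (P.R * x ^ 2 / (s₀ * s₀)) ≤ 2 * x * (P.R * x ^ 2 / (s₀ * s₀)) :=
      mul_le_mul_of_nonneg_right h2 (by positivity)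
    have e : 2 * x * (P.R * x ^ 2 / (s₀ * s₀)) = C₁ * x ^ 3 := by rw [hC₁]; ring
    linarith
  have hZ : Z a - Z b ≤ 2 * P.Q * L := by
    rw [← h.integral_mul_g le_rfl hab le_rfl, hLdef, ← integral_g,
      ← intervalIntegral.integral_const_mul]
    refine intervalIntegral.integral_mono_on hab
      ((continuousOn_id.mul h.continuousOn_g).intervalIntegrable_of_Icc hab)
      ((continuousOn_const.mul h.continuousOn_g).intervalIntegrable_of_Icc hab) fun p hp => ?_
    exact mul_le_mul_of_nonneg_right (by linarith [hp.2]) (h.g_nonneg hp)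
  have hZ0 : Z b ≤ Z a := h.antitoneOn ⟨le_rfl, hab⟩ ⟨hab, le_rfl⟩ hab
  -- `κ R (x² - y²) = m a - m b = n a - n b`, and `n` varies by at most a multiple of the cost
  have hxy : P.R * (x ^ 2 - y ^ 2) ≤ C₂ * L := by
    have h1 := V_sub_V (P := P) b a (Z a)
    rw [h.left, sub_zero] at h1
    have e : (a - b) * (b + a - 2 * P.Q) = x ^ 2 - y ^ 2 := by rw [hxdef, hydef]; ring
    rw [e] at h1
    have h2 : P.V b (Z a) - P.V b (Z b) ≤ P.β * N * (Z a - Z b) := by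
      have e0 : P.V b (Z a) - P.V b (Z b) =
          (Real.exp (P.c * Z a) - Real.exp (P.c * Z b)) / P.κ := by rw [V, V]; ring
      have hexp : ∀ t, t ∈ Icc a b → P.V t (Z t) = 0 → Real.exp (P.c * Z t) ≤ N := by
        intro t ht hVt
        have h3 := hN t ⟨(h.pos_of_mem ht).le, by linarith [ht.2]⟩
        rw [exp_eq t, hVt, mul_zero, add_zero]
        exact (le_abs_self _).trans h3
      have hNpos : 0 < N := (Real.exp_pos _).trans_le (hexp a ⟨le_rfl, hab⟩ h.left)
      have hlog : ∀ t, t ∈ Icc a b → P.V t (Z t) = 0 → P.c * Z t ≤ Real.log N := fun t ht hV =>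
        (Real.le_log_iff_exp_le hNpos).2 (hexp t ht hV)
      have h4 := abs_exp_sub_exp_le (hlog a ⟨le_rfl, hab⟩ h.left) (hlog b ⟨hab, le_rfl⟩ h.right)
      rw [Real.exp_log hNpos, ← mul_sub, abs_mul, abs_of_nonneg (sub_nonneg.2 hZ0)] at h4
      refine (le_abs_self _).trans ?_
      rw [e0, abs_div]
      have hβabs : P.β = |P.c| / |P.κ| := by rw [← abs_div, ← β, abs_of_pos hβ]
      rw [hβabs, div_le_iff₀ (abs_pos.2 κ_ne)]
      have e5 : |P.c| / |P.κ| * N * (Z a - Z b) * |P.κ| = N * (|P.c| * (Z a - Z b)) := by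
        field_simp [abs_ne_zero.2 (κ_ne (P := P))]
      rw [e5]; exact h4
    rw [h.right, sub_zero, h1] at h2
    have h3 : P.β * N * (Z a - Z b) ≤ P.β * N * (2 * P.Q * L) :=
      mul_le_mul_of_nonneg_left hZ (by positivity)
    have e6 : P.β * N * (2 * P.Q * L) = C₂ * L := by rw [hC₂]; ring
    linarith
  have hx2' : 0 < x ^ 2 := by positivity
  have hxle : x ^ 3 ≤ x ^ 2 := by nlinarith
  have hL2 : L ≤ 1 := by
    have h1 : C₁ * x ^ 3 ≤ C₁ * x := by
      refine mul_le_mul_of_nonneg_left ?_ hC₁0.le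
      nlinarith
    linarith
  have hyx : x / 2 ≤ y := by
    have h1 : C₂ * L ≤ P.R / 2 * x ^ 2 := by
      have h2 := mul_le_mul_of_nonneg_left hL1 hC₂0
      have h3 := mul_le_mul_of_nonneg_right hx3.le hx2'.le
      have e : C₂ * (C₁ * x ^ 3) = C₁ * C₂ * x * x ^ 2 := by ring
      linarith
    have h3 : x ^ 2 / 2 ≤ y ^ 2 := by
      by_contra! hlt
      have := mul_lt_mul_of_pos_left hlt hR
      linarith
    by_contra! hlt
    have h4 := pow_lt_pow_left₀ hlt hy0 two_ne_zero
    have e : (x / 2) ^ 2 = x ^ 2 / 4 := by ring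
    linarith
  have hexpL : Real.exp L - 1 ≤ 2 * L := by
    have := Real.abs_exp_sub_one_le (x := L) (by rwa [abs_of_nonneg hL0])
    rw [abs_of_nonneg hL0] at this
    exact (le_abs_self _).trans this
  have hexp0 : 0 ≤ Real.exp L - 1 := by linarith [Real.one_le_exp hL0]
  have h1 : C * (Real.exp L - 1) ≤ |C| * (2 * (C₁ * x ^ 3)) :=
    (mul_le_mul_of_nonneg_right (le_abs_self C) hexp0).trans
      (mul_le_mul_of_nonneg_left (by linarith) (abs_nonneg C))
  have h2 : |C| * (2 * (C₁ * x ^ 3)) ≤ |C| * (2 * (C₁ * x ^ 2)) := by gcongr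
  have h3 := mul_lt_mul_of_pos_right hx4 hx0
  have e : 4 * |C| * C₁ * x * x = 2 * (|C| * (2 * (C₁ * x ^ 2))) := by ring
  linarith

end Params
end MertonTC

namespace MertonTC

namespace Params

variable {P : Params} {Z D W : ℝ → ℝ} {a b : ℝ}

/-! ### From smooth solutions to orbits -/

theorem σ_mul_self (P : Params) : P.σ * P.σ = 1 := by
  rcases P.σ_eq with h | h <;> rw [h] <;> norm_num

theorem σ_ne : P.σ ≠ 0 := left_ne_zero_of_mul (by rw [P.σ_mul_self]; exact one_ne_zero)

theorem s_σ (q : ℝ) : P.s (P.σ * q) = q * (1 - q) := by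
  rw [s]; linear_combination (q - q ^ 2) * P.σ_mul_self

theorem V_σ_sub (q r z : ℝ) : P.V (P.σ * q) z - P.V (P.σ * r) z =
    P.R * ((r - q) * (q + r - 2 * (P.σ * P.Q))) := by
  rw [V_sub_V]; linear_combination P.R * (r - q) * (q + r) * P.σ_mul_self

/-- `Z` is the logarithm of a solution of the free-boundary problem on `[a, b]`, in the original
coordinate `q = σ p` and with derivative `D`. No sign condition is imposed on `a` and `b`. -/
structure Smooth (P : Params) (Z D : ℝ → ℝ) (a b : ℝ) : Prop where
  lt : a < b
  deriv : ∀ q ∈ Icc a b, HasDerivWithinAt Z (D q) (Icc a b) q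
  cont : ContinuousOn D (Icc a b)
  ne : ∀ q ∈ Ioo a b, q ≠ 0 → q ≠ 1 → P.V (P.σ * q) (Z q) ≠ q * (1 - q)
  ode : ∀ q ∈ Ioo a b, q ≠ 0 → q ≠ 1 →
    (1 - q) * (q * (1 - q) - P.V (P.σ * q) (Z q)) * D q = -P.V (P.σ * q) (Z q)
  left : P.V (P.σ * a) (Z a) = 0
  right : P.V (P.σ * b) (Z b) = 0
  nonneg : ∀ q ∈ Icc a b, 0 ≤ P.V (P.σ * q) (Z q)
  left_smooth : a ≠ 1 → D a = 0
  right_smooth : D b = 0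

namespace Smooth

theorem continuousOn (h : Smooth P Z D a b) : ContinuousOn Z (Icc a b) :=
  fun q hq => (h.deriv q hq).continuousWithinAt

theorem continuousOn_V (h : Smooth P Z D a b) :
    ContinuousOn (fun q => P.V (P.σ * q) (Z q)) (Icc a b) := by
  have h1 : Continuous fun q => P.M (P.σ * q) :=
    continuous_M.comp (continuous_const.mul continuous_id)
  unfold V
  exact ((Real.continuous_exp.comp_continuousOn (continuousOn_const.mul h.continuousOn)).sub
    h1.continuousOn).div_const _

theorem hasDerivAt (h : Smooth P Z D a b) {q : ℝ} (hq : q ∈ Ioo a b) : HasDerivAt Z (D q) q :=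
  (h.deriv q (Ioo_subset_Icc_self hq)).hasDerivAt (Icc_mem_nhds hq.1 hq.2)

theorem hasDerivWithinAt_V (h : Smooth P Z D a b) {q : ℝ} (hq : q ∈ Icc a b) :
    HasDerivWithinAt (fun q => P.V (P.σ * q) (Z q))
      (P.β * Real.exp (P.c * Z q) * D q + 2 * P.R * (P.σ * P.Q - q)) (Icc a b) q := by
  have h1 := ((h.deriv q hq).const_mul P.c).exp
  have h2 : HasDerivAt (fun q => P.M (P.σ * q)) (P.κ * P.R * (2 * q - 2 * (P.σ * P.Q))) q := by
    have h3 : (fun q => P.M (P.σ * q)) =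
        fun q => 1 + P.κ * P.R * (q * (q - 2 * (P.σ * P.Q))) := by
      funext q; rw [M]; linear_combination P.κ * P.R * q ^ 2 * P.σ_mul_self
    rw [h3]
    have := (((hasDerivAt_id q).mul ((hasDerivAt_id q).sub_const (2 * (P.σ * P.Q)))).const_mul
      (P.κ * P.R)).const_add 1
    exact this.congr_deriv (by simp only [id]; ring)
  refine ((h1.sub h2.hasDerivWithinAt).div_const P.κ).congr_deriv ?_
  rw [β]; field_simp [κ_ne (P := P)]; ring

/-- Above `ℓ` the equation forces `(1 - q) Z' ≥ 1`, which is incompatible with differentiability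
at `q = 1`, and the solution cannot return to `m` before. -/
theorem V_lt (h : Smooth P Z D a b) {x : ℝ} (hx : x ∈ Ioo a b) (h0 : 0 < x) (h1 : x < 1) :
    P.V (P.σ * x) (Z x) < x * (1 - x) := by
  by_contra! hle
  have hc : ContinuousOn (fun q => P.V (P.σ * q) (Z q) - q * (1 - q)) (Icc a b) :=
    h.continuousOn_V.sub (by fun_prop)
  have hzero : ∀ y ∈ Icc x b, y < 1 → P.V (P.σ * y) (Z y) - y * (1 - y) ≤ 0 → y = b ∧
      P.V (P.σ * y) (Z y) - y * (1 - y) = 0 := by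
    intro y hy hy1 hneg
    obtain ⟨r, hr, hr0⟩ := intermediate_value_Icc' hy.1
      (hc.mono (Icc_subset_Icc hx.1.le hy.2)) ⟨hneg, sub_nonneg.2 hle⟩
    have hr0' : P.V (P.σ * r) (Z r) = r * (1 - r) := sub_eq_zero.1 hr0
    have hrb : b ≤ r := by
      by_contra! hrb
      exact h.ne r ⟨hx.1.trans_le hr.1, hrb⟩ (h0.trans_le hr.1).ne' (hr.2.trans_lt hy1).ne hr0'
    obtain rfl : y = b := le_antisymm hy.2 (hrb.trans hr.2)
    obtain rfl : r = y := le_antisymm hr.2 hrb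
    exact ⟨rfl, hr0⟩
  rcases lt_or_ge b 1 with hb | hb
  · have hb0 : 0 < b := h0.trans hx.2
    have hs : 0 < b * (1 - b) := mul_pos hb0 (by linarith)
    have := (hzero b ⟨hx.2.le, le_rfl⟩ hb (by rw [h.right]; linarith)).2
    rw [h.right] at this
    linarith
  · have h1mem : (1 : ℝ) ∈ Icc a b := ⟨(hx.1.trans h1).le, hb⟩
    have ht : Tendsto (fun q => (1 - q) * D q) (𝓝[<] 1) (𝓝 ((1 - 1) * D 1)) := by
      have h2 : ContinuousWithinAt (fun q => (1 - q) * D q) (Icc a b) 1 :=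
        ContinuousWithinAt.mul (by fun_prop) (h.cont 1 h1mem)
      exact h2.mono_left (nhdsWithin_le_of_mem (mem_of_superset (Ioo_mem_nhdsLT (hx.1.trans h1))
        fun y hy => ⟨hy.1.le, hy.2.le.trans hb⟩))
    have hge : (1 : ℝ) ≤ (1 - 1) * D 1 := by
      refine ge_of_tendsto ht ?_
      filter_upwards [Ioo_mem_nhdsLT h1] with y hy
      have hyb : y < b := hy.2.trans_le hb
      have hpos : 0 < P.V (P.σ * y) (Z y) - y * (1 - y) := by
        by_contra! hneg
        exact hyb.ne (hzero y ⟨hy.1.le, hyb.le⟩ hy.2 hneg).1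
      have hy0 : 0 < y := h0.trans hy.1
      have hode := h.ode y ⟨hx.1.trans hy.1, hyb⟩ hy0.ne' hy.2.ne
      have hs : 0 < y * (1 - y) := mul_pos hy0 (by linarith [hy.2])
      have h3 : (P.V (P.σ * y) (Z y) - y * (1 - y)) * ((1 - y) * D y) =
        P.V (P.σ * y) (Z y) := by linarith
      by_contra! hlt
      nlinarith [mul_lt_mul_of_pos_left hlt hpos]
    norm_num at hge

theorem antitoneOn (h : Smooth P Z D a b) {u : ℝ} (hu : a ≤ u) (hu0 : 0 ≤ u) :
    AntitoneOn Z (Icc u b) := by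
  refine antitoneOn_Icc_of_hasDerivAt_nonpos_off 1
    (h.continuousOn.mono (Icc_subset_Icc hu le_rfl))
    (fun q hq _ => h.hasDerivAt ⟨hu.trans_lt hq.1, hq.2⟩) fun q hq hq1 => ?_
  have hqm : q ∈ Ioo a b := ⟨hu.trans_lt hq.1, hq.2⟩
  have hq0 : 0 < q := hu0.trans_lt hq.1
  have hV := h.nonneg q (Ioo_subset_Icc_self hqm)
  have hode := h.ode q hqm hq0.ne' hq1
  have hpos : 0 < (1 - q) * (q * (1 - q) - P.V (P.σ * q) (Z q)) := by
    rcases lt_or_gt_of_ne hq1 with h1 | h1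
    · exact mul_pos (by linarith) (by linarith [h.V_lt hqm hq0 h1])
    · have := mul_pos hq0 (sub_pos.2 h1)
      exact mul_pos_of_neg_of_neg (by linarith) (by linarith)
  by_contra! hD
  linarith [mul_pos hpos hD]

theorem monotoneOn (h : Smooth P Z D a b) {v : ℝ} (hv : v ≤ b) (hv0 : v ≤ 0) :
    MonotoneOn Z (Icc a v) := by
  refine monotoneOn_Icc_of_hasDerivAt_nonneg (f' := D)
    (h.continuousOn.mono (Icc_subset_Icc le_rfl hv))
    (fun q hq => h.hasDerivAt ⟨hq.1, hq.2.trans_le hv⟩) fun q hq => ?_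
  have hqm : q ∈ Ioo a b := ⟨hq.1, hq.2.trans_le hv⟩
  have hq0 : q < 0 := hq.2.trans_le hv0
  have hV := h.nonneg q (Ioo_subset_Icc_self hqm)
  have hode := h.ode q hqm hq0.ne (by linarith)
  have hs := mul_neg_of_neg_of_pos hq0 (by linarith : 0 < 1 - q)
  have hneg : (1 - q) * (q * (1 - q) - P.V (P.σ * q) (Z q)) < 0 :=
    mul_neg_of_pos_of_neg (by linarith) (by linarith)
  by_contra! hD
  linarith [mul_pos_of_neg_of_neg hneg hD]

theorem not_zero_mem_Ioo (h : Smooth P Z D a b) : ¬(a < 0 ∧ 0 < b) := by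
  rintro ⟨ha, hb⟩
  have hR := P.R_pos
  have hQ := P.Q_pos
  have h0 : (0 : ℝ) ∈ Ioo a b := ⟨ha, hb⟩
  -- the maximum of `Z` sits at `0`, and one of the two ends forces `V > 0 = s` there
  have hpos : 0 < P.V (P.σ * 0) (Z 0) := by
    rcases P.σ_eq with hσ | hσ
    · have hZ : Z a ≤ Z 0 := h.monotoneOn hb.le le_rfl ⟨le_rfl, ha.le⟩ ⟨ha.le, le_rfl⟩ ha.le
      refine lt_of_lt_of_le ?_ ((V_le_V_iff (P := P)).2 hZ)
      have h1 := V_σ_sub (P := P) 0 a (Z a)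
      rw [h.left, sub_zero] at h1
      rw [h1, hσ]
      exact mul_pos hR (mul_pos_of_neg_of_neg (by linarith) (by linarith))
    · have hZ : Z b ≤ Z 0 := h.antitoneOn ha.le le_rfl ⟨le_rfl, hb.le⟩ ⟨hb.le, le_rfl⟩ hb.le
      refine lt_of_lt_of_le ?_ ((V_le_V_iff (P := P)).2 hZ)
      have h1 := V_σ_sub (P := P) 0 b (Z b)
      rw [h.right, sub_zero] at h1
      rw [h1, hσ]
      exact mul_pos hR (mul_pos (by linarith) (by linarith))
  have hc : ContinuousAt (fun q => P.V (P.σ * q) (Z q) - q * (1 - q)) 0 :=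
    (h.continuousOn_V.continuousAt (Icc_mem_nhds ha hb)).sub (by fun_prop)
  have hev : ∀ᶠ q in 𝓝 (0 : ℝ), 0 < P.V (P.σ * q) (Z q) - q * (1 - q) :=
    hc.eventually (lt_mem_nhds (by simpa using hpos))
  have hev2 : ∀ᶠ q in 𝓝[>] (0 : ℝ), 0 < P.V (P.σ * q) (Z q) - q * (1 - q) ∧
      q ∈ Ioo 0 (min b 1) :=
    (hev.filter_mono nhdsWithin_le_nhds).and (Ioo_mem_nhdsGT (lt_min hb one_pos))
  obtain ⟨q, hq, hq0, hq1⟩ := hev2.exists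
  have := h.V_lt ⟨ha.trans hq0, hq1.trans_le (min_le_left _ _)⟩ hq0
    (hq1.trans_le (min_le_right _ _))
  linarith

/-- An end point at `0` is excluded by smooth fit: the equation divided by `q` would give
`V'(0) = 0`. -/
theorem not_fit_zero (h : Smooth P Z D a b) (h0 : (0 : ℝ) ∈ Icc a b)
    (hne : (𝓝[Ioo a b \ {0}] (0 : ℝ)).NeBot) (hD : D 0 = 0)
    (hV : P.V (P.σ * 0) (Z 0) = 0) : False := by
  have hsub : Ioo a b \ {0} ⊆ Icc a b := fun q hq => Ioo_subset_Icc_self hq.1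
  have hslope : Tendsto (fun q => P.V (P.σ * q) (Z q) / q) (𝓝[Ioo a b \ {0}] 0)
      (𝓝 (2 * P.R * (P.σ * P.Q))) := by
    have h2 := (h.hasDerivWithinAt_V h0).mono_of_mem_nhdsWithin
      (mem_of_superset self_mem_nhdsWithin hsub : Icc a b ∈ 𝓝[Ioo a b \ {0}] 0)
    rw [hasDerivWithinAt_iff_tendsto_slope] at h2
    rw [hD, mul_zero, zero_add, sub_zero, sdiff_idem] at h2
    refine h2.congr fun q => ?_
    rw [slope_def_field, hV]; simp
  have hDt : Tendsto D (𝓝[Ioo a b \ {0}] 0) (𝓝 0) := by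
    have := (h.cont 0 h0).mono hsub
    rw [ContinuousWithinAt, hD] at this
    exact this
  have hid : Tendsto (fun q : ℝ => 1 - q) (𝓝[Ioo a b \ {0}] 0) (𝓝 (1 - 0)) :=
    (continuousAt_const.sub continuousAt_id).tendsto.mono_left nhdsWithin_le_nhds
  have hl : Tendsto (fun q => -((1 - q) * ((1 - q) - P.V (P.σ * q) (Z q) / q) * D q))
      (𝓝[Ioo a b \ {0}] 0) (𝓝 (-((1 - 0) * ((1 - 0) - 2 * P.R * (P.σ * P.Q)) * 0))) :=
    ((hid.mul (hid.sub hslope)).mul hDt).neg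
  have heq : (fun q => -((1 - q) * ((1 - q) - P.V (P.σ * q) (Z q) / q) * D q))
      =ᶠ[𝓝[Ioo a b \ {0}] 0] fun q => P.V (P.σ * q) (Z q) / q := by
    have hlt1 : ∀ᶠ q in 𝓝[Ioo a b \ {0}] (0 : ℝ), q < 1 :=
      (gt_mem_nhds one_pos).filter_mono nhdsWithin_le_nhds
    filter_upwards [self_mem_nhdsWithin, hlt1] with q hq hq1
    have hq0 : q ≠ 0 := hq.2
    have := h.ode q hq.1 hq0 hq1.ne
    have hw : P.V (P.σ * q) (Z q) = P.V (P.σ * q) (Z q) / q * q := (div_mul_cancel₀ _ hq0).symm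
    apply mul_right_cancel₀ hq0
    rw [← hw]
    generalize P.V (P.σ * q) (Z q) / q = w at hw ⊢
    rw [hw] at this ⊢
    linarith
  have := tendsto_nhds_unique (hl.congr' heq) hslope
  rw [mul_zero, neg_zero] at this
  exact (mul_ne_zero (mul_pos two_pos P.R_pos).ne' (mul_ne_zero σ_ne P.Q_pos.ne')) this.symm

theorem a_pos (h : Smooth P Z D a b) (hσ : P.σ = 1) : 0 < a := by
  have hR := P.R_pos
  have hQ := P.Q_pos
  by_contra! ha
  rcases eq_or_lt_of_le ha with rfl | ha
  · refine h.not_fit_zero ⟨le_rfl, h.lt.le⟩ ?_ (h.left_smooth zero_ne_one) h.left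
    rw [sdiff_singleton_eq_self (by simp)]; exact left_nhdsWithin_Ioo_neBot h.lt
  · rcases lt_or_ge 0 b with hb | hb
    · exact h.not_zero_mem_Ioo ⟨ha, hb⟩
    · have hZ := h.monotoneOn le_rfl hb ⟨le_rfl, h.lt.le⟩ ⟨h.lt.le, le_rfl⟩ h.lt.le
      have h1 := (V_le_V_iff (P := P) (p := P.σ * b)).2 hZ
      have h2 := V_σ_sub (P := P) b a (Z a)
      rw [h.left, sub_zero, hσ] at h2
      rw [h.right, hσ, h2] at h1
      have := mul_pos hR (mul_pos_of_neg_of_neg (by linarith [h.lt] : a - b < 0)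
        (by linarith : b + a - 2 * (1 * P.Q) < 0))
      linarith

theorem b_neg (h : Smooth P Z D a b) (hσ : P.σ = -1) : b < 0 := by
  have hR := P.R_pos
  have hQ := P.Q_pos
  by_contra! hb
  rcases eq_or_lt_of_le hb with rfl | hb
  · refine h.not_fit_zero ⟨h.lt.le, le_rfl⟩ ?_ h.right_smooth h.right
    rw [sdiff_singleton_eq_self (by simp)]; exact right_nhdsWithin_Ioo_neBot h.lt
  · rcases lt_or_ge a 0 with ha | ha
    · exact h.not_zero_mem_Ioo ⟨ha, hb⟩
    · have hZ := h.antitoneOn le_rfl ha ⟨le_rfl, h.lt.le⟩ ⟨h.lt.le, le_rfl⟩ h.lt.le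
      have h1 := (V_le_V_iff (P := P) (p := P.σ * a)).2 hZ
      have h2 := V_σ_sub (P := P) a b (Z b)
      rw [h.right, sub_zero, hσ] at h2
      rw [h.left, hσ, h2] at h1
      have := mul_pos hR (mul_pos (by linarith [h.lt] : 0 < b - a)
        (by linarith : 0 < a + b - 2 * (-1 * P.Q)))
      linarith

/-- Smooth fit at the end nearer to infinity puts it beyond the turning point of `m`. -/
theorem Q_le_b (h : Smooth P Z D a b) : P.σ * P.Q ≤ b := by
  by_contra! hlt
  have hd := h.hasDerivWithinAt_V (q := b) ⟨h.lt.le, le_rfl⟩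
  rw [h.right_smooth, mul_zero, zero_add] at hd
  have h1 : 2 * P.R * (P.σ * P.Q - b) ≤ 0 := by
    have := right_nhdsWithin_Ioo_neBot h.lt
    refine le_of_tendsto (x := 𝓝[Ioo a b] b) ((hasDerivWithinAt_iff_tendsto_slope.1 hd).mono_left
      (nhdsWithin_mono b fun q hq => ⟨Ioo_subset_Icc_self hq, hq.2.ne⟩)) ?_
    filter_upwards [self_mem_nhdsWithin] with q hq
    rw [slope_def_field, h.right, sub_zero]
    exact div_nonpos_of_nonneg_of_nonpos (h.nonneg q (Ioo_subset_Icc_self hq))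
        (by linarith [hq.2])
  have := mul_pos (mul_pos two_pos P.R_pos) (sub_pos.2 hlt)
  linarith

theorem a_le_Q (h : Smooth P Z D a b) (ha : a ≠ 1) : a ≤ P.σ * P.Q := by
  by_contra! hlt
  have hd := h.hasDerivWithinAt_V (q := a) ⟨le_rfl, h.lt.le⟩
  rw [h.left_smooth ha, mul_zero, zero_add] at hd
  have h1 : 0 ≤ 2 * P.R * (P.σ * P.Q - a) := by
    have := left_nhdsWithin_Ioo_neBot h.lt
    refine ge_of_tendsto (x := 𝓝[Ioo a b] a) ((hasDerivWithinAt_iff_tendsto_slope.1 hd).mono_left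
      (nhdsWithin_mono a fun q hq => ⟨Ioo_subset_Icc_self hq, hq.1.ne'⟩)) ?_
    filter_upwards [self_mem_nhdsWithin] with q hq
    rw [slope_def_field, h.left, sub_zero]
    exact div_nonneg (h.nonneg q (Ioo_subset_Icc_self hq)) (by linarith [hq.1])
  have := mul_pos (mul_pos two_pos P.R_pos) (sub_pos.2 hlt)
  linarith

/-- A smooth solution, read in the coordinate `p = σ q`. -/
theorem toFB (h : Smooth P Z D a b) {u v : ℝ}
    (huv : P.σ = 1 ∧ u = a ∧ v = b ∨ P.σ = -1 ∧ u = -b ∧ v = -a) :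
    FB P (fun p => Z (P.σ * p)) u v := by
  have hσσ := P.σ_mul_self
  have hIcc : ∀ p ∈ Icc u v, P.σ * p ∈ Icc a b := by
    rintro p ⟨h1, h2⟩
    rcases huv with ⟨hσ, rfl, rfl⟩ | ⟨hσ, rfl, rfl⟩ <;> rw [hσ] <;> constructor <;> linarith
  have hIoo : ∀ p ∈ Ioo u v, P.σ * p ∈ Ioo a b := by
    rintro p ⟨h1, h2⟩
    rcases huv with ⟨hσ, rfl, rfl⟩ | ⟨hσ, rfl, rfl⟩ <;> rw [hσ] <;> constructor <;> linarith
  have hu : 0 < u := by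
    rcases huv with ⟨hσ, rfl, rfl⟩ | ⟨hσ, rfl, rfl⟩
    · exact h.a_pos hσ
    · linarith [h.b_neg hσ]
  have hback : ∀ p, P.σ * (P.σ * p) = p := fun p => by rw [← mul_assoc, hσσ, one_mul]
  have hVp : ∀ p, P.V (P.σ * (P.σ * p)) (Z (P.σ * p)) = P.V p (Z (P.σ * p)) := fun p => by
    rw [hback]
  refine ⟨⟨hu, ?_, fun p hp hpσ => ?_, fun p hp => ?_, fun p hp hs => ?_⟩, ?_, ?_, ?_, ?_⟩
  · exact h.continuousOn.comp (continuous_const.mul continuous_id).continuousOn hIcc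
  · have hp0 : p ≠ 0 := (hu.trans hp.1).ne'
    have hq0 : P.σ * p ≠ 0 := mul_ne_zero σ_ne hp0
    have hq1 : P.σ * p ≠ 1 := fun h1 => hpσ (by rw [← hback p, h1, mul_one])
    have hode := h.ode _ (hIoo p hp) hq0 hq1
    have hne := h.ne _ (hIoo p hp) hq0 hq1
    have hd := (h.hasDerivAt (hIoo p hp)).comp p ((hasDerivAt_id p).const_mul P.σ)
    refine hd.congr_deriv ?_
    rw [hVp, ← s_σ, hback] at hode hne
    have hs : P.σ - p ≠ 0 := sub_ne_zero.2 hpσ.symm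
    have hsV : P.s p - P.V p (Z (P.σ * p)) ≠ 0 := sub_ne_zero.2 hne.symm
    have h3 : p * P.G p (Z (P.σ * p)) =
        P.V p (Z (P.σ * p)) / ((P.σ - p) * (P.s p - P.V p (Z (P.σ * p)))) := by
      rw [G, ← mul_div_assoc, show P.s p * (P.s p - P.V p (Z (P.σ * p))) =
        p * ((P.σ - p) * (P.s p - P.V p (Z (P.σ * p)))) by rw [s]; ring, mul_div_mul_left _ _ hp0]
    rw [h3, ← neg_div, eq_div_iff (mul_ne_zero hs hsV), ← hode]
    linear_combination
      D (P.σ * p) * (P.s p - P.V p (Z (P.σ * p))) * hσσ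
  · have := h.nonneg _ (hIcc p hp); rwa [hVp] at this
  · obtain ⟨hσ, hp1⟩ := (s_pos_iff (hu.trans hp.1)).1 hs
    have hp0 := hu.trans hp.1
    have := h.V_lt (hIoo p hp) (by rw [hσ]; linarith) (by rw [hσ]; linarith)
    rwa [hVp, ← s_σ, hback] at this
  · rcases huv with ⟨hσ, rfl, rfl⟩ | ⟨hσ, rfl, rfl⟩ <;> linarith [h.lt]
  · rcases huv with ⟨hσ, rfl, rfl⟩ | ⟨hσ, rfl, rfl⟩
    · have := h.left; simpa [hσ] using this
    · have := h.right; simpa [hσ] using this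
  · rcases huv with ⟨hσ, rfl, rfl⟩ | ⟨hσ, rfl, rfl⟩
    · have := h.right; simpa [hσ] using this
    · have := h.left; simpa [hσ] using this
  · rcases huv with ⟨hσ, rfl, rfl⟩ | ⟨hσ, rfl, rfl⟩
    · have := h.Q_le_b; rwa [hσ, one_mul] at this
    · have := h.a_le_Q (by linarith [h.b_neg hσ, h.lt]); rw [hσ] at this; linarith

end Smooth

end Params

end MertonTC

namespace MertonTC

namespace Params

variable {P : Params} {Z D W : ℝ → ℝ} {a b : ℝ}

/-! ### The reduced problem and the original one -/

theorem FB.g_eq_zero (hV : P.V a (Z a) = 0) (ha : a ≠ P.σ) : P.g Z a = 0 := by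
  rw [g_of_ne ha, G, hV, zero_div]

/-- Smooth fit at the upper end: the cost integrand vanishes there, even at the singular point,
because then `Q = 1`. -/
theorem FB.g_right (h : FB P Z a b) : P.g Z b = 0 := by
  rcases eq_or_ne b P.σ with hb | hb
  · have hσ := h.σ_eq_one (hb ▸ ⟨h.lt.le, le_rfl⟩)
    have hb1 : b = 1 := hb.trans hσ
    have hQ : P.Q = 1 := by
      refine le_antisymm (hb1 ▸ h.le_b) (not_lt.1 fun hQ => ?_)
      linarith [h.b_lt_one hσ hQ]
    rw [g, if_pos hb, gOne, hQ, sub_self, mul_zero, zero_div]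
  · exact FB.g_eq_zero h.right hb

/-- `P` is the reduced form of the problem with parameters `ε`, `δ`, `R`. -/
structure Models (P : Params) (ε δ R : ℝ) : Prop where
  R_eq : P.R = R
  κ_eq : P.κ = δ ^ 2 / 2 * (1 - R)
  ε_eq : ε = P.σ * (δ ^ 2 * R * P.Q)

variable {ε δ R ξ u v : ℝ} {n : ℝ → ℝ}

theorem exists_models (hε : ε ≠ 0) (hδ : 0 < δ) (hR : 0 < R) (hR1 : R ≠ 1) :
    ∃ P : Params, P.Models ε δ R ∧ P.Q = |ε| / (δ ^ 2 * R) ∧ (P.σ = 1 ↔ 0 < ε) := by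
  have hd : 0 < δ ^ 2 * R := by positivity
  have hκ : 0 < δ ^ 2 / 2 * (1 - R) * (1 - R) := by
    have := mul_self_pos.2 (sub_ne_zero.2 hR1.symm)
    rw [mul_assoc]; positivity
  refine ⟨⟨R, δ ^ 2 / 2 * (1 - R), |ε| / (δ ^ 2 * R), if 0 < ε then 1 else -1, hR, hκ,
    div_pos (abs_pos.2 hε) hd, by split_ifs <;> simp⟩, ⟨rfl, rfl, ?_⟩, rfl, ?_⟩
  · simp only
    rw [mul_div_cancel₀ _ hd.ne']
    split_ifs with h
    · rw [one_mul, abs_of_pos h]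
    · rw [neg_one_mul, abs_of_nonpos (not_lt.1 h), neg_neg]
  · simp only
    split_ifs with h <;> norm_num [h]

namespace Models

theorem m_eq (h : P.Models ε δ R) (q : ℝ) : m ε δ R q = P.M (P.σ * q) := by
  rw [m, M, h.κ_eq, h.R_eq, h.ε_eq]
  linear_combination (-δ ^ 2 / 2 * (1 - R) * R * q ^ 2) * P.σ_mul_self

theorem ell_eq (h : P.Models ε δ R) (q : ℝ) :
    ell ε δ R q = P.M (P.σ * q) + P.κ * (q * (1 - q)) := by
  rw [ell, h.m_eq, h.κ_eq]; ring

theorem c_eq (h : P.Models ε δ R) : (1 - R) / R = P.c := by rw [c, h.R_eq]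

theorem costIntegrand_eq (h : P.Models ε δ R) {q z : ℝ} (hn : n q = Real.exp (P.c * z)) :
    costIntegrand ε δ R n q = P.G (P.σ * q) z := by
  rw [costIntegrand, h.m_eq, h.ell_eq, hn, exp_eq (P.σ * q) z, G, s_σ, add_sub_cancel_left,
    show P.M (P.σ * q) + P.κ * (q * (1 - q)) - (P.M (P.σ * q) + P.κ * P.V (P.σ * q) z) =
      P.κ * (q * (1 - q) - P.V (P.σ * q) z) by ring, mul_div_mul_left _ _ κ_ne, div_mul_div_comm,
    one_mul]

theorem slope_eq (h : P.Models ε δ R) (q z : ℝ) :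
    slope ε δ R q (Real.exp (P.c * z)) = Real.exp (P.c * z) * (P.c *
      (-P.V (P.σ * q) z / ((1 - q) * (q * (1 - q) - P.V (P.σ * q) z)))) := by
  rw [slope, h.m_eq, h.ell_eq, h.c_eq]
  nth_rw 2 3 [exp_eq (P.σ * q) z]
  rw [show P.M (P.σ * q) + P.κ * (q * (1 - q)) - (P.M (P.σ * q) + P.κ * P.V (P.σ * q) z) =
      P.κ * (q * (1 - q) - P.V (P.σ * q) z) by ring, sub_add_cancel_left, ← mul_neg,
    mul_div_mul_left _ _ κ_ne, ← div_div]
  ring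

/-- The logarithm of a solution of the original problem, in the original coordinate. -/
theorem smooth (h : P.Models ε δ R) (hn : SolvesFBP ε δ R n a b) :
    Smooth P (fun q => Real.log (n q) / P.c)
      (fun q => derivWithin n (Icc a b) q / n q / P.c) a b := by
  have hexp : ∀ q ∈ Icc a b, n q = Real.exp (P.c * (Real.log (n q) / P.c)) := fun q hq => by
    rw [mul_div_cancel₀ _ c_ne, Real.exp_log (hn.pos q hq)]
  have hu : UniqueDiffOn ℝ (Icc a b) := uniqueDiffOn_Icc hn.lt
  have hder : ∀ q ∈ Icc a b, HasDerivWithinAt n (derivWithin n (Icc a b) q) (Icc a b) q :=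
    fun q hq => (hn.contDiffOn.differentiableOn one_ne_zero q hq).hasDerivWithinAt
  have hderc : ContinuousOn (derivWithin n (Icc a b)) (Icc a b) :=
    hn.contDiffOn.continuousOn_derivWithin hu le_rfl
  have hV : ∀ q ∈ Icc a b, n q = m ε δ R q + P.κ * P.V (P.σ * q) (Real.log (n q) / P.c) :=
    fun q hq => by rw [h.m_eq, ← exp_eq, ← hexp q hq]
  have hκR : 0 < P.κ * (1 - R) := h.R_eq ▸ P.κ_mul_pos
  have hma : a ∈ Icc a b := ⟨le_rfl, hn.lt.le⟩
  have hmb : b ∈ Icc a b := ⟨hn.lt.le, le_rfl⟩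
  have hzero : ∀ q ∈ Icc a b, n q = m ε δ R q →
      P.V (P.σ * q) (Real.log (n q) / P.c) = 0 := fun q hq he => by
    have := hV q hq
    rw [← he] at this
    exact (mul_eq_zero.1 (left_eq_add.1 this)).resolve_left κ_ne
  have hne : ∀ q ∈ Ioo a b, q ≠ 0 → q ≠ 1 →
      P.V (P.σ * q) (Real.log (n q) / P.c) ≠ q * (1 - q) := fun q hq h0 h1 he => by
    have hq' := Ioo_subset_Icc_self hq
    refine hn.ne_ell q hq h0 h1 ?_
    rw [h.ell_eq, hV q hq', he, h.m_eq]
  refine ⟨hn.lt, fun q hq => ((hder q hq).log (hn.pos q hq).ne').div_const _,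
    (hderc.div hn.contDiffOn.continuousOn fun q hq => (hn.pos q hq).ne').div_const _,
    hne, fun q hq h0 h1 => ?_,
    hzero a hma hn.left_eq, hzero b hmb hn.right_eq, fun q hq => ?_, fun ha => ?_, ?_⟩
  · have hq' := Ioo_subset_Icc_self hq
    have hpos := hn.pos q hq'
    have hd := (hn.ode q hq h0 h1).hasDerivWithinAt.derivWithin (hu q hq')
    have hsl := h.slope_eq q (Real.log (n q) / P.c)
    rw [← hexp q hq'] at hsl
    have h1' : (1 - q) * (q * (1 - q) - P.V (P.σ * q) (Real.log (n q) / P.c)) ≠ 0 :=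
      mul_ne_zero (sub_ne_zero.2 h1.symm) (sub_ne_zero.2 (hne q hq h0 h1).symm)
    rw [hd, hsl, mul_div_cancel_left₀ _ hpos.ne', mul_div_cancel_left₀ _ c_ne,
      mul_div_cancel₀ _ h1']
  · have h1 := hn.no_crossing q hq
    rw [hV q hq, mul_add, le_add_iff_nonneg_right, ← mul_assoc, mul_comm (1 - R)] at h1
    exact nonneg_of_mul_nonneg_right h1 hκR
  · rw [(hn.left_smooth ha).derivWithin (hu a hma), zero_div, zero_div]
  · rw [hn.right_smooth.derivWithin (hu b hmb), zero_div, zero_div]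

/-- A solution of the reduced problem gives one of the original problem. -/
theorem solvesFBP (h : P.Models ε δ R) (hZ : FB P Z u v)
    (huv : P.σ = 1 ∧ u = a ∧ v = b ∨ P.σ = -1 ∧ u = -b ∧ v = -a) :
    SolvesFBP ε δ R (fun q => Real.exp (P.c * Z (P.σ * q))) a b := by
  have hab : a < b := by
    rcases huv with ⟨-, rfl, rfl⟩ | ⟨-, rfl, rfl⟩ <;> linarith [hZ.lt]
  have hσσ := P.σ_mul_self
  have hback : ∀ q, P.σ * (P.σ * q) = q := fun q => by rw [← mul_assoc, hσσ, one_mul]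
  have hIcc : MapsTo (fun q => P.σ * q) (Icc a b) (Icc u v) := by
    rintro q ⟨h1, h2⟩
    rcases huv with ⟨hσ, rfl, rfl⟩ | ⟨hσ, rfl, rfl⟩ <;> simp only [hσ] <;> constructor <;> linarith
  have hIoo : MapsTo (fun q => P.σ * q) (Ioo a b) (Ioo u v) := by
    rintro q ⟨h1, h2⟩
    rcases huv with ⟨hσ, rfl, rfl⟩ | ⟨hσ, rfl, rfl⟩ <;> simp only [hσ] <;> constructor <;> linarith
  have hder : ∀ q ∈ Icc a b, HasDerivWithinAt (fun q => Real.exp (P.c * Z (P.σ * q)))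
      (Real.exp (P.c * Z (P.σ * q)) * (P.c * -(q * P.g Z (P.σ * q)))) (Icc a b) q := by
    intro q hq
    have h1 := (hZ.hasDerivWithinAt (hIcc hq)).comp q
      (((hasDerivAt_id q).const_mul P.σ).hasDerivWithinAt (s := Icc a b)) hIcc
    refine ((h1.const_mul P.c).exp).congr_deriv ?_
    simp only [Function.comp_apply]
    linear_combination (-Real.exp (P.c * Z (P.σ * q)) * P.c * q * P.g Z (P.σ * q)) * hσσ
  have hcont : Continuous fun q => P.σ * q := continuous_const.mul continuous_id
  have hcd : ContinuousOn (fun q => Real.exp (P.c * Z (P.σ * q)) *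
      (P.c * -(q * P.g Z (P.σ * q)))) (Icc a b) := by
    have h1 : ContinuousOn (fun q => Z (P.σ * q)) (Icc a b) :=
      hZ.cont.comp hcont.continuousOn hIcc
    have h2 : ContinuousOn (fun q => P.g Z (P.σ * q)) (Icc a b) :=
      hZ.continuousOn_g.comp hcont.continuousOn hIcc
    exact (Real.continuous_exp.comp_continuousOn (continuousOn_const.mul h1)).mul
      (continuousOn_const.mul (continuousOn_id.mul h2).neg)
  have hu : UniqueDiffOn ℝ (Icc a b) := uniqueDiffOn_Icc hab
  have hma : a ∈ Icc a b := ⟨le_rfl, hab.le⟩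
  have hmb : b ∈ Icc a b := ⟨hab.le, le_rfl⟩
  have heq : ∀ q, P.V (P.σ * q) (Z (P.σ * q)) = 0 →
      Real.exp (P.c * Z (P.σ * q)) = m ε δ R q := fun q hq => by
    rw [exp_eq (P.σ * q), hq, h.m_eq, mul_zero, add_zero]
  have hVa : P.V (P.σ * a) (Z (P.σ * a)) = 0 := by
    rcases huv with ⟨hσ, rfl, rfl⟩ | ⟨hσ, rfl, rfl⟩
    · simpa [hσ] using hZ.left
    · simpa [hσ] using hZ.right
  have hVb : P.V (P.σ * b) (Z (P.σ * b)) = 0 := by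
    rcases huv with ⟨hσ, rfl, rfl⟩ | ⟨hσ, rfl, rfl⟩
    · simpa [hσ] using hZ.right
    · simpa [hσ] using hZ.left
  have hneσ : ∀ q : ℝ, q ≠ 1 → P.σ * q ≠ P.σ := fun q hq he =>
    hq (mul_left_cancel₀ σ_ne (he.trans (mul_one _).symm))
  have hne : ∀ q ∈ Icc a b, q ≠ 1 → q ≠ 0 ∧ q * (1 - q) - P.V (P.σ * q) (Z (P.σ * q)) ≠ 0 := by
    intro q hq hq1
    have hd := (hZ.denom_pos (hIcc hq) (hneσ q hq1)).ne'
    simp only [s_σ] at hd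
    exact ⟨left_ne_zero_of_mul (left_ne_zero_of_mul hd), right_ne_zero_of_mul hd⟩
  refine ⟨hab, ?_, fun q _ => Real.exp_pos _, fun q hq h0 h1 he => ?_, fun q hq h0 h1 => ?_,
    heq a hVa, heq b hVb, fun q hq => ?_, fun ha => ?_, ?_⟩
  · refine (contDiffOn_one_iff_derivWithin hu).2
      ⟨fun q hq => (hder q hq).differentiableWithinAt, ?_⟩
    exact hcd.congr fun q hq => (hder q hq).derivWithin (hu q hq)
  · refine (hne q (Ioo_subset_Icc_self hq) h1).2 ?_
    rw [h.ell_eq, exp_eq (P.σ * q)] at he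
    have := mul_left_cancel₀ κ_ne (add_left_cancel he)
    rw [this, sub_self]
  · have hq' := Ioo_subset_Icc_self hq
    refine ((hder q hq').hasDerivAt (Icc_mem_nhds hq.1 hq.2)).congr_deriv ?_
    have h2 := (hne q hq' h1).2
    have h3 : 1 - q ≠ 0 := sub_ne_zero.2 h1.symm
    rw [h.slope_eq, g_of_ne (hneσ q h1), G, s_σ]
    congr 2
    field_simp
  · have h1 := hZ.nonneg _ (hIcc hq)
    have h2 : 0 < P.κ * (1 - R) := h.R_eq ▸ P.κ_mul_pos
    have h3 := mul_nonneg h2.le h1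
    simp only at h3 ⊢
    rw [h.m_eq, exp_eq (P.σ * q)]
    linarith
  · have h1 := hder a hma
    rwa [FB.g_eq_zero hVa (hneσ a ha), mul_zero, neg_zero, mul_zero, mul_zero] at h1
  · have h1 := hder b hmb
    have h2 : P.g Z (P.σ * b) = 0 := by
      rcases huv with ⟨hσ, rfl, rfl⟩ | ⟨hσ, rfl, rfl⟩
      · simpa [hσ] using hZ.g_right
      · refine FB.g_eq_zero hVb (hneσ b ?_)
        linarith [hZ.a_pos]
    rwa [h2, mul_zero, neg_zero, mul_zero, mul_zero] at h1

/-- The free boundaries in terms of the reduced problem. -/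
theorem isFreeBoundary_iff (h : P.Models ε δ R)
    (huv : P.σ = 1 ∧ u = a ∧ v = b ∨ P.σ = -1 ∧ u = -b ∧ v = -a) :
    IsFreeBoundary ε δ R ξ a b ↔ 0 < ξ ∧ P.Cost u v (Real.log (1 + ξ)) := by
  have hback : ∀ p, P.σ * (P.σ * p) = p := fun p => by rw [← mul_assoc, P.σ_mul_self, one_mul]
  have hint : ∀ f : ℝ → ℝ, ∫ q in a..b, f (P.σ * q) = ∫ p in u..v, f p := by
    intro f
    rcases huv with ⟨hσ, rfl, rfl⟩ | ⟨hσ, rfl, rfl⟩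
    · simp [hσ]
    · simp [hσ]
  refine and_congr_right fun hξ => ⟨?_, ?_⟩
  · rintro ⟨n, hn, -, hL⟩
    have hs := h.smooth hn
    refine ⟨_, hs.toFB huv, ?_⟩
    rw [← hL, ← hint]
    refine intervalIntegral.integral_congr fun q hq => ?_
    rw [uIcc_of_le hn.lt.le] at hq
    simp only [hback]
    refine (h.costIntegrand_eq ?_).symm
    rw [mul_div_cancel₀ _ c_ne, Real.exp_log (hn.pos q hq)]
  · rintro ⟨Z, hZ, hL⟩
    have he : costIntegrand ε δ R (fun q => Real.exp (P.c * Z (P.σ * q))) =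
        fun q => P.G (P.σ * q) (Z (P.σ * q)) := funext fun q => h.costIntegrand_eq rfl
    refine ⟨_, h.solvesFBP hZ huv, ?_, ?_⟩
    · rw [he]
      have h1 := hZ.intervalIntegrable_G
      rcases huv with ⟨hσ, rfl, rfl⟩ | ⟨hσ, rfl, rfl⟩
      · simpa [hσ] using h1
      · have := (IntervalIntegrable.iff_comp_neg (by simp) |>.1 h1).symm
        simpa [hσ] using this
    · rw [he, ← hL]
      exact hint fun p => P.G p (Z p)

end Models

end Params

end MertonTC

namespace MertonTC

namespace Params

variable {P : Params} {Z D W : ℝ → ℝ} {a b : ℝ}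

/-! ### Well-posedness -/

variable {ε δ R ξ L : ℝ}

theorem M_Q : P.M P.Q = 1 - P.κ * P.R * P.Q ^ 2 := by rw [M]; ring

theorem M_eq_add_sq (p : ℝ) : P.M p = P.M P.Q + P.κ * P.R * (p - P.Q) ^ 2 := by rw [M, M]; ring

theorem M_Q_pos_of_neg (hκ : P.κ < 0) : 0 < P.M P.Q := by
  have := mul_pos (mul_pos (neg_pos.2 hκ) P.R_pos) (pow_pos P.Q_pos 2)
  rw [M_Q]; linarith

theorem M_pos_of_lt_Q (hM : 0 ≤ P.M P.Q) (h0 : 0 < a) (hQ : a < P.Q) : 0 < P.M a := by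
  rcases P.sign_cases with ⟨hκ, -⟩ | ⟨hκ, -⟩
  · rw [M_eq_add_sq]
    have := mul_pos (mul_pos hκ P.R_pos) (pow_pos (sub_pos.2 hQ) 2)
    rw [← neg_sq, neg_sub] at this
    linarith
  · have := mul_pos (mul_pos (neg_pos.2 hκ) P.R_pos) (mul_pos h0 (by linarith : 0 < 2 * P.Q - a))
    rw [M]; linarith

namespace Models

theorem sq_eq (h : P.Models ε δ R) : ε ^ 2 = (δ ^ 2 * R * P.Q) ^ 2 := by
  rw [h.ε_eq]; linear_combination (δ ^ 2 * R * P.Q) ^ 2 * P.σ_mul_self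

theorem abs_eq (h : P.Models ε δ R) (hδ : 0 < δ) : |ε| = δ ^ 2 * R * P.Q := by
  have hR := h.R_eq ▸ P.R_pos
  have hQ := P.Q_pos
  rw [← sq_eq_sq₀ (abs_nonneg _) (by positivity), sq_abs, h.sq_eq]

theorem R_pos (h : P.Models ε δ R) : 0 < R := h.R_eq ▸ P.R_pos

theorem κ_pos_iff (h : P.Models ε δ R) : 0 < P.κ ↔ R < 1 := by
  rw [← sub_pos (a := 1), ← h.R_eq]
  have := P.κ_mul_pos
  exact ⟨fun hκ => (mul_pos_iff_of_pos_left hκ).1 this,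
    fun hR => (mul_pos_iff_of_pos_right hR).1 this⟩

/-- The bound on `|ε|` in the definition of well-posedness says that `m` has no two distinct
roots. -/
theorem abs_le_iff (h : P.Models ε δ R) (hδ : 0 < δ) (hR1 : R < 1) :
    |ε| ≤ δ * Real.sqrt (2 * R / (1 - R)) ↔ 0 ≤ P.M P.Q := by
  have hR := h.R_pos
  have hQ := P.Q_pos
  have h1R : 0 < 1 - R := by linarith
  rw [h.abs_eq hδ, show δ ^ 2 * R * P.Q = δ * (δ * R * P.Q) by ring, mul_le_mul_iff_right₀ hδ,
    Real.le_sqrt' (by positivity), le_div_iff₀ h1R, M_Q, h.κ_eq, h.R_eq, sub_nonneg]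
  rw [show (δ * R * P.Q) ^ 2 * (1 - R) = (2 * R) * (δ ^ 2 / 2 * (1 - R) * R * P.Q ^ 2) by ring]
  exact mul_le_iff_le_one_right (by positivity)

theorem σ_eq_neg_one (h : P.Models ε δ R) (hδ : 0 < δ) (hε : ε < 0) : P.σ = -1 := by
  refine P.σ_eq.resolve_left fun hσ => ?_
  have hR := h.R_pos
  have hQ := P.Q_pos
  have h1 := h.ε_eq
  have : 0 < δ ^ 2 * R * P.Q := by positivity
  rw [hσ] at h1; linarith

/-- The Merton proportion is the turning point, in the original coordinate. -/
theorem qM_eq (h : P.Models ε δ R) (hδ : 0 < δ) : qM ε δ R = P.σ * P.Q := by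
  have hR := h.R_pos
  rw [qM, h.ε_eq, div_eq_iff (by positivity)]; ring

/-- The regimes of well-posedness in terms of the values of `M` at `1` and at its turning point. -/
theorem of_wellPosed (h : P.Models ε δ R) (hδ : 0 < δ) (hw : WellPosed ε δ R ξ) :
    (P.σ = 1 → P.κ < 0 ∨ 0 < P.M 1) ∧ (P.M P.Q < 0 → lowerCost ε δ R < ξ) := by
  have hR := h.R_pos
  have hneg : 1 < R → P.κ < 0 := fun hR1 => by
    rcases P.sign_cases with ⟨hκ, -⟩ | ⟨hκ, -⟩
    · linarith [h.κ_pos_iff.1 hκ]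
    · exact hκ
  have hone : R < 1 → ε < 1 / (1 - R) + δ ^ 2 * R / 2 → P.σ = 1 → 0 < P.M 1 := by
    intro hR1 hε hσ
    have h1R : 0 < 1 - R := by linarith
    have h1 := h.m_eq 1
    rw [hσ, one_mul] at h1
    rw [← h1, m]
    have h2 := mul_lt_mul_of_pos_right hε h1R
    rw [add_mul, one_div, inv_mul_cancel₀ h1R.ne'] at h2
    linarith
  have hlow : R < 1 → δ * Real.sqrt (2 * R / (1 - R)) < |ε| → P.M P.Q < 0 := fun hR1 hε => by
    rw [← not_le, ← h.abs_le_iff hδ hR1]; exact not_le.2 hε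
  have hsq := mul_nonneg hδ.le (Real.sqrt_nonneg (2 * R / (1 - R)))
  rcases hw with hR1 | ⟨hR1, h1, h2⟩ | ⟨hR1, h1, h2, h3⟩ | ⟨hR1, h1, h3⟩
  · exact ⟨fun _ => .inl (hneg hR1), fun hM => absurd hM (M_Q_pos_of_neg (hneg hR1)).not_gt⟩
  · exact ⟨fun hσ => .inr (hone hR1 h2 hσ), fun hM => absurd ((h.abs_le_iff hδ hR1).1 h1) hM.not_ge⟩
  · exact ⟨fun hσ => .inr (hone hR1 h2 hσ), fun _ => h3⟩
  · refine ⟨fun hσ => ?_, fun _ => h3⟩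
    have := h.σ_eq_neg_one hδ (by linarith)
    rw [hσ] at this; norm_num at this

/-- With a short Merton position every sufficiently large cost makes the problem well-posed. -/
theorem wellPosed_of_neg (hR1 : R ≠ 1) (hδ : 0 < δ) (hR : 0 < R) (hε : ε < 0)
    (hξ : lowerCost ε δ R < ξ) : WellPosed ε δ R ξ := by
  rcases lt_or_gt_of_ne hR1 with hR1 | hR1
  · have h1R : 0 < 1 - R := by linarith
    rcases le_or_gt |ε| (δ * Real.sqrt (2 * R / (1 - R))) with h1 | h1
    · exact .inr (.inl ⟨hR1, h1, hε.trans (by positivity)⟩)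
    · rw [abs_of_neg hε] at h1
      exact .inr (.inr (.inr ⟨hR1, by linarith, hξ⟩))
  · exact .inl hR1

/-- When `M` takes negative values, the threshold cost is the integral between its roots. -/
theorem exists_root (h : P.Models ε δ R) (hδ : 0 < δ) (hM : P.M P.Q < 0) :
    ∃ r, 0 < r ∧ r < P.Q ∧ P.M r = 0 ∧ lowerCost ε δ R = Real.exp
      (∫ p in r..(2 * P.Q - r), -P.M p / (P.s p * (P.M p + P.κ * P.s p))) - 1 := by
  have hR := h.R_pos
  have hQ := P.Q_pos
  have hκ : 0 < P.κ := by
    rcases P.sign_cases with ⟨hκ, -⟩ | ⟨hκ, -⟩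
    · exact hκ
    · exact absurd hM (M_Q_pos_of_neg hκ).not_gt
  have hR1 : 0 < 1 - R := sub_pos.2 (h.κ_pos_iff.1 hκ)
  have hd : 0 < δ ^ 2 * R := by positivity
  set S := Real.sqrt (ε ^ 2 - δ ^ 2 * (2 * R / (1 - R))) with hS
  set ρ := S / (δ ^ 2 * R) with hρ
  have hdisc : ε ^ 2 - δ ^ 2 * (2 * R / (1 - R)) =
      (δ ^ 2 * R) ^ 2 * (-P.M P.Q / (P.κ * P.R)) := by
    rw [h.sq_eq, M_Q, h.κ_eq, h.R_eq]; field_simp; ring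
  have hdiv : 0 < -P.M P.Q / (P.κ * P.R) := div_pos (by linarith) (mul_pos hκ P.R_pos)
  have hρ0 : 0 < ρ := div_pos (Real.sqrt_pos.2 (by rw [hdisc]; positivity)) hd
  have hρ2 : P.κ * P.R * ρ ^ 2 = -P.M P.Q := by
    have hκR := (mul_pos hκ P.R_pos).ne'
    rw [hρ, div_pow, hS, Real.sq_sqrt (by rw [hdisc]; positivity), hdisc,
      mul_div_cancel_left₀ _ (pow_pos hd 2).ne', mul_div_cancel₀ _ hκR]
  have hroot : ∀ p, P.M p = P.κ * P.R * ((p - P.Q) ^ 2 - ρ ^ 2) := fun p => by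
    rw [M_eq_add_sq]; linarith
  have hρQ : ρ < P.Q := by
    refine lt_of_pow_lt_pow_left₀ 2 hQ.le (lt_of_mul_lt_mul_left ?_ (mul_pos hκ P.R_pos).le)
    rw [hρ2, M_Q]; linarith
  have hends : rootMinus ε δ R = P.σ * P.Q - ρ ∧ rootPlus ε δ R = P.σ * P.Q + ρ := by
    rw [← h.qM_eq hδ, rootMinus, rootPlus, qM, hρ, sub_div, add_div]
    exact ⟨rfl, rfl⟩
  refine ⟨P.Q - ρ, by linarith, by linarith, by rw [hroot]; ring, ?_⟩
  have hint : ∫ q in (P.σ * P.Q - ρ)..(P.σ * P.Q + ρ),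
      1 / (q * (1 - q)) * (|m ε δ R q| / ell ε δ R q) =
      ∫ p in (P.Q - ρ)..(P.Q + ρ), |P.M p| / (P.s p * (P.M p + P.κ * P.s p)) := by
    have he : ∀ q, 1 / (q * (1 - q)) * (|m ε δ R q| / ell ε δ R q) =
        (fun p => |P.M p| / (P.s p * (P.M p + P.κ * P.s p))) (P.σ * q) := fun q => by
      simp only
      rw [h.m_eq, h.ell_eq, s_σ, div_mul_div_comm, one_mul]
    rw [intervalIntegral.integral_congr fun q _ => he q]
    rcases P.σ_eq with hσ | hσ
    · simp only [hσ, one_mul]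
    · simp only [hσ, neg_mul, one_mul]
      rw [intervalIntegral.integral_comp_neg
        (fun p => |P.M p| / (P.s p * (P.M p + P.κ * P.s p)))]
      congr 1 <;> ring
  rw [lowerCost, hends.1, hends.2, hint, show 2 * P.Q - (P.Q - ρ) = P.Q + ρ by ring]
  congr 2
  refine intervalIntegral.integral_congr fun p hp => ?_
  rw [uIcc_of_le (by linarith)] at hp
  have hMp : P.M p ≤ 0 := by
    rw [hroot]
    refine mul_nonpos_of_nonneg_of_nonpos (mul_pos hκ P.R_pos).le ?_
    rw [sub_nonpos]
    exact sq_le_sq' (by linarith [hp.1]) (by linarith [hp.2])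
  simp only [abs_of_nonpos hMp]

/-- Existence for well-posed costs. -/
theorem exists_cost (h : P.Models ε δ R) (hδ : 0 < δ) (hξ : 0 < ξ) (hw : WellPosed ε δ R ξ) :
    ∃ a b, P.Cost a b (Real.log (1 + ξ)) := by
  obtain ⟨hM1, hlow⟩ := h.of_wellPosed hδ hw
  have hL : 0 < Real.log (1 + ξ) := Real.log_pos (by linarith)
  have hQ := P.Q_pos
  -- a starting point close to the turning point or to the smaller root has a small cost
  obtain ⟨A, hA0, hAQ, hMA, hA⟩ : ∃ A, 0 < A ∧ A < P.Q ∧ 0 < P.M A ∧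
      ∀ Z b, FB P Z A b → ∫ p in A..b, P.G p (Z p) ≤ Real.log (1 + ξ) := by
    have hκ : P.M P.Q ≤ 0 → 0 < P.κ := fun hM => by
      rcases P.sign_cases with ⟨hκ, -⟩ | ⟨hκ, -⟩
      · exact hκ
      · exact absurd hM (M_Q_pos_of_neg hκ).not_ge
    have hM1' : P.M P.Q ≤ 0 → P.σ = 1 → 0 < P.M 1 := fun hM hσ =>
      (hM1 hσ).resolve_left (hκ hM).not_gt
    rcases lt_trichotomy (P.M P.Q) 0 with hM | hM | hM
    · obtain ⟨r, hr0, hrQ, hr, hr'⟩ := h.exists_root hδ hM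
      have hint : ∫ p in r..(2 * P.Q - r), -P.M p / (P.s p * (P.M p + P.κ * P.s p)) <
          Real.log (1 + ξ) := by
        rw [Real.lt_log_iff_exp_lt (by linarith)]
        linarith [hlow hM]
      obtain ⟨A, hA, hA0, hAr⟩ := ((eventually_cost_le_of_root (hκ hM.le) hr0 hrQ.le hr
        (hM1' hM.le) hint).and (Ioo_mem_nhdsLT hr0)).exists
      refine ⟨A, hA0, hAr.trans hrQ, ?_, hA⟩
      have h1 := M_sub_M (P := P) A r
      rw [hr, sub_zero] at h1
      rw [h1]
      exact mul_pos (mul_pos (hκ hM.le) P.R_pos)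
        (mul_pos_of_neg_of_neg (by linarith) (by linarith))
    · have hint : ∫ p in P.Q..(2 * P.Q - P.Q), -P.M p / (P.s p * (P.M p + P.κ * P.s p)) <
          Real.log (1 + ξ) := by
        rwa [show 2 * P.Q - P.Q = P.Q by ring, intervalIntegral.integral_same]
      obtain ⟨A, hA, hA0, hAr⟩ := ((eventually_cost_le_of_root (hκ hM.le) hQ le_rfl hM
        (hM1' hM.le) hint).and (Ioo_mem_nhdsLT hQ)).exists
      exact ⟨A, hA0, hAr, M_pos_of_lt_Q hM.ge hA0 hAr, hA⟩
    · obtain ⟨A, hA, hA0, hAr⟩ := ((eventually_cost_le hM hL).and (Ioo_mem_nhdsLT hQ)).exists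
      exact ⟨A, hA0, hAr, M_pos_of_lt_Q hM.le hA0 hAr, hA⟩
  obtain ⟨a, -, b, hab⟩ := exists_cost_of_le hA0 hAQ hMA hM1 hA
  exact ⟨a, b, hab⟩

/-- A problem with a leveraged or short Merton position that is well-posed for all costs has
`M ≥ 0`, since otherwise the threshold cost is positive. -/
theorem M_Q_nonneg (h : P.Models ε δ R) (hδ : 0 < δ) (hσQ : P.σ < P.Q)
    (hw : ∀ ξ, 0 < ξ → WellPosed ε δ R ξ) : 0 ≤ P.M P.Q := by
  by_contra! hM
  have hκ : 0 < P.κ := by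
    rcases P.sign_cases with ⟨hκ, -⟩ | ⟨hκ, -⟩
    · exact hκ
    · exact absurd hM (M_Q_pos_of_neg hκ).not_gt
  have hκR := mul_pos hκ P.R_pos
  obtain ⟨r, hr0, hrQ, hr, hr'⟩ := h.exists_root hδ hM
  have hneg : lowerCost ε δ R ≤ 0 := by
    by_contra! hpos
    exact absurd ((h.of_wellPosed hδ (hw _ hpos)).2 hM) (lt_irrefl _)
  have hfac : ∀ p, P.M p = P.κ * P.R * ((p - r) * (p + r - 2 * P.Q)) := fun p => by
    have := M_sub_M (P := P) p r
    rwa [hr, sub_zero] at this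
  -- `s < 0` between the roots, since `M 1 > 0` keeps the singular point out
  have hσr : P.σ < r := by
    rcases P.σ_eq with hσ | hσ
    · by_contra! hle
      have h1 := ((h.of_wellPosed hδ (hw 1 one_pos)).1 hσ).resolve_left hκ.not_gt
      rw [hσ] at hσQ hle
      rw [hfac] at h1
      have := mul_nonneg hκR.le (mul_nonneg (sub_nonneg.2 hle)
        (by linarith : 0 ≤ 2 * P.Q - 1 - r))
      linarith
    · rw [hσ]; linarith
  have hden : ∀ p ∈ Icc r (2 * P.Q - r), P.M p ≤ 0 ∧ 0 < P.s p * (P.M p + P.κ * P.s p) := by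
    intro p hp
    have hs := s_neg (P := P) (hσr.trans_le hp.1) (hr0.trans_le hp.1)
    have hMp : P.M p ≤ 0 := by
      rw [hfac]
      exact mul_nonpos_of_nonneg_of_nonpos hκR.le
        (mul_nonpos_of_nonneg_of_nonpos (by linarith [hp.1]) (by linarith [hp.2]))
    exact ⟨hMp, mul_pos_of_neg_of_neg hs (by linarith [mul_neg_of_pos_of_neg hκ hs])⟩
  have hpos : 0 < ∫ p in r..(2 * P.Q - r), -P.M p / (P.s p * (P.M p + P.κ * P.s p)) := by
    refine intervalIntegral.integral_pos (by linarith) ?_ (fun p hp => ?_)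
      ⟨P.Q, ⟨hrQ.le, by linarith⟩, ?_⟩
    · exact continuous_M.continuousOn.neg.div (continuous_s.mul
        (continuous_M.add (continuous_const.mul continuous_s))).continuousOn
        fun p hp => (hden p hp).2.ne'
    · have := hden p (Ioc_subset_Icc_self hp)
      exact div_nonneg (by linarith) this.2.le
    · exact div_pos (by linarith) (hden P.Q ⟨hrQ.le, by linarith⟩).2
  have := Real.add_one_lt_exp hpos.ne'
  linarith

theorem isFreeBoundary_of_cost {u v : ℝ} (h : P.Models ε δ R)
    (huv : P.σ = 1 ∧ u = a ∧ v = b ∨ P.σ = -1 ∧ u = -b ∧ v = -a) (hc : P.Cost u v L) :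
    IsFreeBoundary ε δ R (Real.exp L - 1) a b := by
  refine (h.isFreeBoundary_iff huv).2 ⟨?_, ?_⟩
  · linarith [Real.add_one_lt_exp hc.L_pos.ne', hc.L_pos]
  · rwa [add_sub_cancel, Real.log_exp]

end Models

/-- A short position never pays more than the integral of `1 / |s|`, which bounds the cost. -/
theorem Cost.exp_lt (h : P.Cost a b L) (hσ : P.σ = -1) :
    Real.exp L * (a * (1 + b)) < b * (1 + a) := by
  obtain ⟨Z, hZ, rfl⟩ := h
  have ha := hZ.a_pos
  have hb := ha.trans hZ.lt
  have hF : ∀ p ∈ Icc a b, HasDerivAt (fun p => Real.log p - Real.log (1 + p))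
      (1 / (p * (1 + p))) p := fun p hp => by
    have hp0 := ha.trans_le hp.1
    have h1 : 1 + p ≠ 0 := by linarith
    refine ((Real.hasDerivAt_log hp0.ne').sub
      (((hasDerivAt_id p).const_add 1).log h1)).congr_deriv ?_
    simp only [id]; field_simp; ring
  have hc : ContinuousOn (fun p : ℝ => 1 / (p * (1 + p))) (Icc a b) :=
    continuousOn_const.div (by fun_prop) fun p hp => by
      have hp0 := ha.trans_le hp.1
      have : 0 < p * (1 + p) := mul_pos hp0 (by linarith)
      exact this.ne'
  have hlt : ∀ p ∈ Icc a b, P.g Z p < 1 / (p * (1 + p)) := fun p hp => by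
    have hp0 := ha.trans_le hp.1
    have hpσ : p ≠ P.σ := by rw [hσ]; linarith
    have hs : P.s p = -(p * (1 + p)) := by rw [s, hσ]; ring
    have hs0 : 0 < p * (1 + p) := mul_pos hp0 (by linarith)
    have hV := hZ.nonneg p hp
    rw [g_of_ne hpσ, G, hs, show -(p * (1 + p)) * (-(p * (1 + p)) - P.V p (Z p)) =
      (p * (1 + p)) * (p * (1 + p) + P.V p (Z p)) by ring, div_lt_div_iff₀ (by positivity) hs0]
    nlinarith [mul_pos hs0 hs0]
  have hint : ∫ p in a..b, P.G p (Z p) <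
      (Real.log b - Real.log (1 + b)) - (Real.log a - Real.log (1 + a)) := by
    rw [← integral_g, ← intervalIntegral.integral_eq_sub_of_hasDerivAt
      (fun p hp => hF p (by rwa [uIcc_of_le hZ.lt.le] at hp))
      (hc.intervalIntegrable_of_Icc hZ.lt.le)]
    exact intervalIntegral.integral_lt_integral_of_continuousOn_of_le_of_exists_lt hZ.lt
      hZ.continuousOn_g hc (fun p hp => (hlt p (Ioc_subset_Icc_self hp)).le)
      ⟨a, ⟨le_rfl, hZ.lt.le⟩, hlt a ⟨le_rfl, hZ.lt.le⟩⟩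
  have h3 := Real.exp_lt_exp.2 hint
  rw [Real.exp_sub, Real.exp_sub, Real.exp_sub, Real.exp_log hb, Real.exp_log ha,
    Real.exp_log (by linarith), Real.exp_log (by linarith), div_div_div_eq,
    lt_div_iff₀ (mul_pos (by linarith) ha)] at h3
  linarith

end Params

end MertonTC

namespace MertonTC

namespace Params

variable {P : Params} {a b a₁ b₁ a₂ b₂ L L₁ L₂ ε δ R ξ lam gam p S : ℝ}

/-! ### The wedge -/

theorem Cost.a_le_of_le (h₁ : P.Cost a₁ b₁ L₁) (h₂ : P.Cost a₂ b₂ L₂) (hL : L₁ ≤ L₂) :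
    a₂ ≤ a₁ := by
  rcases eq_or_lt_of_le hL with rfl | hL
  · exact (h₂.a_eq_of_eq h₁).le
  · exact (h₁.a_lt_of_lt h₂ hL).le

theorem Cost.eq (h₁ : P.Cost a₁ b₁ L) (h₂ : P.Cost a₂ b₂ L) : a₁ = a₂ ∧ b₁ = b₂ := by
  obtain rfl := h₁.a_eq_of_eq h₂
  exact ⟨rfl, (h₁.unique h₂).1⟩

theorem one_add_roundTrip (hg : gam < 1) : 1 + roundTrip lam gam = (1 + lam) / (1 - gam) := by
  have : 1 - gam ≠ 0 := by linarith
  rw [roundTrip]; field_simp; ring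

theorem roundTrip_zero_left (L : ℝ) : roundTrip 0 (1 - Real.exp (-L)) = Real.exp L - 1 := by
  have h1 := Real.exp_pos L
  rw [roundTrip, Real.exp_neg]; field_simp; ring

theorem roundTrip_zero_right (lam : ℝ) : roundTrip lam 0 = lam := by simp [roundTrip]

theorem roundTrip_lt {lam₁ lam₂ gam₁ gam₂ : ℝ} (hl0 : 0 ≤ lam₁) (hg1 : gam₂ < 1)
    (hl : lam₁ ≤ lam₂) (hg : gam₁ ≤ gam₂) (h : lam₁ < lam₂ ∨ gam₁ < gam₂) :
    roundTrip lam₁ gam₁ < roundTrip lam₂ gam₂ := by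
  have h1 := one_add_roundTrip (lam := lam₁) (hg.trans_lt hg1)
  have h2 := one_add_roundTrip (lam := lam₂) hg1
  have : (1 + lam₁) / (1 - gam₁) < (1 + lam₂) / (1 - gam₂) := by
    rw [div_lt_div_iff₀ (by linarith) (by linarith)]
    rcases h with h | h
    · nlinarith [mul_lt_mul_of_pos_right h (by linarith : 0 < 1 - gam₁),
        mul_le_mul_of_nonneg_left hg (by linarith : 0 ≤ 1 + lam₁)]
    · nlinarith [mul_le_mul_of_nonneg_right hl (by linarith : 0 ≤ 1 - gam₁),
        mul_lt_mul_of_pos_left h (by linarith : 0 < 1 + lam₁)]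
  linarith

/-- Both boundaries of the wedge move outwards when the costs and the free boundaries in `(0, 1)`
do. -/
theorem wedge_lt {lam₁ lam₂ gam₁ gam₂ : ℝ} (hl0 : 0 ≤ lam₁) (hg0 : 0 ≤ gam₁) (hg1 : gam₂ < 1)
    (hl : lam₁ ≤ lam₂) (hg : gam₁ ≤ gam₂) (ha0 : 0 < a₂) (ha : a₂ < a₁) (hab : a₁ < b₁)
    (hb : b₁ < b₂) (hb1 : b₂ < 1) :
    a₂ / (1 + lam₂ - lam₂ * a₂) < a₁ / (1 + lam₁ - lam₁ * a₁) ∧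
      b₁ / (1 - gam₁ + gam₁ * b₁) < b₂ / (1 - gam₂ + gam₂ * b₂) := by
  have hb0 : 0 < b₁ := by linarith
  have e1 : ∀ {l x : ℝ}, 0 ≤ l → x < 1 → 0 < 1 + l - l * x := fun {l x} hl hx => by
    linarith [mul_nonneg hl (sub_nonneg.2 hx.le)]
  have e2 : ∀ {g x : ℝ}, 0 ≤ g → g < 1 → 0 < x → 0 < 1 - g + g * x := fun {g x} h0 h1 hx => by
    linarith [mul_nonneg h0 hx.le]
  constructor
  · rw [div_lt_div_iff₀ (e1 (hl0.trans hl) (by linarith)) (e1 hl0 (by linarith))]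
    have h1 := mul_le_mul_of_nonneg_right hl
      (mul_nonneg (by linarith : 0 ≤ a₁) (by linarith : 0 ≤ 1 - a₂))
    have h2 := mul_le_mul_of_nonneg_left ha.le hl0
    linarith
  · rw [div_lt_div_iff₀ (e2 hg0 (hg.trans_lt hg1) hb0) (e2 (hg0.trans hg) hg1 (hb0.trans hb))]
    have h1 := mul_le_mul_of_nonneg_right hg (mul_nonneg hb0.le (by linarith : 0 ≤ 1 - b₂))
    have h2 := mul_lt_mul_of_pos_right (hg.trans_lt hg1) (sub_pos.2 hb)
    linarith

/-- The cost at a starting point near the turning point, when `M ≥ 0`. -/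
theorem eventually_exists_cost (hM : 0 ≤ P.M P.Q) (hM1 : P.σ = 1 → P.κ < 0 ∨ 0 < P.M 1) :
    ∀ᶠ a in 𝓝[<] P.Q, ∃ b L, P.Cost a b L := by
  filter_upwards [Ioo_mem_nhdsLT P.Q_pos] with a ha
  obtain ⟨Z, b, hZ⟩ := exists_FB ha.1 ha.2 (M_pos_of_lt_Q hM ha.1 ha.2) hM1
  exact ⟨b, _, Z, hZ, rfl⟩

/-- Starting points whose upper boundary exceeds the turning point by a prescribed multiple of the
cost, together with starting points of smaller cost and upper boundary below a given value. -/
theorem exists_two_costs (hM : 0 ≤ P.M P.Q) (hM1 : P.σ = 1 → P.κ < 0 ∨ 0 < P.M 1)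
    (hσ : P.σ < P.Q) (C : ℝ) : ∃ a₂ b₂ L₂, P.Cost a₂ b₂ L₂ ∧ C * (Real.exp L₂ - 1) < b₂ - P.Q ∧
      ∀ y, P.Q < y → ∃ a₁ b₁ L₁, P.Cost a₁ b₁ L₁ ∧ L₁ < L₂ ∧ b₁ < y := by
  have hex := eventually_exists_cost hM hM1
  obtain ⟨a₂, ⟨b₂, L₂, h₂⟩, hC⟩ := (hex.and (eventually_cost_lt_b_sub hσ C)).exists
  refine ⟨a₂, b₂, L₂, h₂, hC b₂ L₂ h₂, fun y hy => ?_⟩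
  have hlt : max a₂ (2 * P.Q - y) < P.Q := max_lt h₂.a_lt_Q (by linarith)
  obtain ⟨a₁, ⟨b₁, L₁, h₁⟩, ha₁, -⟩ := (hex.and (Ioo_mem_nhdsLT hlt)).exists
  refine ⟨a₁, b₁, L₁, h₁, ?_, ?_⟩
  · exact h₁.lt_of_lt h₂ ((le_max_left _ _).trans_lt ha₁)
  · linarith [h₁.add_le, (le_max_right a₂ (2 * P.Q - y)).trans_lt ha₁]

namespace Models

theorem isFreeBoundary_iff_of_pos (h : P.Models ε δ R) (hσ : P.σ = 1) :
    IsFreeBoundary ε δ R ξ a b ↔ 0 < ξ ∧ P.Cost a b (Real.log (1 + ξ)) :=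
  h.isFreeBoundary_iff (.inl ⟨hσ, rfl, rfl⟩)

theorem isFreeBoundary_iff_of_neg (h : P.Models ε δ R) (hσ : P.σ = -1) :
    IsFreeBoundary ε δ R ξ a b ↔ 0 < ξ ∧ P.Cost (-b) (-a) (Real.log (1 + ξ)) :=
  h.isFreeBoundary_iff (.inr ⟨hσ, rfl, rfl⟩)

theorem existsUnique (h : P.Models ε δ R) (hδ : 0 < δ) (hξ : 0 < ξ) (hw : WellPosed ε δ R ξ) :
    ∃! q : ℝ × ℝ, IsFreeBoundary ε δ R ξ q.1 q.2 := by
  obtain ⟨a, b, hab⟩ := h.exists_cost hδ hξ hw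
  rcases P.σ_eq with hσ | hσ
  · refine ⟨(a, b), (h.isFreeBoundary_iff_of_pos hσ).2 ⟨hξ, hab⟩, fun q hq => ?_⟩
    have := ((h.isFreeBoundary_iff_of_pos hσ).1 hq).2.eq hab
    exact Prod.ext this.1 this.2
  · refine ⟨(-b, -a), (h.isFreeBoundary_iff_of_neg hσ).2 ⟨hξ, by simpa using hab⟩, fun q hq => ?_⟩
    have := ((h.isFreeBoundary_iff_of_neg hσ).1 hq).2.eq hab
    exact Prod.ext (by simp only; linarith [this.2]) (by simp only; linarith [this.1])

theorem freeBoundary_monotone (h : P.Models ε δ R) {ξ₁ ξ₂ : ℝ} (hξ : ξ₁ < ξ₂)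
    (h₁ : IsFreeBoundary ε δ R ξ₁ a₁ b₁) (h₂ : IsFreeBoundary ε δ R ξ₂ a₂ b₂) :
    a₂ < a₁ ∧ b₁ ≤ b₂ := by
  have hL : Real.log (1 + ξ₁) < Real.log (1 + ξ₂) :=
    Real.log_lt_log (by linarith [h₁.1]) (by linarith)
  rcases P.σ_eq with hσ | hσ
  · rw [h.isFreeBoundary_iff_of_pos hσ] at h₁ h₂
    have ha := h₁.2.a_lt_of_lt h₂.2 hL
    exact ⟨ha, h₁.2.b_le h₂.2 ha.le⟩
  · rw [h.isFreeBoundary_iff_of_neg hσ] at h₁ h₂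
    have ha := h₁.2.a_lt_of_lt h₂.2 hL
    have hb := h₁.2.b_lt h₂.2 hL (fun h1 => by rw [hσ] at h1; norm_num at h1)
    exact ⟨by linarith, by linarith⟩

/-! ### The leveraged case -/

theorem M_one_pos (h : P.Models ε δ R) (hδ : 0 < δ) (hσ : P.σ = 1) (hQ : 1 < P.Q)
    (hw : WellPosed ε δ R ξ) : 0 < P.M 1 := by
  rcases (h.of_wellPosed hδ hw).1 hσ with hκ | hM
  · have := mul_pos (mul_pos (neg_pos.2 hκ) P.R_pos) (by linarith : 0 < 2 * P.Q - 1)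
    rw [M]; linarith
  · exact hM

/-- For `Q > 1` the solution through the singular point provides the upper boundary for all costs at
least as large as its own. -/
theorem leveraged_saturation (h : P.Models ε δ R) (hδ : 0 < δ) (hσ : P.σ = 1) (hQ : 1 < P.Q)
    (hw : WellPosed ε δ R ξ) : ∃ b L, P.Cost 1 b L ∧ ∀ L', L ≤ L' → ∃ a ≤ 1, P.Cost a b L' := by
  have hM := h.M_one_pos hδ hσ hQ hw
  obtain ⟨Z, b, hZ⟩ := exists_FB one_pos hQ hM fun _ => .inr hM
  have hc : P.Cost 1 b _ := ⟨Z, hZ, rfl⟩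
  refine ⟨b, _, hc, fun L' hL' => ?_⟩
  obtain ⟨a, ha, b', hab⟩ := exists_cost_of_le one_pos hQ hM (fun _ => .inr hM)
    fun W b' hW => (hZ.integral_eq hW).symm.trans_le hL'
  obtain rfl := hab.b_eq_of_le_one hc hσ hQ ha le_rfl
  exact ⟨a, ha, hab⟩

theorem leveraged_freeBoundary (h : P.Models ε δ R) (hδ : 0 < δ) (hσ : P.σ = 1) (hQ : 1 < P.Q)
    (hw : WellPosed ε δ R ξ) :
    ∃ ξbar qbar : ℝ, IsFreeBoundary ε δ R ξbar 1 qbar ∧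
      (∀ ξ b : ℝ, IsFreeBoundary ε δ R ξ 1 b → ξ = ξbar) ∧
      ∀ ξ : ℝ, ξbar ≤ ξ → (∃ a : ℝ, IsFreeBoundary ε δ R ξ a qbar) ∧
        ∀ a b : ℝ, IsFreeBoundary ε δ R ξ a b → a ≤ 1 ∧ b = qbar := by
  obtain ⟨b, L, hc, hsat⟩ := h.leveraged_saturation hδ hσ hQ hw
  have hF := h.isFreeBoundary_of_cost (.inl ⟨hσ, rfl, rfl⟩) hc
  refine ⟨Real.exp L - 1, b, hF, fun ξ b' hb' => ?_, fun ξ hξ => ⟨?_, fun a b' hb' => ?_⟩⟩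
  · rw [h.isFreeBoundary_iff_of_pos hσ] at hb'
    rw [(hc.unique hb'.2).2, Real.exp_log (by linarith [hb'.1])]; ring
  · have hξ0 := hF.1.trans_le hξ
    obtain ⟨a, -, ha⟩ := hsat (Real.log (1 + ξ))
      ((Real.le_log_iff_exp_le (by linarith)).2 (by linarith))
    exact ⟨a, (h.isFreeBoundary_iff_of_pos hσ).2 ⟨hξ0, ha⟩⟩
  · rw [h.isFreeBoundary_iff_of_pos hσ] at hb'
    have ha := hc.a_le_of_le hb'.2 ((Real.le_log_iff_exp_le (by linarith [hb'.1])).2 (by linarith))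
    exact ⟨ha, hb'.2.b_eq_of_le_one hc hσ hQ ha le_rfl⟩

/-- The wedge when only sales are charged. -/
theorem isWedge_sale (h : P.Models ε δ R) (hσ : P.σ = 1) (hc : P.Cost a b L) :
    IsWedge ε δ R 0 (1 - Real.exp (-L)) a (b / (1 - (1 - Real.exp (-L)) +
      (1 - Real.exp (-L)) * b)) := by
  have h1 : Real.exp (-L) < 1 := Real.exp_lt_one_iff.2 (by linarith [hc.L_pos])
  refine ⟨⟨le_rfl, by linarith, by linarith [Real.exp_pos (-L)], by linarith⟩, a, b, ?_, by simp,
    rfl⟩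
  rw [roundTrip_zero_left]
  exact h.isFreeBoundary_of_cost (.inl ⟨hσ, rfl, rfl⟩) hc

theorem leveraged_one_lt (h : P.Models ε δ R) (hσ : P.σ = 1) (hQ : 1 < P.Q)
    (hw : IsWedge ε δ R lam gam p S) : 1 < S := by
  obtain ⟨⟨hl, hg, hg1, -⟩, a, b, hF, -, rfl⟩ := hw
  rw [h.isFreeBoundary_iff_of_pos hσ] at hF
  have hb := hF.2.Q_lt_b (by rw [hσ]; exact hQ.ne')
  have := mul_nonneg hg (by linarith : 0 ≤ b)
  rw [one_lt_div (by linarith)]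
  linarith [mul_pos (sub_pos.2 hg1) (by linarith : 0 < b - 1)]

/-- When sales cost nearly everything, the sale boundary comes down to `1`. -/
theorem leveraged_exists_lt (h : P.Models ε δ R) (hδ : 0 < δ) (hσ : P.σ = 1) (hQ : 1 < P.Q)
    (hw : WellPosed ε δ R ξ) {gam₀ : ℝ} (hg₀ : gam₀ < 1) :
    ∃ gam p S, gam₀ < gam ∧ IsWedge ε δ R 0 gam p S ∧ S < P.Q := by
  obtain ⟨b, L, hc, hsat⟩ := h.leveraged_saturation hδ hσ hQ hw
  have hQ0 := P.Q_pos
  set η := min (Real.exp (-L)) (min ((P.Q - 1) / P.Q) ((1 - gam₀) / 2)) with hη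
  have hη0 : 0 < η := lt_min (Real.exp_pos _)
    (lt_min (div_pos (by linarith) hQ0) (by linarith))
  have hηL : η ≤ Real.exp (-L) := min_le_left _ _
  have hηQ : η * P.Q ≤ P.Q - 1 := (le_div_iff₀ hQ0).1 ((min_le_right _ _).trans (min_le_left _ _))
  have hηg : η ≤ (1 - gam₀) / 2 := (min_le_right _ _).trans (min_le_right _ _)
  obtain ⟨a, -, ha⟩ := hsat (-Real.log η)
    (by linarith [(Real.log_le_iff_le_exp hη0).2 hηL])
  have hwedge := h.isWedge_sale hσ ha
  rw [neg_neg, Real.exp_log hη0] at hwedge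
  refine ⟨_, _, _, by linarith, hwedge, ?_⟩
  have hb := ha.Q_lt_b (by rw [hσ]; exact hQ.ne')
  have hη1 : η < 1 := hηL.trans_lt (Real.exp_lt_one_iff.2 (by linarith [hc.L_pos]))
  have hpos : 0 < 1 - (1 - η) + (1 - η) * b := by
    have := mul_pos (by linarith : 0 < 1 - η) (by linarith : 0 < b)
    linarith
  rw [div_lt_iff₀ hpos]
  have := mul_le_mul_of_nonneg_right hηQ (by linarith : 0 ≤ b - 1)
  linarith

/-- A small charge on sales moves the sale boundary beyond the Merton line; a smaller one leaves it
closer to that line, and a charge of nearly the whole proceeds brings it back inside. -/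
theorem leveraged_not_monotone (h : P.Models ε δ R) (hδ : 0 < δ) (hσ : P.σ = 1) (hQ : 1 < P.Q)
    (hw : ∀ ξ, 0 < ξ → WellPosed ε δ R ξ) :
    ∃ lam gam₁ gam₂ gam₃ p₁ P₁ p₂ P₂ p₃ P₃ : ℝ, gam₁ < gam₂ ∧ gam₂ < gam₃ ∧
      IsWedge ε δ R lam gam₁ p₁ P₁ ∧ IsWedge ε δ R lam gam₂ p₂ P₂ ∧
      IsWedge ε δ R lam gam₃ p₃ P₃ ∧ P₁ < P₂ ∧ P₃ < P₂ := by
  -- `C = Q (2 Q - 1)` turns `b - Q > C ξ` into `b - Q > γ Q (b - 1)`, which says that the sale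
  -- boundary lies beyond the Merton line.
  have hσQ : P.σ < P.Q := by rw [hσ]; exact hQ
  have hQ0 := P.Q_pos
  have hM := h.M_Q_nonneg hδ hσQ hw
  have hM1 := h.M_one_pos hδ hσ hQ (hw 1 one_pos)
  obtain ⟨a₂, b₂, L₂, h₂, hC, hsmall⟩ :=
    exists_two_costs hM (fun _ => .inr hM1) hσQ (P.Q * (2 * P.Q - 1))
  have hL₂ := h₂.L_pos
  set g₂ := 1 - Real.exp (-L₂) with hg₂
  have hg₂1 : g₂ < 1 := by linarith [Real.exp_pos (-L₂)]
  have hg₂0 : 0 < g₂ := by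
    have : Real.exp (-L₂) < 1 := Real.exp_lt_one_iff.2 (by linarith)
    linarith
  have hQb := h₂.Q_lt_b hσQ.ne'
  have hden : 0 < 1 - g₂ + g₂ * b₂ := by
    have := mul_pos hg₂0 (by linarith : 0 < b₂)
    linarith
  have hS₂ : P.Q < b₂ / (1 - g₂ + g₂ * b₂) := by
    rw [lt_div_iff₀ hden]
    -- `1 - e^{-L} ≤ e^L - 1` because the sum of an exponential and its inverse is at least `2`
    have h1 : g₂ ≤ Real.exp L₂ - 1 := by
      linarith [Real.add_one_le_exp L₂, Real.add_one_le_exp (-L₂)]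
    have h3 : g₂ * (P.Q * (b₂ - 1)) ≤ (Real.exp L₂ - 1) * (P.Q * (2 * P.Q - 1)) := by
      refine mul_le_mul h1 (mul_le_mul_of_nonneg_left ?_ hQ0.le) ?_ (by linarith)
      · linarith [h₂.add_le, h₂.a_pos]
      · exact mul_nonneg hQ0.le (by linarith)
    linarith
  obtain ⟨a₁, b₁, L₁, h₁, hL, hb₁⟩ := hsmall _ hS₂
  obtain ⟨g₃, p₃, S₃, hg₃, hw₃, hS₃⟩ := h.leveraged_exists_lt hδ hσ hQ (hw 1 one_pos) hg₂1
  have hL₁ := h₁.L_pos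
  have hQb₁ := h₁.Q_lt_b hσQ.ne'
  have hg₁0 : Real.exp (-L₁) < 1 := Real.exp_lt_one_iff.2 (by linarith)
  refine ⟨0, _, g₂, g₃, _, _, _, _, _, _, ?_, hg₃, h.isWedge_sale hσ h₁, h.isWedge_sale hσ h₂,
    hw₃, ?_, hS₃.trans hS₂⟩
  · rw [hg₂]
    linarith [Real.exp_lt_exp.2 (by linarith : -L₂ < -L₁)]
  · refine lt_of_le_of_lt (div_le_self (by linarith) ?_) hb₁
    have := mul_nonneg (by linarith : 0 ≤ 1 - Real.exp (-L₁)) (by linarith : 0 ≤ b₁ - 1)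
    linarith

/-! ### The short case -/

/-- The wedge when only purchases are charged. -/
theorem isWedge_purchase (h : P.Models ε δ R) (hσ : P.σ = -1) (hc : P.Cost a b L) :
    ∃ S, IsWedge ε δ R (Real.exp L - 1) 0
      (-b / (1 + (Real.exp L - 1) - (Real.exp L - 1) * -b)) S := by
  have hL := hc.L_pos
  have h1 : 0 < Real.exp L - 1 := by linarith [Real.add_one_lt_exp hL.ne']
  refine ⟨_, ⟨h1.le, le_rfl, one_pos, by linarith⟩, -b, -a, ?_, rfl, rfl⟩
  rw [roundTrip_zero_right]
  exact h.isFreeBoundary_of_cost (.inr ⟨hσ, by ring, by ring⟩) hc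

theorem short_lt (h : P.Models ε δ R) (hσ : P.σ = -1) (hw : IsWedge ε δ R lam gam p S) :
    p < S ∧ S < 0 := by
  obtain ⟨⟨hl, hg, hg1, -⟩, a, b, hF, rfl, rfl⟩ := hw
  rw [h.isFreeBoundary_iff_of_neg hσ] at hF
  have hexp := hF.2.exp_lt hσ
  have hb := hF.2.a_pos
  have hab := hF.2.lt
  have hg1' : 0 < 1 - gam := by linarith
  rw [Real.exp_log (by linarith [hF.1]), one_add_roundTrip hg1, div_mul_eq_mul_div,
    div_lt_iff₀ hg1'] at hexp
  -- the bound of the cost keeps the denominator of the sale boundary positive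
  have hden : 0 < 1 - gam + gam * b := by
    have h1 : 0 < -a * (1 - gam + gam * b) := by
      nlinarith [mul_nonneg hl (mul_nonneg hb.le (by linarith : 0 ≤ 1 + -a)),
        mul_pos hg1' hb]
    exact pos_of_mul_pos_right h1 (by linarith)
  have hden' : 0 < 1 + lam - lam * a := by
    linarith [mul_nonneg hl (by linarith : 0 ≤ -a)]
  refine ⟨?_, div_neg_of_neg_of_pos (by linarith) hden⟩
  rw [div_lt_div_iff₀ hden' hden]
  linarith

/-- When purchases are very expensive, the purchase boundary comes up to `0`. -/
theorem short_exists_lt (h : P.Models ε δ R) (hδ : 0 < δ) (hR : R ≠ 1) (hε : ε < 0) (K : ℝ) :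
    ∃ lam p S, K < lam ∧ IsWedge ε δ R lam 0 p S ∧ -P.Q < p := by
  have hσ := h.σ_eq_neg_one hδ hε
  have hQ := P.Q_pos
  obtain ⟨lam, hlam⟩ := exists_gt (max (max K (1 / P.Q)) (lowerCost ε δ R))
  have h1 := (le_max_left _ _).trans_lt hlam
  have hK := (le_max_left _ _).trans_lt h1
  have hlQ : 1 < lam * P.Q := (div_lt_iff₀ hQ).1 ((le_max_right _ _).trans_lt h1)
  have hl0 : 0 < lam := (one_div_pos.2 hQ).trans ((le_max_right _ _).trans_lt h1)
  obtain ⟨a, b, hc⟩ := h.exists_cost hδ hl0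
    (wellPosed_of_neg hR hδ h.R_pos hε ((le_max_right _ _).trans_lt hlam))
  obtain ⟨S, hS⟩ := h.isWedge_purchase hσ hc
  rw [Real.exp_log (by linarith), add_sub_cancel_left] at hS
  refine ⟨lam, _, S, hK, hS, ?_⟩
  have hb : 0 < b := hc.a_pos.trans hc.lt
  have hlb := mul_pos hl0 hb
  rw [lt_div_iff₀ (by linarith)]
  have := mul_lt_mul_of_pos_right hlQ (by linarith : 0 < 1 + b)
  linarith

/-- A small charge on purchases moves the purchase boundary beyond the Merton line; a smaller one
leaves it closer to that line, and a very large one brings it back inside. -/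
theorem short_not_monotone (h : P.Models ε δ R) (hδ : 0 < δ) (hR : R ≠ 1) (hε : ε < 0)
    (hw : ∀ ξ, 0 < ξ → WellPosed ε δ R ξ) :
    ∃ gam lam₁ lam₂ lam₃ p₁ P₁ p₂ P₂ p₃ P₃ : ℝ, lam₁ < lam₂ ∧ lam₂ < lam₃ ∧
      IsWedge ε δ R lam₁ gam p₁ P₁ ∧ IsWedge ε δ R lam₂ gam p₂ P₂ ∧
      IsWedge ε δ R lam₃ gam p₃ P₃ ∧ p₂ < p₁ ∧ p₂ < p₃ := by
  have hσ := h.σ_eq_neg_one hδ hε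
  -- `C = Q (1 + 2 Q)` turns `b - Q > C λ` into `b - Q > λ Q (1 + b)`, which says that the purchase
  -- boundary lies beyond the Merton line.
  have hQ0 := P.Q_pos
  have hσQ : P.σ < P.Q := by rw [hσ]; linarith
  have hM := h.M_Q_nonneg hδ hσQ hw
  obtain ⟨a₂, b₂, L₂, h₂, hC, hsmall⟩ := exists_two_costs hM
    (fun h1 => by rw [hσ] at h1; norm_num at h1) hσQ (P.Q * (1 + 2 * P.Q))
  have hl₂ : 0 < Real.exp L₂ - 1 := by linarith [Real.add_one_lt_exp h₂.L_pos.ne', h₂.L_pos]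
  have hb₂ : 0 < b₂ := h₂.a_pos.trans h₂.lt
  obtain ⟨S₂, hS₂⟩ := h.isWedge_purchase hσ h₂
  set l₂ := Real.exp L₂ - 1 with hl₂'
  have hden : 0 < 1 + l₂ - l₂ * -b₂ := by linarith [mul_pos hl₂ hb₂]
  have hp₂ : P.Q < b₂ / (1 + l₂ - l₂ * -b₂) := by
    rw [lt_div_iff₀ hden]
    have h3 : P.Q * (1 + b₂) * l₂ ≤ P.Q * (1 + 2 * P.Q) * l₂ :=
      mul_le_mul_of_nonneg_right (mul_le_mul_of_nonneg_left
        (by linarith [h₂.add_le, h₂.a_pos]) hQ0.le) hl₂.le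
    linarith
  obtain ⟨a₁, b₁, L₁, h₁, hL, hb₁⟩ := hsmall _ hp₂
  obtain ⟨S₁, hS₁⟩ := h.isWedge_purchase hσ h₁
  obtain ⟨l₃, p₃, S₃, hl₃, hw₃, hp₃⟩ := h.short_exists_lt hδ hR hε l₂
  have hb₁0 : 0 < b₁ := h₁.a_pos.trans h₁.lt
  have hl₁ : 0 < Real.exp L₁ - 1 := by linarith [Real.add_one_lt_exp h₁.L_pos.ne', h₁.L_pos]
  refine ⟨0, _, l₂, l₃, _, _, _, _, _, _, ?_, hl₃, hS₁, hS₂, hw₃, ?_, ?_⟩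
  · rw [hl₂']; linarith [Real.exp_lt_exp.2 hL]
  · rw [neg_div, neg_div, neg_lt_neg_iff]
    refine lt_of_le_of_lt (div_le_self hb₁0.le ?_) hb₁
    linarith [mul_pos hl₁ hb₁0]
  · rw [neg_div]; linarith

/-! ### The intermediate case -/

theorem intermediate_bounds (h : P.Models ε δ R) (hσ : P.σ = 1) (hQ : P.Q < 1)
    (hw : IsWedge ε δ R lam gam p S) : 0 < p ∧ p < P.Q ∧ P.Q < S ∧ S < 1 := by
  obtain ⟨⟨hl, hg, hg1, -⟩, a, b, hF, rfl, rfl⟩ := hw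
  rw [h.isFreeBoundary_iff_of_pos hσ] at hF
  have ha := hF.2.a_pos
  have haQ := hF.2.a_lt_Q
  have hQb := hF.2.Q_lt_b (by rw [hσ]; exact hQ.ne)
  have hb1 := hF.2.b_lt_one hσ hQ
  have h1 : 0 ≤ lam * (1 - a) := mul_nonneg hl (by linarith)
  have h2 : 0 ≤ gam * (1 - b) := mul_nonneg hg (by linarith)
  have h3 : 0 ≤ gam * b := mul_nonneg hg (by linarith)
  refine ⟨div_pos ha (by linarith), (div_le_self ha.le (by linarith)).trans_lt haQ,
    hQb.trans_le (le_div_self (by linarith) (by linarith) (by linarith)), ?_⟩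
  rw [div_lt_one (by linarith)]
  linarith [mul_pos (sub_pos.2 hg1) (sub_pos.2 hb1)]

theorem intermediate_lt (h : P.Models ε δ R) (hσ : P.σ = 1) (hQ : P.Q < 1)
    {lam₁ lam₂ gam₁ gam₂ p₁ S₁ p₂ S₂ : ℝ} (hl : lam₁ ≤ lam₂) (hg : gam₁ ≤ gam₂)
    (hlt : lam₁ < lam₂ ∨ gam₁ < gam₂) (hw₁ : IsWedge ε δ R lam₁ gam₁ p₁ S₁)
    (hw₂ : IsWedge ε δ R lam₂ gam₂ p₂ S₂) : p₂ < p₁ ∧ S₁ < S₂ := by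
  obtain ⟨⟨hl0, hg0, -, -⟩, a₁, b₁, hF₁, rfl, rfl⟩ := hw₁
  obtain ⟨⟨-, -, hg1, -⟩, a₂, b₂, hF₂, rfl, rfl⟩ := hw₂
  rw [h.isFreeBoundary_iff_of_pos hσ] at hF₁ hF₂
  have hL := Real.log_lt_log (by linarith [hF₁.1])
    ((add_lt_add_iff_left 1).2 (roundTrip_lt hl0 hg1 hl hg hlt))
  exact wedge_lt hl0 hg0 hg1 hl hg hF₂.2.a_pos (hF₁.2.a_lt_of_lt hF₂.2 hL) hF₁.2.lt
    (hF₁.2.b_lt hF₂.2 hL fun _ => hQ) (hF₂.2.b_lt_one hσ hQ)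

end Models

end Params

end MertonTC

theorem mainTheorem3 (ε δ R : ℝ) (hε : ε ≠ 0) (hδ : 0 < δ) (hR : 0 < R) (hR1 : R ≠ 1) :
    -- when the problem is well-posed, the free boundaries exist and are unique
    (∀ ξ : ℝ, 0 < ξ → MertonTC.WellPosed ε δ R ξ →
      ∃! q : ℝ × ℝ, MertonTC.IsFreeBoundary ε δ R ξ q.1 q.2) ∧
    -- (a)(i)
    (∀ ξ₁ ξ₂ a₁ b₁ a₂ b₂ : ℝ, ξ₁ < ξ₂ →
      MertonTC.IsFreeBoundary ε δ R ξ₁ a₁ b₁ → MertonTC.IsFreeBoundary ε δ R ξ₂ a₂ b₂ →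
      a₂ < a₁ ∧ b₁ ≤ b₂) ∧
    -- (a)(ii)
    (δ ^ 2 * R < ε → (∃ ξ : ℝ, 0 < ξ ∧ MertonTC.WellPosed ε δ R ξ) →
      ∃ ξbar qbar : ℝ, MertonTC.IsFreeBoundary ε δ R ξbar 1 qbar ∧
        (∀ ξ b : ℝ, MertonTC.IsFreeBoundary ε δ R ξ 1 b → ξ = ξbar) ∧
        ∀ ξ : ℝ, ξbar ≤ ξ →
          (∃ a : ℝ, MertonTC.IsFreeBoundary ε δ R ξ a qbar) ∧
          ∀ a b : ℝ, MertonTC.IsFreeBoundary ε δ R ξ a b → a ≤ 1 ∧ b = qbar) ∧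
    -- (b)(i)
    (0 < ε → ε < δ ^ 2 * R →
      (∀ lam gam p P : ℝ, MertonTC.IsWedge ε δ R lam gam p P →
        0 < p ∧ p < MertonTC.qM ε δ R ∧ MertonTC.qM ε δ R < P ∧ P < 1) ∧
      (∀ lam₁ lam₂ gam p₁ P₁ p₂ P₂ : ℝ, lam₁ < lam₂ →
        MertonTC.IsWedge ε δ R lam₁ gam p₁ P₁ → MertonTC.IsWedge ε δ R lam₂ gam p₂ P₂ →
        p₂ < p₁ ∧ P₁ < P₂) ∧
      (∀ lam gam₁ gam₂ p₁ P₁ p₂ P₂ : ℝ, gam₁ < gam₂ →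
        MertonTC.IsWedge ε δ R lam gam₁ p₁ P₁ → MertonTC.IsWedge ε δ R lam gam₂ p₂ P₂ →
        p₂ < p₁ ∧ P₁ < P₂)) ∧
    -- (b)(ii), leveraged case
    (δ ^ 2 * R < ε →
      (∀ lam gam p P : ℝ, MertonTC.IsWedge ε δ R lam gam p P → 1 < P) ∧
      ((∃ ξ : ℝ, 0 < ξ ∧ MertonTC.WellPosed ε δ R ξ) →
        ∃ lam gam p P : ℝ, MertonTC.IsWedge ε δ R lam gam p P ∧ P < MertonTC.qM ε δ R) ∧
      ((∀ ξ : ℝ, 0 < ξ → MertonTC.WellPosed ε δ R ξ) →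
        ∃ lam gam₁ gam₂ gam₃ p₁ P₁ p₂ P₂ p₃ P₃ : ℝ, gam₁ < gam₂ ∧ gam₂ < gam₃ ∧
          MertonTC.IsWedge ε δ R lam gam₁ p₁ P₁ ∧ MertonTC.IsWedge ε δ R lam gam₂ p₂ P₂ ∧
          MertonTC.IsWedge ε δ R lam gam₃ p₃ P₃ ∧ P₁ < P₂ ∧ P₃ < P₂)) ∧
    -- (b)(ii), short case
    (ε < 0 →
      (∀ lam gam p P : ℝ, MertonTC.IsWedge ε δ R lam gam p P → p < P ∧ P < 0) ∧
      (∃ lam gam p P : ℝ, MertonTC.IsWedge ε δ R lam gam p P ∧ MertonTC.qM ε δ R < p) ∧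
      ((∀ ξ : ℝ, 0 < ξ → MertonTC.WellPosed ε δ R ξ) →
        ∃ gam lam₁ lam₂ lam₃ p₁ P₁ p₂ P₂ p₃ P₃ : ℝ, lam₁ < lam₂ ∧ lam₂ < lam₃ ∧
          MertonTC.IsWedge ε δ R lam₁ gam p₁ P₁ ∧ MertonTC.IsWedge ε δ R lam₂ gam p₂ P₂ ∧
          MertonTC.IsWedge ε δ R lam₃ gam p₃ P₃ ∧ p₂ < p₁ ∧ p₂ < p₃)) := by
  obtain ⟨P, h, hPQ, hσ⟩ := MertonTC.Params.exists_models hε hδ hR hR1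
  have hd : 0 < δ ^ 2 * R := by positivity
  have hQ1 : δ ^ 2 * R < ε → P.σ = 1 ∧ 1 < P.Q := fun hlt => by
    have hε0 := hd.trans hlt
    refine ⟨hσ.2 hε0, ?_⟩
    rw [hPQ, abs_of_pos hε0, one_lt_div hd]; exact hlt
  have hQ2 : 0 < ε → ε < δ ^ 2 * R → P.σ = 1 ∧ P.Q < 1 := fun hε0 hlt => by
    refine ⟨hσ.2 hε0, ?_⟩
    rw [hPQ, abs_of_pos hε0, div_lt_one hd]; exact hlt
  have hqM : P.σ = 1 → MertonTC.qM ε δ R = P.Q := fun h1 => by rw [h.qM_eq hδ, h1, one_mul]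
  refine ⟨fun ξ hξ hw => h.existsUnique hδ hξ hw,
    fun ξ₁ ξ₂ a₁ b₁ a₂ b₂ hξ h₁ h₂ => h.freeBoundary_monotone hξ h₁ h₂,
    fun hlt ⟨ξ, _, hw⟩ => h.leveraged_freeBoundary hδ (hQ1 hlt).1 (hQ1 hlt).2 hw,
    fun hε0 hlt => ?_, fun hlt => ⟨fun lam gam p S hw => ?_, fun ⟨ξ, _, hw⟩ => ?_, fun hw => ?_⟩,
    fun hε0 => ⟨fun lam gam p S hw => ?_, ?_, fun hw => ?_⟩⟩
  · obtain ⟨h1, hQ⟩ := hQ2 hε0 hlt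
    rw [hqM h1]
    exact ⟨fun lam gam p S hw => h.intermediate_bounds h1 hQ hw,
      fun lam₁ lam₂ gam p₁ S₁ p₂ S₂ hl hw₁ hw₂ =>
        h.intermediate_lt h1 hQ hl.le le_rfl (.inl hl) hw₁ hw₂,
      fun lam gam₁ gam₂ p₁ S₁ p₂ S₂ hg hw₁ hw₂ =>
        h.intermediate_lt h1 hQ le_rfl hg.le (.inr hg) hw₁ hw₂⟩
  · exact h.leveraged_one_lt (hQ1 hlt).1 (hQ1 hlt).2 hw
  · obtain ⟨h1, hQ⟩ := hQ1 hlt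
    obtain ⟨gam, p, S, -, hw', hS⟩ := h.leveraged_exists_lt hδ h1 hQ hw zero_lt_one
    exact ⟨0, gam, p, S, hw', by rwa [hqM h1]⟩
  · exact h.leveraged_not_monotone hδ (hQ1 hlt).1 (hQ1 hlt).2 hw
  · exact h.short_lt (h.σ_eq_neg_one hδ hε0) hw
  · obtain ⟨lam, p, S, -, hw, hp⟩ := h.short_exists_lt hδ hR1 hε0 0
    refine ⟨lam, 0, p, S, hw, ?_⟩
    rwa [h.qM_eq hδ, h.σ_eq_neg_one hδ hε0, neg_one_mul]
  · exact h.short_not_monotone hδ hR1 hε0 hw
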